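/- Let $U$ be a finite-dimensional complex vector superspace with a homogeneous basis $A=A_{\bar 0}\sqcup A_{\bar 1}$, and let $F$ be the SUSY charged free fermion vertex algebra of $U$: the universal enveloping $N_K=1$ SUSY vertex algebra, with odd derivation $D$ and translation operator $\partial=D^2$, generated by $\phi_a$ (of the parity of $a$) and $\phi^{\bar a}$ (of the opposite parity), $a\in A$, with $[\phi_a{}_\Lambda\phi^{\bar b}]=\delta_{ab}$ and $[\phi_a{}_\Lambda\phi_b]=[\phi^{\bar a}{}_\Lambda\phi^{\bar b}]=0$. Let $Y(v,z)$ be the underlying (non-SUSY) state-field correspondence and $[\,{}_\lambda\,]$ its $\lambda$-bracket; products below are normally ordered. For $a\in A_{\bar 0}$ write $(\gamma,c,b,\beta)=(\phi_a,D\phi_a,\phi^{\bar a},D\phi^{\bar a})$, and for $a\in A_{\bar 1}$ write $(\gamma,c,b,\beta)=(\phi^{\bar a},D\phi^{\bar a},\phi_a,D\phi_a)$. Let $(t_a)_{a\in A}$ be complex numbers, $c_{sh}=\sum_{a\in A}(6t_a+3)$, and put $$G^+=\sum_{a\in A} c\beta,\qquad G^-=\sum_{a\in A}\big((t_a+1)\,\partial\gamma\,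 b+t_a\,\gamma\,\partial b\big),\qquad J=\sum_{a\in A}\big((t_a+1)\,cb+t_a\,\gamma\beta\big),$$ $$L=\sum_{a\in A}\tfrac12\big((t_a-1)\,c\,\partial b+(t_a+1)\,\partial c\, b+t_a\,\gamma\,\partial\beta+(t_a+2)\,\partial\gamma\,\beta\big),$$ $$T=\sum_{a\in A_{\bar 0}}\big((t_a+1)\partial\phi_a\phi^{\bar a}+t_a\phi_a\partial\phi^{\bar a}+D\phi_aD\phi^{\bar a}\big)+\sum_{a\in A_{\bar 1}}\big(t_a\partial\phi_a\phi^{\bar a}+(t_a+1)\phi_a\partial\phi^{\bar a}+D\phi_aD\phi^{\bar a}\big),$$ $$D^1=(G^++G^-)_{(0)},\qquad D^2=i\,(G^+-G^-)_{(0)},\qquad P=-iJ .$$ 1. With $Y(v,z,\theta^1,\theta^2)=Y(v,z)+\theta^1Y(D^1v,z)+\theta^2Y(D^2v,z)+\theta^2\theta^1Y(D^1D^2v,z)$, the tuple $(F,|0\rangle,D^1,D^2,Y)$ is an $N_K=2$ SUSY vertex algebra. Moreover $[D^i,D^j]=2\delta_{ij}\partial$, and $D^1=D$ on the vectors $\phi_a,D\phi_a,\phi^{\bar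 a},D\phi^{\bar a}$. 2. Let $[u\,{}_\Lambda v]=-[D^1D^2u\,{}_\lambda v]-\chi^1[D^2u\,{}_\lambda v]+\chi^2[D^1u\,{}_\lambda v]-\chi^1\chi^2[u\,{}_\lambda v]$ be the $N_K=2$ bracket, where $\lambda$ is central and $\chi^i\chi^j+\chi^j\chi^i=-2\delta_{ij}\lambda$. It satisfies $[D^iu\,{}_\Lambda v]=-\chi^i[u\,{}_\Lambda v]$, and $$[P\,{}_\Lambda P]=(2\partial+2\lambda+\chi^1D^1+\chi^2D^2)P+\frac{c_{sh}}{3}\,\lambda\chi^1\chi^2 .$$ 3. The shifted $N=2$ superconformal symmetry is generated by the single $N=2$ superfield of $P$. That is, $T$ and $J$ satisfy, for the $N_K=1$ bracket $[u\,{}_\Lambda v]=[Du\,{}_\lambda v]+\chi[u\,{}_\lambda v]$ with $D=D^1$ and $\chi^2=-\lambda$ (the square of $\chi$), $$[T{}_\Lambda T]=(2\partial+3\lambda+\chi D)T+\tfrac{c_{sh}}{3}\lambda^2\chi,\quad [T{}_\Lambda J]=(2\partial+2\lambda+\chi D)J,\quad [J{}_\Lambda J]=T+\tfrac{c_{sh}}{3}\lambda\chi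 ;$$ one has $T=G^++G^-$ and $$Y(P,z,\theta^1,\theta^2)=-iY(J,z)-i\theta^1Y(G^--G^+,z)-\theta^2Y(T,z)-\theta^2\theta^1Y(2L,z);$$ and the $N_K=2$ SUSY vertex subalgebra generated by $P$ equals both the $N_K=1$ SUSY vertex subalgebra generated by $T$ and $J$ and the vertex subalgebra generated by $L,G^+,G^-,J$. -/

import Mathlib

open scoped TensorProduct VertexOperator

noncomputable section

namespace SusyFree

/-! ## Superspaces, superfields and SUSY vertex algebras -/

/-- The sign `(-1) ^ (i j)` of two parities. -/
def koszul (i j : ZMod 2) : ℂ := (-1) ^ (i.val * j.val)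

section SuperField

/-- An `N`-superfield `a(z, θ¹, …, θᴺ) = ∑_S θ^S a_S(z)` on `V`: the component `a_S(z)` of the
ordered monomial `θ^S = θ^{i₁} ⋯ θ^{iₖ}`, `S = {i₁ < ⋯ < iₖ}`, is an `End V`-valued field
`∑ₙ z^{-n-1} (a_S)[[n]]`. The odd variables are numbered from `0`. -/
abbrev SuperField (N : ℕ) (V : Type*) [AddCommGroup V] [Module ℂ V] : Type _ :=
  Finset (Fin N) → VertexOperator ℂ V

variable {N : ℕ} {V : Type*} [AddCommGroup V] [Module ℂ V]

/-- The sign in `θⁱ θ^S = ± θ^{S ∪ {i}}` for `i ∉ S`. -/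
def thetaSign (i : Fin N) (S : Finset (Fin N)) : ℂ := (-1) ^ (S.filter (· < i)).card

/-- The `n`-th mode of the `θ^S`-component of `(∂_{θⁱ} - θⁱ ∂_z) F`. Here
`∂_z ∑ₙ z^{-n-1} aₙ = ∑ₙ z^{-n-1} (-n) aₙ₋₁`. -/
def superDerivMode (i : Fin N) (F : SuperField N V) (S : Finset (Fin N)) (n : ℤ) :
    Module.End ℂ V :=
  if i ∈ S then -(thetaSign i (S.erase i) • ((-n : ℤ) • (F (S.erase i))[[n - 1]]))
  else thetaSign i S • (F (insert i S))[[n]]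

/-- The `n`-th mode of the `θ^S`-component of the supercommutator `[D, F] = D F - (-1)^q F D`
of an odd endomorphism `D` with a superfield `F` of parity `q`. Its component `F_S` has parity
`q + |S|`, and moving `D` through `θ^S` gives the sign `(-1)^{|S|}`. -/
def superCommMode (D : Module.End ℂ V) (q : ZMod 2) (F : SuperField N V) (S : Finset (Fin N))
    (n : ℤ) : Module.End ℂ V :=
  (-1 : ℂ) ^ S.card • (D * (F S)[[n]] - koszul 1 (q + S.card) • ((F S)[[n]] * D))

/-- `(z - w)^M [a(z), b(w)] = 0` for two fields of parities `q` and `r`, coefficientwise,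
where `[ , ]` is the supercommutator. -/
def LocalAt (M : ℕ) (q r : ZMod 2) (a b : VertexOperator ℂ V) : Prop :=
  ∀ m n : ℤ, ∑ k ∈ Finset.range (M + 1), ((-1 : ℂ) ^ k * (M.choose k : ℂ)) •
    (a[[m + (M - k : ℕ)]] * b[[n + k]] - koszul q r • (b[[n + k]] * a[[m + (M - k : ℕ)]])) = 0

/-- An `N_K = N` SUSY vertex algebra `(V, |0⟩, D¹, …, Dᴺ, Y)`: `grade` is the superspace structure
of `V`. The superfield `Y(a, z, θ)` of `a` of parity `q` has components `Y(a)_S` of parity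
`q + |S|`, and locality `(z - w)^M [Y(a, z, θ), Y(b, w, ζ)] = 0` is imposed on every coefficient
of `θ^S ζ^T`. -/
structure IsSusyVertexAlgebra (grade : ZMod 2 → Submodule ℂ V) (vac : V)
    (D : Fin N → Module.End ℂ V) (Y : V →ₗ[ℂ] SuperField N V) : Prop where
  isInternal : DirectSum.IsInternal grade
  vac_even : vac ∈ grade 0
  D_odd : ∀ i q, ∀ v ∈ grade q, D i v ∈ grade (q + 1)
  Y_parity : ∀ q r, ∀ a ∈ grade q, ∀ v ∈ grade r, ∀ S n,
    ((Y a S)[[n]]) v ∈ grade (q + S.card + r)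
  D_vac : ∀ i, D i vac = 0
  regular : ∀ a S, ∀ n : ℤ, 0 ≤ n → ((Y a S)[[n]]) vac = 0
  creation : ∀ a, ((Y a ∅)[[-1]]) vac = a
  covariance : ∀ q, ∀ a ∈ grade q, ∀ i S n,
    superCommMode (D i) q (Y a) S n = superDerivMode i (Y a) S n
  locality : ∀ q r, ∀ a ∈ grade q, ∀ b ∈ grade r, ∃ M : ℕ, ∀ S T,
    LocalAt M (q + S.card) (r + T.card) (Y a S) (Y b T)

/-- The smallest SUSY vertex subalgebra containing `s`: the smallest subspace that contains
`|0⟩` and `s` and is closed under all `Dⁱ` and all products `a_{(n|S)} b`. -/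
def generated (vac : V) (D : Fin N → Module.End ℂ V) (Y : V →ₗ[ℂ] SuperField N V) (s : Set V) :
    Submodule ℂ V :=
  sInf {W | vac ∈ W ∧ s ⊆ W ∧ (∀ i, ∀ a ∈ W, D i a ∈ W) ∧
    ∀ a ∈ W, ∀ b ∈ W, ∀ S n, ((Y a S)[[n]]) b ∈ W}

/-- The superfield correspondence without odd variables, that is, `Y(v, z)` itself. -/
def superfieldZero (Y : V →ₗ[ℂ] VertexOperator ℂ V) : V →ₗ[ℂ] SuperField 0 V :=
  LinearMap.pi fun _ => Y

/-- `Y(v, z, θ) = Y(v, z) + θ Y(D v, z)`. -/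
def superfieldOne (Y : V →ₗ[ℂ] VertexOperator ℂ V) (D : Fin 1 → Module.End ℂ V) :
    V →ₗ[ℂ] SuperField 1 V :=
  LinearMap.pi fun S => if 0 ∈ S then Y ∘ₗ D 0 else Y

/-- `Y(v, z, θ¹, θ²) = Y(v, z) + θ¹ Y(D¹ v, z) + θ² Y(D² v, z) + θ² θ¹ Y(D¹ D² v, z)`;
note `θ² θ¹ = - θ¹ θ²`. -/
def superfieldTwo (Y : V →ₗ[ℂ] VertexOperator ℂ V) (D : Fin 2 → Module.End ℂ V) :
    V →ₗ[ℂ] SuperField 2 V :=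
  LinearMap.pi fun S =>
    if 0 ∈ S then (if 1 ∈ S then -(Y ∘ₗ D 0 ∘ₗ D 1) else Y ∘ₗ D 0)
    else (if 1 ∈ S then Y ∘ₗ D 1 else Y)

end SuperField

/-! ## `Λ`-brackets -/

section Bracket

/-- The algebra `ℒ_N` generated by an even central `λ` and odd `χ¹, …, χᴺ` with
`χⁱ χʲ + χʲ χⁱ = -2 δᵢⱼ λ`: the Clifford algebra over `ℂ[λ]` of the form `x ↦ -λ ∑ xᵢ²`. -/
abbrev LambdaAlg (N : ℕ) : Type :=
  CliffordAlgebra (QuadraticMap.weightedSumSquares (Polynomial ℂ)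
    (fun _ : Fin N => (-Polynomial.X : Polynomial ℂ)))

/-- The even generator `λ` of `ℒ_N`. -/
def lam (N : ℕ) : LambdaAlg N := algebraMap (Polynomial ℂ) (LambdaAlg N) Polynomial.X

/-- The odd generators `χⁱ` of `ℒ_N`. -/
def chi {N : ℕ} (i : Fin N) : LambdaAlg N :=
  CliffordAlgebra.ι (QuadraticMap.weightedSumSquares (Polynomial ℂ)
    (fun _ : Fin N => (-Polynomial.X : Polynomial ℂ))) (Pi.single i 1)

variable {V : Type*} [AddCommGroup V] [Module ℂ V]

/-- `∑_{j ≥ 0} λʲ / j! ⊗ a_{(j)} v` in `ℒ_N ⊗ V`, a finite sum since `a(z)` is a field. -/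
def lambdaSum (N : ℕ) (a : VertexOperator ℂ V) (v : V) : LambdaAlg N ⊗[ℂ] V :=
  ∑ᶠ j : ℕ, ((j.factorial : ℂ)⁻¹) • ((lam N ^ j) ⊗ₜ[ℂ] (a[[(j : ℤ)]]) v)

/-- The `N_K = 1` bracket
`[u_Λ v] = ∑ⱼ λʲ/j! u_{(j|0)} v + χ ∑ⱼ λʲ/j! u_{(j|1)} v`, where
`Y(u, z, θ) = ∑ z^{-j-1} u_{(j|1)} + θ ∑ z^{-j-1} u_{(j|0)}`. -/
def bracketOne (Y : V →ₗ[ℂ] SuperField 1 V) (u v : V) : LambdaAlg 1 ⊗[ℂ] V :=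
  lambdaSum 1 (Y u {0}) v + chi (0 : Fin 1) • lambdaSum 1 (Y u ∅) v

/-- The `N_K = 2` bracket. For `Y(u, z, θ¹, θ²)` as in `superfieldTwo` this is
`[u_Λ v] = - [D¹D²u_λ v] - χ¹ [D²u_λ v] + χ² [D¹u_λ v] - χ¹χ² [u_λ v]`, the normalization in which
`[Dⁱ u_Λ v] = - χⁱ [u_Λ v]`. -/
def bracketTwo (Y : V →ₗ[ℂ] SuperField 2 V) (u v : V) : LambdaAlg 2 ⊗[ℂ] V :=
  lambdaSum 2 (Y u {0, 1}) v - chi (0 : Fin 2) • lambdaSum 2 (Y u {1}) v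
    + chi (1 : Fin 2) • lambdaSum 2 (Y u {0}) v
    - (chi (0 : Fin 2) * chi (1 : Fin 2)) • lambdaSum 2 (Y u ∅) v

end Bracket

/-! ## The SUSY charged free fermion vertex algebra -/

section Fock

variable {A : Type*}

/-- The vectors `φ_a`, `Dφ_a`, `φ^ā`, `Dφ^ā`, for `a` in a homogeneous basis `A` of `U`. They freely
generate `R = ℋ_{N=1} ⊗ (φ_U ⊕ φ^Ū)` as a `ℂ[∂]`-module. -/
inductive Gen (A : Type*) : Type _
  | phi (a : A)
  | dphi (a : A)
  | phiBar (a : A)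
  | dphiBar (a : A)

/-- Parities: `φ_a` has the parity of `a`, `φ^ā` the opposite one, and `D` is odd. -/
def Gen.parity (p : A → ZMod 2) : Gen A → ZMod 2
  | .phi a => p a
  | .dphi a => p a + 1
  | .phiBar a => p a + 1
  | .dphiBar a => p a

open Classical in
/-- The constants `[x_λ y] = ⟨x, y⟩` of the `λ`-bracket on `R` that underlies the `Λ`-bracket
`[φ_a _Λ φ^b̄] = δ_{ab}`, `[φ_a _Λ φ_b] = [φ^ā _Λ φ^b̄] = 0`. From
`[x_Λ y] = [Dx_λ y] + χ [x_λ y]`, `[x_Λ Dy] = (-1)^{x+1} (D + χ) [x_Λ y]` and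
`[φ^ā _Λ φ_b] = [φ_b _Λ φ^ā]` one reads off the four nonzero cases. -/
def Gen.pairing (p : A → ZMod 2) : Gen A → Gen A → ℂ
  | .dphi a, .phiBar b => if a = b then 1 else 0
  | .phiBar a, .dphi b => if a = b then (-1) ^ (p a).val else 0
  | .phi a, .dphiBar b => if a = b then (-1) ^ (p a + 1).val else 0
  | .dphiBar a, .phi b => if a = b then 1 else 0
  | _, _ => 0

theorem koszul_mul_self (i j : ZMod 2) : koszul i j * koszul i j = 1 := by
  unfold koszul
  rw [← pow_add, ← two_mul, pow_mul]
  norm_num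

theorem koszul_comm (i j : ZMod 2) : koszul i j = koszul j i := by
  unfold koszul
  rw [mul_comm]

theorem Gen.pairing_parity (p : A → ZMod 2) (x y : Gen A) (h : pairing p x y ≠ 0) :
    x.parity p = y.parity p := by
  cases x <;> cases y <;> simp_all [Gen.pairing, Gen.parity]

/-- The commutation relations `x_m y_n - (-1)^{xy} y_n x_m = ⟨x, y⟩ δ_{m+n,-1}` of the modes. -/
inductive ModeRel (p : A → ZMod 2) :
    FreeAlgebra ℂ (Gen A × ℤ) → FreeAlgebra ℂ (Gen A × ℤ) → Prop
  | comm (x y : Gen A) (m n : ℤ) : ModeRel p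
      (FreeAlgebra.ι ℂ (x, m) * FreeAlgebra.ι ℂ (y, n))
      (koszul (x.parity p) (y.parity p) •
          (FreeAlgebra.ι ℂ (y, n) * FreeAlgebra.ι ℂ (x, m))
        + algebraMap ℂ _ (if m + n = -1 then Gen.pairing p x y else 0))

/-- The mode algebra: the enveloping algebra of the Lie superalgebra of modes of `R`, with the
central element set to `1`. -/
def ModeAlg (p : A → ZMod 2) : Type _ := RingQuot (ModeRel p)

instance (p : A → ZMod 2) : Ring (ModeAlg p) := inferInstanceAs (Ring (RingQuot (ModeRel p)))

instance (p : A → ZMod 2) : Algebra ℂ (ModeAlg p) :=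
  inferInstanceAs (Algebra ℂ (RingQuot (ModeRel p)))

/-- The projection from words in the modes to the mode algebra. -/
def ModeAlg.proj (p : A → ZMod 2) : FreeAlgebra ℂ (Gen A × ℤ) →ₐ[ℂ] ModeAlg p :=
  RingQuot.mkAlgHom ℂ (ModeRel p)

/-- A map of the modes that respects the commutation relations extends to the mode algebra. -/
def ModeAlg.lift (p : A → ZMod 2) {B : Type*} [Ring B] [Algebra ℂ B] (f : Gen A × ℤ → B)
    (hf : ∀ (x y : Gen A) (m n : ℤ), f (x, m) * f (y, n) =
      koszul (x.parity p) (y.parity p) • (f (y, n) * f (x, m))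
        + (if m + n = -1 then Gen.pairing p x y else 0) • 1) : ModeAlg p →ₐ[ℂ] B :=
  RingQuot.liftAlgHom ℂ ⟨FreeAlgebra.lift ℂ f, by
    rintro _ _ ⟨x, y, m, n⟩
    rw [map_mul, map_add, map_smul, map_mul, AlgHom.commutes, FreeAlgebra.lift_ι_apply,
      FreeAlgebra.lift_ι_apply, hf, Algebra.algebraMap_eq_smul_one]⟩

/-- The mode `x_n`. -/
def mode (p : A → ZMod 2) (x : Gen A) (n : ℤ) : ModeAlg p :=
  ModeAlg.proj p (FreeAlgebra.ι ℂ (x, n))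

theorem ModeAlg.lift_mode (p : A → ZMod 2) {B : Type*} [Ring B] [Algebra ℂ B]
    (f : Gen A × ℤ → B) (hf) (x : Gen A) (n : ℤ) :
    ModeAlg.lift p f hf (mode p x n) = f (x, n) := by
  unfold ModeAlg.lift mode ModeAlg.proj
  erw [RingQuot.liftAlgHom_mkAlgHom_apply]
  exact FreeAlgebra.lift_ι_apply _ _

/-- The left ideal generated by the modes `x_n`, `n ≥ 0`. -/
def annihilators (p : A → ZMod 2) : Submodule (ModeAlg p) (ModeAlg p) :=
  Submodule.span (ModeAlg p) {r | ∃ (x : Gen A) (n : ℤ), 0 ≤ n ∧ r = mode p x n}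

/-- The space of the SUSY charged free fermion vertex algebra, that is, of the universal enveloping
vertex algebra of `R`: the vacuum module of the mode algebra. -/
def Fch (p : A → ZMod 2) : Type _ := ModeAlg p ⧸ annihilators p

instance (p : A → ZMod 2) : AddCommGroup (Fch p) :=
  inferInstanceAs (AddCommGroup (ModeAlg p ⧸ annihilators p))

instance (p : A → ZMod 2) : Module (ModeAlg p) (Fch p) :=
  inferInstanceAs (Module (ModeAlg p) (ModeAlg p ⧸ annihilators p))

instance (p : A → ZMod 2) : Module ℂ (Fch p) :=
  inferInstanceAs (Module ℂ (ModeAlg p ⧸ annihilators p))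

instance (p : A → ZMod 2) : IsScalarTower ℂ (ModeAlg p) (Fch p) :=
  inferInstanceAs (IsScalarTower ℂ (ModeAlg p) (ModeAlg p ⧸ annihilators p))

/-- The vacuum vector. -/
def vacuum (p : A → ZMod 2) : Fch p := Submodule.Quotient.mk (p := annihilators p) 1

/-- The operator `x_n` on `F^ch`. -/
def modeOp (p : A → ZMod 2) (x : Gen A) (n : ℤ) : Module.End ℂ (Fch p) :=
  Algebra.lsmul ℂ ℂ (Fch p) (mode p x n)

theorem modeOp_apply (p : A → ZMod 2) (x : Gen A) (n : ℤ) (v : Fch p) :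
    modeOp p x n v = mode p x n • v := rfl

theorem mode_mul (p : A → ZMod 2) (x y : Gen A) (m n : ℤ) :
    mode p x m * mode p y n = koszul (x.parity p) (y.parity p) • (mode p y n * mode p x m)
      + (if m + n = -1 then Gen.pairing p x y else 0) • 1 := by
  have h : ModeAlg.proj p _ = ModeAlg.proj p _ :=
    RingQuot.mkAlgHom_rel ℂ (ModeRel.comm (p := p) x y m n)
  rwa [map_mul, map_add, map_smul, map_mul, AlgHom.commutes,
    Algebra.algebraMap_eq_smul_one] at h

theorem modeOp_mul (p : A → ZMod 2) (x y : Gen A) (m n : ℤ) :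
    modeOp p x m * modeOp p y n =
      koszul (x.parity p) (y.parity p) • (modeOp p y n * modeOp p x m)
      + (if m + n = -1 then Gen.pairing p x y else 0) • 1 := by
  unfold modeOp
  rw [← map_mul, mode_mul, map_add, map_smul, map_mul, map_smul, map_one]

theorem Fch.exists_smul (p : A → ZMod 2) (v : Fch p) : ∃ r : ModeAlg p, r • vacuum p = v := by
  obtain ⟨r, rfl⟩ := Submodule.Quotient.mk_surjective (annihilators p) v
  refine ⟨r, ?_⟩
  change r • Submodule.Quotient.mk (p := annihilators p) 1 = _
  rw [← Submodule.Quotient.mk_smul, smul_eq_mul, mul_one]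

theorem modeOp_vacuum (p : A → ZMod 2) (x : Gen A) (n : ℤ) (hn : 0 ≤ n) :
    modeOp p x n (vacuum p) = 0 := by
  change mode p x n • Submodule.Quotient.mk (p := annihilators p) 1 = 0
  rw [← Submodule.Quotient.mk_smul, Submodule.Quotient.mk_eq_zero, smul_eq_mul, mul_one]
  exact Submodule.subset_span ⟨x, n, hn, rfl⟩

/-- Induction on the vacuum module: every vector is a combination of products of modes applied to
the vacuum. -/
theorem Fch.induction (p : A → ZMod 2) (W : Submodule ℂ (Fch p)) (h0 : vacuum p ∈ W)
    (h1 : ∀ x n, ∀ v ∈ W, modeOp p x n v ∈ W) (v : Fch p) : v ∈ W := by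
  have key : ∀ r : FreeAlgebra ℂ (Gen A × ℤ), ∀ v ∈ W, ModeAlg.proj p r • v ∈ W := by
    intro r
    induction r using FreeAlgebra.induction with
    | grade0 c =>
      intro v hv
      rw [AlgHom.commutes, algebraMap_smul]
      exact W.smul_mem c hv
    | grade1 g => exact fun v hv => h1 g.1 g.2 v hv
    | mul a b ha hb =>
      intro v hv
      rw [map_mul, mul_smul]
      exact ha _ (hb _ hv)
    | add a b ha hb =>
      intro v hv
      rw [map_add, add_smul]
      exact W.add_mem (ha _ hv) (hb _ hv)
  obtain ⟨r, rfl⟩ := Fch.exists_smul p v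
  obtain ⟨r, rfl⟩ := RingQuot.mkAlgHom_surjective ℂ (ModeRel p) r
  exact key r _ h0

/-- If a representation `ρ` of the mode algebra on `W` has a vector `w` with `x_n w = 0` for all
`n ≥ 0`, then `r |0⟩ ↦ r w` is a well-defined map on `F^ch`. -/
def Fch.lift (p : A → ZMod 2) {W : Type*} [AddCommGroup W] [Module ℂ W]
    (ρ : ModeAlg p →ₐ[ℂ] Module.End ℂ W) (w : W)
    (hw : ∀ (x : Gen A) (n : ℤ), 0 ≤ n → ρ (mode p x n) w = 0) : Fch p →ₗ[ℂ] W :=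
  ((annihilators p).restrictScalars ℂ).liftQ ((LinearMap.applyₗ w) ∘ₗ ρ.toLinearMap) (by
    intro r hr
    rw [LinearMap.mem_ker]
    change ρ r w = 0
    refine Submodule.span_induction (p := fun r _ => ρ r w = 0) ?_ ?_ ?_ ?_ hr
    · rintro _ ⟨x, n, hn, rfl⟩
      exact hw x n hn
    · rw [map_zero, LinearMap.zero_apply]
    · intro a b _ _ ha hb
      rw [map_add, LinearMap.add_apply, ha, hb, add_zero]
    · intro a b _ hb
      rw [smul_eq_mul, map_mul, Module.End.mul_apply, hb, map_zero]) ∘ₗ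
    (Submodule.Quotient.restrictScalarsEquiv ℂ (annihilators p)).symm.toLinearMap

theorem Fch.lift_vacuum (p : A → ZMod 2) {W : Type*} [AddCommGroup W] [Module ℂ W]
    (ρ : ModeAlg p →ₐ[ℂ] Module.End ℂ W) (w : W) (hw) : Fch.lift p ρ w hw (vacuum p) = w := by
  change ρ 1 w = w
  rw [map_one, Module.End.one_apply]

theorem Fch.lift_modeOp (p : A → ZMod 2) {W : Type*} [AddCommGroup W] [Module ℂ W]
    (ρ : ModeAlg p →ₐ[ℂ] Module.End ℂ W) (w : W) (hw) (x : Gen A) (n : ℤ) (v : Fch p) :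
    Fch.lift p ρ w hw (modeOp p x n v) = ρ (mode p x n) (Fch.lift p ρ w hw v) := by
  obtain ⟨r, rfl⟩ := Submodule.Quotient.mk_surjective (annihilators p) v
  change ρ (mode p x n * r) w = ρ (mode p x n) (ρ r w)
  rw [map_mul, Module.End.mul_apply]

/-! ### Parity -/

/-- The action of the mode algebra on `F^ch` twisted by the parity automorphism
`x_n ↦ (-1)^{x} x_n`. -/
def twistedAction (p : A → ZMod 2) : ModeAlg p →ₐ[ℂ] Module.End ℂ (Fch p) :=
  ModeAlg.lift p (fun g => koszul 1 (g.1.parity p) • modeOp p g.1 g.2) (by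
    intro x y m n
    simp only [smul_mul_smul_comm, modeOp_mul p x y m n, smul_add]
    congr 1
    · rw [smul_comm, mul_comm]
    · by_cases h2 : Gen.pairing p x y = 0
      · simp [h2]
      · rw [Gen.pairing_parity p x y h2, koszul_mul_self, one_smul])

theorem twistedAction_mode (p : A → ZMod 2) (x : Gen A) (n : ℤ) :
    twistedAction p (mode p x n) = koszul 1 (x.parity p) • modeOp p x n :=
  ModeAlg.lift_mode p _ _ x n

/-- The parity operator of `F^ch`: it fixes `|0⟩`, and `x_n` changes it by the sign `(-1)^x`. -/
def parityOp (p : A → ZMod 2) : Module.End ℂ (Fch p) :=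
  Fch.lift p (twistedAction p) (vacuum p) (by
    intro x n hn
    rw [twistedAction_mode, LinearMap.smul_apply, modeOp_vacuum p x n hn]
    exact smul_zero _)

/-- The superspace structure of `F^ch`: the even and the odd subspace. -/
def grade (p : A → ZMod 2) (q : ZMod 2) : Submodule ℂ (Fch p) :=
  LinearMap.ker (parityOp p - koszul 1 q • (1 : Module.End ℂ (Fch p)))

theorem parityOp_vacuum (p : A → ZMod 2) : parityOp p (vacuum p) = vacuum p :=
  Fch.lift_vacuum p _ _ _

theorem parityOp_mul_modeOp (p : A → ZMod 2) (x : Gen A) (n : ℤ) :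
    parityOp p * modeOp p x n = koszul 1 (x.parity p) • (modeOp p x n * parityOp p) := by
  refine LinearMap.ext fun v => ?_
  rw [Module.End.mul_apply, parityOp, Fch.lift_modeOp, twistedAction_mode]
  rfl

theorem parityOp_mul_self (p : A → ZMod 2) : parityOp p * parityOp p = 1 := by
  refine LinearMap.ext fun v => ?_
  have := Fch.induction p (LinearMap.ker (parityOp p * parityOp p - 1))
    (by
      rw [LinearMap.mem_ker, LinearMap.sub_apply, Module.End.mul_apply, parityOp_vacuum,
        parityOp_vacuum, Module.End.one_apply, sub_self]) (by
      intro x n v hv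
      have h := parityOp_mul_modeOp p x n
      have h1 : parityOp p * parityOp p * modeOp p x n
          = modeOp p x n * (parityOp p * parityOp p) := by
        rw [mul_assoc, h, mul_smul_comm, ← mul_assoc, h, smul_mul_assoc, smul_smul,
          koszul_mul_self, one_smul, mul_assoc]
      rw [LinearMap.mem_ker, LinearMap.sub_apply, sub_eq_zero] at hv ⊢
      have h2 := LinearMap.congr_fun h1 v
      rw [Module.End.mul_apply] at h2
      rw [h2, Module.End.mul_apply, hv]
      rfl) v
  rwa [LinearMap.mem_ker, LinearMap.sub_apply, sub_eq_zero] at this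

/-! ### The state-field correspondence -/

/-- The modes of a field are eventually zero on every vector. -/
def Trunc {V : Type*} [AddCommGroup V] [Module ℂ V] (f : ℤ → Module.End ℂ V) : Prop :=
  ∀ v, ∃ N : ℤ, ∀ n, N ≤ n → f n v = 0

/-- The field with given modes. -/
def ofModes {V : Type*} [AddCommGroup V] [Module ℂ V] (f : ℤ → Module.End ℂ V) (hf : Trunc f) :
    VertexOperator ℂ V :=
  VertexOperator.of_coeff (fun k => f (-k - 1)) (by
    intro v
    obtain ⟨N, hN⟩ := hf v
    refine ⟨-N, fun k hk => ?_⟩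
    by_contra h
    exact hk (hN _ (by omega)))

theorem ncoeff_ofModes {V : Type*} [AddCommGroup V] [Module ℂ V] (f : ℤ → Module.End ℂ V)
    (hf : Trunc f) (n : ℤ) : (ofModes f hf)[[n]] = f n := by
  rw [ofModes, VertexOperator.ncoeff_of_coeff]
  congr 1
  omega

theorem trunc_ncoeff {V : Type*} [AddCommGroup V] [Module ℂ V] (a : VertexOperator ℂ V) :
    Trunc (fun n => a[[n]]) := by
  intro v
  refine ⟨-((HahnModule.of ℂ).symm (a v)).order, fun n hn => ?_⟩
  exact VertexOperator.ncoeff_eq_zero_of_lt_order a n v (by omega)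

theorem field_ext {V : Type*} [AddCommGroup V] [Module ℂ V] {a b : VertexOperator ℂ V}
    (h : ∀ n v, (a[[n]]) v = (b[[n]]) v) : a = b := by
  refine HVertexOperator.coeff_inj (funext fun k => LinearMap.ext fun v => ?_)
  rw [VertexOperator.coeff_eq_ncoeff, VertexOperator.coeff_eq_ncoeff, h]

theorem trunc_modeOp (p : A → ZMod 2) (x : Gen A) : Trunc (modeOp p x) := by
  let W : Submodule ℂ (Fch p) :=
    { carrier := {v | ∀ x : Gen A, ∃ N : ℤ, ∀ n, N ≤ n → modeOp p x n v = 0}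
      zero_mem' := fun x => ⟨0, fun n _ => map_zero _⟩
      add_mem' := by
        intro a b ha hb x
        obtain ⟨N, hN⟩ := ha x
        obtain ⟨M, hM⟩ := hb x
        refine ⟨max N M, fun n hn => ?_⟩
        rw [map_add, hN n (le_trans (le_max_left _ _) hn), hM n (le_trans (le_max_right _ _) hn),
          add_zero]
      smul_mem' := by
        intro c a ha x
        obtain ⟨N, hN⟩ := ha x
        exact ⟨N, fun n hn => by rw [map_smul, hN n hn, smul_zero]⟩ }
  intro v
  refine Fch.induction p W ?_ ?_ v x
  · exact fun x => ⟨0, fun n hn => modeOp_vacuum p x n hn⟩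
  · intro y m v hv x
    obtain ⟨N, hN⟩ := hv x
    refine ⟨max N (-m), fun n hn => ?_⟩
    have h := LinearMap.congr_fun (modeOp_mul p x y n m) v
    rw [if_neg (by omega), zero_smul, add_zero] at h
    rw [Module.End.mul_apply] at h
    rw [h, LinearMap.smul_apply, Module.End.mul_apply, hN n (by omega), map_zero, smul_zero]

/-- The free field `x(z) = ∑ₙ z^{-n-1} x_n`. -/
def freeField (p : A → ZMod 2) (x : Gen A) : VertexOperator ℂ (Fch p) :=
  ofModes (modeOp p x) (trunc_modeOp p x)

/-- The `j`-th summand of the `k`-th mode of the `n`-th product of the free field `x(z)` with a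
family of modes `F`; the conjugation by the parity operator produces the sign `(-1)^{x F}`. -/
def prodTerm (p : A → ZMod 2) (x : Gen A) (n : ℤ) (F : ℤ → Module.End ℂ (Fch p)) (k : ℤ) (j : ℕ) :
    Module.End ℂ (Fch p) :=
  ((-1 : ℂ) ^ j * (Ring.choose n j : ℤ)) •
    (modeOp p x (n - j) * F (k + j) - (-1 : ℂ) ^ n •
      (parityOp p ^ (x.parity p).val * F (n + k - j) * parityOp p ^ (x.parity p).val *
        modeOp p x j))

theorem prodTerm_zero (p : A → ZMod 2) (x : Gen A) (n : ℤ) {F : ℤ → Module.End ℂ (Fch p)}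
    (hF : Trunc F) (k : ℤ) (v : Fch p) :
    ∃ N : ℕ, ∀ j : ℕ, N ≤ j → ∀ i : ℕ, prodTerm p x n F (k + i) j v = 0 := by
  obtain ⟨N, hN⟩ := hF v
  obtain ⟨M, hM⟩ := trunc_modeOp p x v
  refine ⟨(max (N - k) M).toNat, fun j hj i => ?_⟩
  simp only [prodTerm, LinearMap.smul_apply, LinearMap.sub_apply, Module.End.mul_apply]
  rw [hN _ (by omega), hM _ (by omega)]
  simp only [map_zero, smul_zero, sub_zero]

theorem finite_support_prodTerm (p : A → ZMod 2) (x : Gen A) (n : ℤ)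
    {F : ℤ → Module.End ℂ (Fch p)} (hF : Trunc F) (k : ℤ) (v : Fch p) :
    (Function.support fun j => prodTerm p x n F k j v).Finite := by
  obtain ⟨N, hN⟩ := prodTerm_zero p x n hF k v
  refine (Set.finite_lt_nat N).subset fun j hj => ?_
  by_contra h
  have := hN j (by simpa using h) 0
  rw [Nat.cast_zero, add_zero] at this
  exact hj this

/-- The `k`-th mode of the `n`-th product `x(w)_{(n)} F(w)`, which is the residue at `z = 0` of
`x(z) F(w) (z - w)^n - (-1)^{x F} F(w) x(z) (z - w)^n`, the two powers being expanded in the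
domains `|z| > |w|` and `|w| > |z|`. -/
def prodMode (p : A → ZMod 2) (x : Gen A) (n : ℤ) (F : ℤ → Module.End ℂ (Fch p)) (hF : Trunc F)
    (k : ℤ) : Module.End ℂ (Fch p) where
  toFun v := ∑ᶠ j : ℕ, prodTerm p x n F k j v
  map_add' v w := by
    rw [← finsum_add_distrib (finite_support_prodTerm p x n hF k v)
      (finite_support_prodTerm p x n hF k w)]
    exact finsum_congr fun j => map_add _ _ _
  map_smul' c v := by
    rw [RingHom.id_apply, smul_finsum]
    exact finsum_congr fun j => map_smul _ _ _

theorem prodMode_eq_sum (p : A → ZMod 2) (x : Gen A) (n : ℤ) (F : ℤ → Module.End ℂ (Fch p))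
    (hF : Trunc F) (k : ℤ) (v : Fch p) (N : ℕ)
    (hN : ∀ j : ℕ, N ≤ j → prodTerm p x n F k j v = 0) :
    prodMode p x n F hF k v = ∑ j ∈ Finset.range N, prodTerm p x n F k j v := by
  refine finsum_eq_sum_of_support_subset _ fun j hj => ?_
  rw [Finset.coe_range]
  by_contra h
  exact hj (hN j (by simpa using h))

theorem prodMode_trunc (p : A → ZMod 2) (x : Gen A) (n : ℤ) (F : ℤ → Module.End ℂ (Fch p))
    (hF : Trunc F) : Trunc (prodMode p x n F hF) := by
  intro v
  obtain ⟨N, hN⟩ := hF v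
  obtain ⟨M, hM⟩ := trunc_modeOp p x v
  have h : ∀ j : ℕ, ∃ K : ℤ, ∀ k, K ≤ k →
      F k ((parityOp p ^ (x.parity p).val) (modeOp p x j v)) = 0 := fun j => hF _
  choose K hK using h
  refine ⟨max N (∑ j ∈ Finset.range M.toNat, |K j - n + j|), fun k hk => ?_⟩
  refine (finsum_congr fun j => ?_).trans finsum_zero
  simp only [prodTerm, LinearMap.smul_apply, LinearMap.sub_apply, Module.End.mul_apply]
  rw [hN _ (by omega)]
  by_cases hj : j < M.toNat
  · have h1 : |K j - n + j| ≤ ∑ j ∈ Finset.range M.toNat, |K j - n + j| :=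
      Finset.single_le_sum (f := fun j : ℕ => |K j - n + j|) (fun j _ => abs_nonneg _)
        (Finset.mem_range.mpr hj)
    have h2 := le_abs_self (K j - n + j)
    rw [hK j _ (by omega)]
    simp only [map_zero, smul_zero, sub_zero]
  · rw [hM _ (by omega)]
    simp only [map_zero, smul_zero, sub_zero]

/-- The `n`-th product with the free field `x(z)`, as an operator on the space of fields. -/
def prodOp (p : A → ZMod 2) (x : Gen A) (n : ℤ) :
    Module.End ℂ (VertexOperator ℂ (Fch p)) where
  toFun a := ofModes (prodMode p x n (fun k => a[[k]]) (trunc_ncoeff a))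
    (prodMode_trunc p x n _ _)
  map_add' a b := field_ext fun k v => by
    rw [map_add (VertexOperator.ncoeff (R := ℂ) (V := Fch p)) (ofModes _ _) (ofModes _ _),
      Pi.add_apply, LinearMap.add_apply, ncoeff_ofModes, ncoeff_ofModes, ncoeff_ofModes]
    refine (finsum_congr fun j => ?_).trans (finsum_add_distrib
      (finite_support_prodTerm p x n (trunc_ncoeff a) k v)
      (finite_support_prodTerm p x n (trunc_ncoeff b) k v))
    simp only [prodTerm, map_add, Pi.add_apply, mul_add, add_mul, LinearMap.smul_apply,
      LinearMap.sub_apply, LinearMap.add_apply, smul_add, smul_sub]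
    abel
  map_smul' c a := field_ext fun k v => by
    rw [map_smul (VertexOperator.ncoeff (R := ℂ) (V := Fch p)) _ (ofModes _ _),
      Pi.smul_apply, LinearMap.smul_apply, ncoeff_ofModes, ncoeff_ofModes]
    refine (finsum_congr fun j => ?_).trans (smul_finsum c _).symm
    simp only [prodTerm, map_smul, Pi.smul_apply, LinearMap.smul_apply,
      LinearMap.sub_apply, smul_sub, mul_smul_comm, smul_mul_assoc, smul_smul]
    ring_nf

theorem prodOp_ncoeff (p : A → ZMod 2) (x : Gen A) (n k : ℤ) (a : VertexOperator ℂ (Fch p)) :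
    (prodOp p x n a)[[k]] = prodMode p x n (fun k => a[[k]]) (trunc_ncoeff a) k :=
  ncoeff_ofModes _ (prodMode_trunc p x n _ (trunc_ncoeff a)) k

theorem parityOp_pow_mul_modeOp (p : A → ZMod 2) (q : ZMod 2) (x : Gen A) (n : ℤ) :
    parityOp p ^ q.val * modeOp p x n =
      koszul (x.parity p) q • (modeOp p x n * parityOp p ^ q.val) := by
  have h : ∀ e : ℕ, parityOp p ^ e * modeOp p x n =
      (koszul 1 (x.parity p)) ^ e • (modeOp p x n * parityOp p ^ e) := by
    intro e
    induction e with
    | zero => simp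
    | succ e ih =>
      rw [pow_succ', mul_assoc, ih, mul_smul_comm, ← mul_assoc, parityOp_mul_modeOp,
        smul_mul_assoc, smul_smul, ← pow_succ, mul_assoc]
  rw [h]
  congr 1
  unfold koszul
  rw [← pow_mul]
  congr 1
  rw [show (1 : ZMod 2).val = 1 from rfl, one_mul]

theorem prod_aux {R : Type*} [Ring R] [Algebra ℂ R] (X X' Y Y' P Q F₁ F₂ F₃ F₄ : R)
    (s κ ε η c d : ℂ) (hs : s * s = 1) (hXY : X * Y = s • (Y * X) + κ • 1)
    (hXY' : X' * Y' = s • (Y' * X')) (hQX : Q * X = s • (X * Q)) (hQX' : Q * X' = s • (X' * Q))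
    (hPY : P * Y = s • (Y * P)) (hPY' : P * Y' = s • (Y' * P)) (hPQ : P * Q = Q * P) :
    c • (X * (d • (Y * F₁ - η • (Q * F₂ * Q * Y')))
        - ε • (P * (d • (Y * F₃ - η • (Q * F₄ * Q * Y'))) * P * X')) =
      s • (d • (Y * (c • (X * F₁ - ε • (P * F₃ * P * X')))
        - η • (Q * (c • (X * F₂ - ε • (P * F₄ * P * X'))) * Q * Y'))) + (c * d * κ) • F₁ := by
  have t1 : X * (Y * F₁) = s • (Y * (X * F₁)) + κ • F₁ := by
    rw [← mul_assoc, hXY, add_mul, smul_mul_assoc, smul_mul_assoc, one_mul, mul_assoc]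
  have t2 : X * (Q * F₂ * Q * Y') = s • (Q * (X * F₂) * Q * Y') := by
    rw [← mul_assoc Q X F₂, hQX]
    simp only [smul_mul_assoc, smul_smul, hs, one_smul, mul_assoc]
  have t3 : P * (Y * F₃) * P * X' = s • (Y * (P * F₃ * P * X')) := by
    rw [← mul_assoc P Y F₃, hPY]
    simp only [smul_mul_assoc, mul_assoc]
  have t4 : P * (Q * F₄ * Q * Y') * P * X' = s • (Q * (P * F₄ * P * X') * Q * Y') := by
    have e1 : Y' * (P * X') = P * (X' * Y') := by
      rw [hXY', mul_smul_comm, ← mul_assoc P Y' X', hPY', smul_mul_assoc, smul_smul, hs, one_smul,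
        mul_assoc]
    have e2 : X' * (Q * Y') = s • (Q * (X' * Y')) := by
      rw [← mul_assoc Q X' Y', hQX', smul_mul_assoc, smul_smul, hs, one_smul, mul_assoc]
    simp only [mul_assoc, e1, e2, mul_smul_comm, smul_smul, hs, one_smul]
    rw [← mul_assoc P Q, hPQ, mul_assoc, ← mul_assoc Q P (X' * Y'), ← hPQ, mul_assoc]
  simp only [mul_smul_comm, smul_mul_assoc, mul_sub, sub_mul, t1, t2, t3, t4]
  module

theorem prodTerm_comm (p : A → ZMod 2) (x y : Gen A) (m n : ℤ) (F : ℤ → Module.End ℂ (Fch p))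
    (k : ℤ) (i j : ℕ) :
    prodTerm p x m (fun l => prodTerm p y n F l j) k i =
      koszul (x.parity p) (y.parity p) • prodTerm p y n (fun l => prodTerm p x m F l i) k j
      + (((-1 : ℂ) ^ i * (Ring.choose m i : ℤ)) * ((-1 : ℂ) ^ j * (Ring.choose n j : ℤ))
          * (if (m - i) + (n - j) = -1 then Gen.pairing p x y else 0)) • F (k + i + j) := by
  simp only [prodTerm]
  rw [show k + (j : ℤ) + i = k + i + j by ring, show n + k - (j : ℤ) + i = n + (k + i) - j by ring,
    show m + (k + (j : ℤ)) - i = m + k - i + j by ring,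
    show m + (n + k - (j : ℤ)) - i = n + (m + k - i) - j by ring]
  refine prod_aux _ _ _ _ _ _ _ _ _ _ _ _ _ _ _ _ (koszul_mul_self _ _) (modeOp_mul p x y _ _)
    ?_ (parityOp_pow_mul_modeOp p _ x _) (parityOp_pow_mul_modeOp p _ x _) ?_ ?_ ?_
  · rw [modeOp_mul, if_neg (by omega), zero_smul, add_zero]
  · rw [koszul_comm]
    exact parityOp_pow_mul_modeOp p _ y _
  · rw [koszul_comm]
    exact parityOp_pow_mul_modeOp p _ y _
  · rw [← pow_add, ← pow_add, add_comm]

theorem prodOp_prodOp_eq_sum (p : A → ZMod 2) (x y : Gen A) (m n k : ℤ)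
    (a : VertexOperator ℂ (Fch p)) (v : Fch p) :
    ∃ N₀ : ℕ, ∀ N : ℕ, N₀ ≤ N → ((prodOp p x m (prodOp p y n a))[[k]]) v =
      ∑ i ∈ Finset.range N, ∑ j ∈ Finset.range N,
        prodTerm p x m (fun l => prodTerm p y n (fun k => a[[k]]) l j) k i v := by
  obtain ⟨N₁, h₁⟩ := prodTerm_zero p x m (trunc_ncoeff (prodOp p y n a)) k v
  obtain ⟨N₂, h₂⟩ := prodTerm_zero p y n (trunc_ncoeff a) k v
  obtain ⟨M, hM⟩ := trunc_modeOp p x v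
  have h₃ := fun i : ℕ => prodTerm_zero p y n (trunc_ncoeff a) (m + k - i)
    ((parityOp p ^ (x.parity p).val) (modeOp p x i v))
  choose N₃ h₃ using h₃
  refine ⟨max (max N₁ N₂) (max M.toNat (∑ i ∈ Finset.range M.toNat, N₃ i)), fun N hN => ?_⟩
  rw [prodOp_ncoeff, prodMode_eq_sum p x m _ _ k v N]
  · refine Finset.sum_congr rfl fun i _ => ?_
    have e1 : ((prodOp p y n a)[[k + i]]) v =
        ∑ j ∈ Finset.range N, prodTerm p y n (fun k => a[[k]]) (k + i) j v := by
      rw [prodOp_ncoeff, prodMode_eq_sum p y n _ _ (k + i) v N]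
      exact fun j hj => h₂ j (by omega) i
    have e2 : ((prodOp p y n a)[[m + k - i]])
          ((parityOp p ^ (x.parity p).val) (modeOp p x i v)) =
        ∑ j ∈ Finset.range N, prodTerm p y n (fun k => a[[k]]) (m + k - i) j
          ((parityOp p ^ (x.parity p).val) (modeOp p x i v)) := by
      by_cases hi : i < M.toNat
      · have h4 : N₃ i ≤ ∑ i ∈ Finset.range M.toNat, N₃ i :=
          Finset.single_le_sum (f := N₃) (fun j _ => Nat.zero_le _) (Finset.mem_range.mpr hi)
        rw [prodOp_ncoeff, prodMode_eq_sum p y n _ _ (m + k - i) _ N]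
        intro j hj
        have := h₃ i j (by omega) 0
        rwa [Nat.cast_zero, add_zero] at this
      · rw [hM _ (by omega), map_zero, map_zero]
        exact (Finset.sum_eq_zero fun j _ => map_zero _).symm
    simp only [prodTerm, LinearMap.smul_apply, LinearMap.sub_apply, Module.End.mul_apply] at e1 e2 ⊢
    rw [e1, e2, ← Finset.smul_sum]
    congr 1
    rw [Finset.sum_sub_distrib, ← Finset.smul_sum, map_sum, map_sum]
  · intro j hj
    have := h₁ j (by omega) 0
    rwa [Nat.cast_zero, add_zero] at this

theorem sum_choose_aux {V : Type*} [AddCommGroup V] [Module ℂ V] (m n : ℤ) (κ : ℂ) (f : ℤ → V)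
    (N : ℕ) (hN : m + n + 1 < N) :
    ∑ i ∈ Finset.range N, ∑ j ∈ Finset.range N,
      (((-1 : ℂ) ^ i * (Ring.choose m i : ℤ)) * ((-1 : ℂ) ^ j * (Ring.choose n j : ℤ))
        * (if (m - i) + (n - j) = -1 then κ else 0)) • f (i + j) =
      (if m + n = -1 then κ else 0) • f 0 := by
  rcases lt_or_ge (m + n + 1) 0 with h | h
  · rw [if_neg (by omega), zero_smul]
    refine Finset.sum_eq_zero fun i _ => Finset.sum_eq_zero fun j _ => ?_
    rw [if_neg (by omega), mul_zero, zero_smul]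
  · obtain ⟨S, hS⟩ := Int.eq_ofNat_of_zero_le h
    rw [← Finset.sum_product']
    rw [← Finset.sum_subset (s₁ := Finset.HasAntidiagonal.antidiagonal S)]
    · have e : ∀ ij ∈ Finset.HasAntidiagonal.antidiagonal S,
          (((-1 : ℂ) ^ ij.1 * (Ring.choose m ij.1 : ℤ)) * ((-1 : ℂ) ^ ij.2 *
            (Ring.choose n ij.2 : ℤ))
            * (if (m - ij.1) + (n - ij.2) = -1 then κ else 0)) • f (ij.1 + ij.2) =
          (((Ring.choose m ij.1 * Ring.choose n ij.2 : ℤ) : ℂ)) • ((-1) ^ S * κ) • f S := by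
        intro ij hij
        rw [Finset.HasAntidiagonal.mem_antidiagonal] at hij
        subst hij
        rw [if_pos (by push_cast at hS; omega), smul_smul]
        push_cast
        congr 1
        rw [pow_add]
        ring
      rw [Finset.sum_congr rfl e, ← Finset.sum_smul, ← Int.cast_sum,
        ← Ring.add_choose_eq S (Commute.all m n)]
      rcases Nat.eq_zero_or_pos S with h0 | h0
      · subst h0
        rw [if_pos (by omega)]
        simp
      · rw [if_neg (by omega), zero_smul, show m + n = ((S - 1 : ℕ) : ℤ) by omega,
          Ring.choose_natCast, Nat.choose_eq_zero_of_lt (by omega)]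
        simp
    · intro ij hij
      rw [Finset.HasAntidiagonal.mem_antidiagonal] at hij
      rw [Finset.mem_product, Finset.mem_range, Finset.mem_range]
      omega
    · intro ij _ hij
      rw [Finset.HasAntidiagonal.mem_antidiagonal] at hij
      rw [if_neg (by omega), mul_zero, zero_smul]

/-- The `n`-th products with the free fields satisfy the relations of the modes. -/
theorem prodOp_mul (p : A → ZMod 2) (x y : Gen A) (m n : ℤ) :
    prodOp p x m * prodOp p y n =
      koszul (x.parity p) (y.parity p) • (prodOp p y n * prodOp p x m)
      + (if m + n = -1 then Gen.pairing p x y else 0) • 1 := by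
  refine LinearMap.ext fun a => field_ext fun k v => ?_
  obtain ⟨N₁, h₁⟩ := prodOp_prodOp_eq_sum p x y m n k a v
  obtain ⟨N₂, h₂⟩ := prodOp_prodOp_eq_sum p y x n m k a v
  set N := max (max N₁ N₂) (m + n + 2).toNat with hN
  have h₁ := h₁ N (by omega)
  have h₂ := h₂ N (by omega)
  rw [LinearMap.add_apply, LinearMap.smul_apply, LinearMap.smul_apply, Module.End.mul_apply,
    Module.End.mul_apply, Module.End.one_apply, map_add, map_smul, map_smul, Pi.add_apply,
    Pi.smul_apply, Pi.smul_apply, LinearMap.add_apply, LinearMap.smul_apply, LinearMap.smul_apply,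
    h₁, h₂]
  have h₃ := sum_choose_aux m n (Gen.pairing p x y) (fun l => (a[[k + l]]) v) N (by omega)
  simp only [add_zero] at h₃
  rw [← h₃, Finset.sum_comm (s := Finset.range N) (t := Finset.range N)
    (f := fun i j => prodTerm p y n (fun l => prodTerm p x m (fun k => a[[k]]) l j) k i v),
    Finset.smul_sum, ← Finset.sum_add_distrib]
  refine Finset.sum_congr rfl fun i _ => ?_
  rw [Finset.smul_sum, ← Finset.sum_add_distrib]
  refine Finset.sum_congr rfl fun j _ => ?_
  rw [prodTerm_comm, LinearMap.add_apply, LinearMap.smul_apply, LinearMap.smul_apply, add_assoc]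

theorem trunc_id (p : A → ZMod 2) :
    Trunc (fun k : ℤ => if k = -1 then (1 : Module.End ℂ (Fch p)) else 0) :=
  fun _ => ⟨0, fun n hn => by simp only [if_neg (show n ≠ -1 by omega), LinearMap.zero_apply]⟩

/-- The identity field `1`, whose only nonzero mode is the one with index `-1`. -/
def idField (p : A → ZMod 2) : VertexOperator ℂ (Fch p) :=
  ofModes (fun k => if k = -1 then 1 else 0) (trunc_id p)

theorem idField_ncoeff (p : A → ZMod 2) (k : ℤ) :
    (idField p)[[k]] = if k = -1 then 1 else 0 := ncoeff_ofModes _ (trunc_id p) k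

theorem prodOp_idField (p : A → ZMod 2) (x : Gen A) (n : ℤ) (hn : 0 ≤ n) :
    prodOp p x n (idField p) = 0 := by
  obtain ⟨n, rfl⟩ := Int.eq_ofNat_of_zero_le hn
  refine field_ext fun k v => ?_
  have hP : ∀ e : ℕ, parityOp p ^ e * parityOp p ^ e = 1 := fun e => by
    rw [← (Commute.refl (parityOp p)).mul_pow, parityOp_mul_self, one_pow]
  rw [prodOp_ncoeff, prodMode_eq_sum p x n _ _ k v (n + 1)]
  · have e : ∀ j ∈ Finset.range (n + 1),
        prodTerm p x n (fun k => (idField p)[[k]]) k j v =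
          (if k + j = -1 then ((-1 : ℂ) ^ j * (n.choose j : ℂ)) • modeOp p x (n - j) v else 0)
          - (if n + k - j = -1 then ((-1 : ℂ) ^ n * (-1) ^ j * (n.choose j : ℂ)) • modeOp p x j v
            else 0) := by
      intro j _
      rw [prodTerm, Ring.choose_natCast, idField_ncoeff, idField_ncoeff]
      split_ifs with h1 h2 h2
      · simp only [mul_one, hP, one_mul, LinearMap.smul_apply, LinearMap.sub_apply, zpow_natCast]
        push_cast
        module
      · simp only [mul_one, mul_zero, zero_mul, smul_zero, sub_zero, LinearMap.smul_apply]
        push_cast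
        rfl
      · simp only [mul_one, hP, one_mul, mul_zero, LinearMap.smul_apply, LinearMap.sub_apply,
          zpow_natCast, LinearMap.zero_apply]
        push_cast
        module
      · simp
    rw [Finset.sum_congr rfl e, Finset.sum_sub_distrib,
      ← Finset.sum_range_reflect (fun j : ℕ => if (n : ℤ) + k - j = -1 then
        ((-1 : ℂ) ^ n * (-1) ^ j * (n.choose j : ℂ)) • modeOp p x j v else 0),
      ← Finset.sum_sub_distrib]
    rw [map_zero, Pi.zero_apply, LinearMap.zero_apply]
    refine Finset.sum_eq_zero fun j hj => ?_
    have hj : j ≤ n := Nat.lt_succ_iff.mp (Finset.mem_range.mp hj)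
    obtain ⟨i, rfl⟩ := Nat.exists_eq_add_of_le hj
    rw [show j + i + 1 - 1 - j = i by omega, Nat.choose_symm_add]
    by_cases h : k + j = -1
    · rw [if_pos h, if_pos (by push_cast; omega), sub_eq_zero,
        show ((j + i : ℕ) : ℤ) - j = i by push_cast; ring, pow_add, mul_assoc ((-1 : ℂ) ^ j),
        ← mul_pow, neg_one_mul, neg_neg, one_pow, mul_one]
    · rw [if_neg h, if_neg (by push_cast; omega), sub_zero]
  · intro j hj
    rw [prodTerm, Ring.choose_natCast, Nat.choose_eq_zero_of_lt (by omega)]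
    simp

/-- The state-field correspondence of `F^ch`: `Y(|0⟩, z) = 1` and
`Y(x_n v, z) = x(z)_{(n)} Y(v, z)`. -/
def stateField (p : A → ZMod 2) : Fch p →ₗ[ℂ] VertexOperator ℂ (Fch p) :=
  Fch.lift p (ModeAlg.lift p (fun g => prodOp p g.1 g.2) (prodOp_mul p)) (idField p) (by
    intro x n hn
    rw [ModeAlg.lift_mode]
    exact prodOp_idField p x n hn)

theorem stateField_vacuum (p : A → ZMod 2) : stateField p (vacuum p) = idField p :=
  Fch.lift_vacuum p _ _ _

theorem stateField_modeOp (p : A → ZMod 2) (x : Gen A) (n : ℤ) (v : Fch p) :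
    stateField p (modeOp p x n v) = prodOp p x n (stateField p v) := by
  rw [stateField, Fch.lift_modeOp, ModeAlg.lift_mode]

/-- The vector `x = x_{-1} |0⟩` of a generator `x`. -/
def vec (p : A → ZMod 2) (x : Gen A) : Fch p := modeOp p x (-1) (vacuum p)

/-- The translation operator `∂ v = v_{(-2)} |0⟩`. -/
def transl (p : A → ZMod 2) : Module.End ℂ (Fch p) where
  toFun v := ((stateField p v)[[-2]]) (vacuum p)
  map_add' u v := by rw [map_add, map_add, Pi.add_apply, LinearMap.add_apply]
  map_smul' c v := by
    rw [map_smul, map_smul, Pi.smul_apply, LinearMap.smul_apply, RingHom.id_apply]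

/-- The normally ordered product `:u v: = u_{(-1)} v`. -/
def nop (p : A → ZMod 2) (u v : Fch p) : Fch p := ((stateField p u)[[-1]]) v

end Fock

/-! ## The shifted superconformal vectors -/

section Vectors

variable {A : Type*}

/-- The vector `γ` attached to `a`: the even one of `φ_a`, `φ^ā`. -/
def gammaVec (p : A → ZMod 2) (a : A) : Fch p :=
  if p a = 0 then vec p (.phi a) else vec p (.phiBar a)

/-- The vector `c = Dγ`. -/
def cVec (p : A → ZMod 2) (a : A) : Fch p :=
  if p a = 0 then vec p (.dphi a) else vec p (.dphiBar a)

/-- The vector `b` attached to `a`: the odd one of `φ_a`, `φ^ā`. -/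
def bVec (p : A → ZMod 2) (a : A) : Fch p :=
  if p a = 0 then vec p (.phiBar a) else vec p (.phi a)

/-- The vector `β = Db`. -/
def betaVec (p : A → ZMod 2) (a : A) : Fch p :=
  if p a = 0 then vec p (.dphiBar a) else vec p (.dphi a)

variable [Fintype A]

/-- The central charge `c_sh = ∑_a (6 t_a + 3)`. -/
def cSh (t : A → ℂ) : ℂ := ∑ a, (6 * t a + 3)

/-- The shifted superconformal vector `T_sh`. -/
def TSh (p : A → ZMod 2) (t : A → ℂ) : Fch p :=
  ∑ a, if p a = 0 then
      (t a + 1) • nop p (transl p (vec p (.phi a))) (vec p (.phiBar a))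
        + t a • nop p (vec p (.phi a)) (transl p (vec p (.phiBar a)))
        + nop p (vec p (.dphi a)) (vec p (.dphiBar a))
    else
      t a • nop p (transl p (vec p (.phi a))) (vec p (.phiBar a))
        + (t a + 1) • nop p (vec p (.phi a)) (transl p (vec p (.phiBar a)))
        + nop p (vec p (.dphi a)) (vec p (.dphiBar a))

/-- The shifted current `J_sh = J_st + J_ghost`. -/
def JSh (p : A → ZMod 2) (t : A → ℂ) : Fch p :=
  (∑ a, if p a = 0 then nop p (vec p (.dphi a)) (vec p (.phiBar a))
    else nop p (vec p (.dphiBar a)) (vec p (.phi a)))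
  + ∑ a, t a • if p a = 0 then
      nop p (vec p (.dphi a)) (vec p (.phiBar a)) + nop p (vec p (.phi a)) (vec p (.dphiBar a))
    else
      nop p (vec p (.dphiBar a)) (vec p (.phi a)) + nop p (vec p (.phiBar a)) (vec p (.dphi a))

/-- `G⁺_sh = ∑_a cβ`. -/
def GPlusSh (p : A → ZMod 2) : Fch p := ∑ a, nop p (cVec p a) (betaVec p a)

/-- `G⁻_sh = ∑_a (t_a + 1) ∂γ b + t_a γ ∂b`. -/
def GMinusSh (p : A → ZMod 2) (t : A → ℂ) : Fch p :=
  ∑ a, ((t a + 1) • nop p (transl p (gammaVec p a)) (bVec p a)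
    + t a • nop p (gammaVec p a) (transl p (bVec p a)))

/-- `L_sh = ∑_a ½ ((t_a - 1) c∂b + (t_a + 1) ∂c b + t_a γ∂β + (t_a + 2) ∂γ β)`. -/
def LSh (p : A → ZMod 2) (t : A → ℂ) : Fch p :=
  ∑ a, (2⁻¹ : ℂ) • ((t a - 1) • nop p (cVec p a) (transl p (bVec p a))
    + (t a + 1) • nop p (transl p (cVec p a)) (bVec p a)
    + t a • nop p (gammaVec p a) (transl p (betaVec p a))
    + (t a + 2) • nop p (transl p (gammaVec p a)) (betaVec p a))

/-- `D¹ = (G⁺ + G⁻)_{(0)}` and `D² = i (G⁺ - G⁻)_{(0)}`. -/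
def DSh (p : A → ZMod 2) (t : A → ℂ) : Fin 2 → Module.End ℂ (Fch p) :=
  ![(stateField p (GPlusSh p + GMinusSh p t))[[0]],
    Complex.I • (stateField p (GPlusSh p - GMinusSh p t))[[0]]]

/-- `P_sh = -i J_sh`. -/
def PSh (p : A → ZMod 2) (t : A → ℂ) : Fch p := -Complex.I • JSh p t

/-- The `N_K = 2` superfield correspondence of `F^ch` built from `D¹` and `D²`. -/
def YTwo (p : A → ZMod 2) (t : A → ℂ) : Fch p →ₗ[ℂ] SuperField 2 (Fch p) :=
  superfieldTwo (stateField p) (DSh p t)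

/-- The `N_K = 1` superfield correspondence of `F^ch` built from `D = D¹`. -/
def YOne (p : A → ZMod 2) (t : A → ℂ) : Fch p →ₗ[ℂ] SuperField 1 (Fch p) :=
  superfieldOne (stateField p) ![DSh p t 0]

end Vectors

end SusyFree

end

open scoped TensorProduct VertexOperator

noncomputable section

namespace SusyFree

/-! ### Modes of products with a free field, and Koszul signs as conjugations -/

section Modes

open Filter Finset

variable {A : Type*}

/-! ### Twisting by the parity operator -/

/-! The space is the vacuum module of a Heisenberg–Clifford type mode algebra, and its fields are
defined by the recursion $Y(x_k v) = x(z)_{(k)} Y(v)$. Since every vector arises from the vacuum by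
applying modes, an identity that is linear in $v$ is proved by checking it on the vacuum and showing
that it survives $v \mapsto x_k v$ (`Fch.induction`). The vertex algebra facts are obtained this
way: the commutator formula $[x_m, v_n] = \sum_j \binom{m}{j} (x_j v)_{m+n-j}$
(`modeOp_commutator`), Dong's lemma in the form that any two fields are mutually local
(`modes_local`), translation covariance (`modes_transl`), and the principle that an odd operator
which kills the vacuum and acts suitably on the free fields is a derivation of all fields
(`modes_derivation`). Behind the first two lie identities for the two expansions of $(z-w)^k$,
written coefficientwise with binomials.

The vectors $G^\pm$, $J$, $L$ are quadratic in the generators, so by the commutator formula the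
commutator of any of their modes with a free mode is again linear in free modes. This gives the four
action tables `modes_GPlusSh_modeOp`, `modes_GMinusSh_modeOp`, `modes_JSh_modeOp` and
`modes_LSh_modeOp`, from which all products among $G^\pm$, $J$, $L$ that are needed follow by
evaluating on quadratic vectors. In $G^-$ and $L$ the parameter $t_a$ multiplies only total
derivatives. Hence the zero modes do not see it: $G^+_{(0)}$ sends $\gamma \mapsto c$, $b \mapsto
\beta$, and $G^-_{(0)}$ sends $c \mapsto \partial\gamma$, $\beta \mapsto \partial b$, while $L_{(0)}
= \partial$. The shift shows up in the higher products, where each $a$ contributes $(t_a+1)^2 -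
t_a^2 = 2t_a + 1$, and these add up to $c_{sh}/3$.

Any combination $\alpha G^+_{(0)} + \alpha' G^-_{(0)}$ is an odd derivation, and two of them
anticommute to $(\alpha\delta' + \alpha'\delta)\,\partial$ (`oddOp_anticommutator`). The choices
$(1,1)$ and $(i,-i)$ give $D^1$ and $D^2$ with $[D^i, D^j] = 2\delta_{ij}\partial$. The $N_K = 2$
axioms then reduce to facts about ordinary fields, because each component of a superfield is the
field of a vector obtained by applying the $D^i$.

Since $D^2 P = -T$, $D^1 P = -i(G^- - G^+)$ and $-D^1D^2P = D^1 T = 2L$, the superfield of $P$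
contains all four currents. Its bracket is assembled from the products of $2L$, $T$, $G^- - G^+$ and
$J$ with $J$. For the generated subalgebras, all three descriptions cut out the same family of
subspaces: one that contains $G^\pm$ and is closed under products is automatically stable under the
$D^i$, as these are zero modes of $G^\pm$. -/

theorem parityOp_pow_mul_pow (p : A → ZMod 2) (e : ℕ) :
    parityOp p ^ e * parityOp p ^ e = 1 := by
  rw [← (Commute.refl (parityOp p)).mul_pow, parityOp_mul_self, one_pow]

/-- Conjugation of an operator by the `q`-th power of the parity operator. -/
def twist (p : A → ZMod 2) (q : ZMod 2) : Module.End ℂ (Fch p) →ₐ[ℂ] Module.End ℂ (Fch p) :=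
  AlgHom.ofLinearMap
    { toFun := fun B => parityOp p ^ q.val * B * parityOp p ^ q.val
      map_add' := fun B C => by rw [mul_add, add_mul]
      map_smul' := fun c B => by rw [mul_smul_comm, smul_mul_assoc, RingHom.id_apply] }
    (by simp [parityOp_pow_mul_pow])
    (by
      intro B C
      change _ * (B * C) * _ = (_ * B * _) * (_ * C * _)
      rw [mul_assoc (_ * B), mul_assoc _ C, ← mul_assoc _ _ (C * _), parityOp_pow_mul_pow,
        one_mul, mul_assoc _ B, ← mul_assoc B, ← mul_assoc, ← mul_assoc, ← mul_assoc])

theorem twist_apply (p : A → ZMod 2) (q : ZMod 2) (B : Module.End ℂ (Fch p)) :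
    twist p q B = parityOp p ^ q.val * B * parityOp p ^ q.val := rfl

theorem twist_zero (p : A → ZMod 2) (B : Module.End ℂ (Fch p)) : twist p 0 B = B := by
  simp [twist_apply]

theorem twist_twist (p : A → ZMod 2) (q r : ZMod 2) (B : Module.End ℂ (Fch p)) :
    twist p q (twist p r B) = twist p (q + r) B := by
  have h := parityOp_mul_self p
  have h' : parityOp p * (parityOp p * B * parityOp p) * parityOp p = B := by
    rw [mul_assoc (parityOp p) B, ← mul_assoc, h, one_mul, mul_assoc, h, mul_one]
  have v1 : (1 : ZMod 2).val = 1 := rfl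
  have e : (1 : ZMod 2) + 1 = 0 := rfl
  have h01 : ∀ s : ZMod 2, s = 0 ∨ s = 1 := by decide
  rcases h01 q with rfl | rfl <;> rcases h01 r with rfl | rfl <;> simp [twist_apply, v1, e, h']

theorem twist_self (p : A → ZMod 2) (q : ZMod 2) (B : Module.End ℂ (Fch p)) :
    twist p q (twist p q B) = B := by
  rw [twist_twist, CharTwo.add_self_eq_zero, twist_zero]

theorem twist_comm (p : A → ZMod 2) (q r : ZMod 2) (B : Module.End ℂ (Fch p)) :
    twist p q (twist p r B) = twist p r (twist p q B) := by
  rw [twist_twist, twist_twist, add_comm]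

theorem twist_modeOp (p : A → ZMod 2) (q : ZMod 2) (x : Gen A) (n : ℤ) :
    twist p q (modeOp p x n) = koszul (x.parity p) q • modeOp p x n := by
  rw [twist_apply, parityOp_pow_mul_modeOp, smul_mul_assoc, mul_assoc, parityOp_pow_mul_pow,
    mul_one]

/-! ### The modes of the `n`-th product -/

/-- The modes of the field of a vector. -/
def modes (p : A → ZMod 2) : Fch p →ₗ[ℂ] ℤ → Module.End ℂ (Fch p) :=
  VertexOperator.ncoeff ∘ₗ stateField p

theorem modes_apply (p : A → ZMod 2) (v : Fch p) (n : ℤ) :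
    modes p v n = (stateField p v)[[n]] := rfl

/-- The `j`-th summand of the `k`-th mode of the `n`-th product of two families of modes, the
first one being of parity `q`. -/
def productTerm (p : A → ZMod 2) (W : ℤ → Module.End ℂ (Fch p)) (q : ZMod 2) (n : ℤ)
    (F : ℤ → Module.End ℂ (Fch p)) (k : ℤ) (j : ℕ) : Module.End ℂ (Fch p) :=
  ((-1 : ℂ) ^ j * (Ring.choose n j : ℤ)) •
    (W (n - j) * F (k + j) - (-1 : ℂ) ^ n • (twist p q (F (n + k - j)) * W j))

theorem modes_trunc (p : A → ZMod 2) (v : Fch p) : Trunc (modes p v) :=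
  trunc_ncoeff (stateField p v)

theorem eventually_modeOp_eq_zero (p : A → ZMod 2) (x : Gen A) (v : Fch p) :
    ∀ᶠ M : ℕ in atTop, ∀ j : ℕ, M ≤ j → modeOp p x j v = 0 := by
  obtain ⟨N, hN⟩ := trunc_modeOp p x v
  filter_upwards [eventually_ge_atTop N.toNat] with M hM j hj
  exact hN _ (by omega)

/-- The product is an infinite sum that is finite on each vector. Stating it for all large cutoffs,
rather than for one, allows several such sums to be truncated at a common cutoff and compared term
by term. -/
theorem modes_modeOp (p : A → ZMod 2) (x : Gen A) (k : ℤ) (v : Fch p) (n : ℤ) (w : Fch p) :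
    ∀ᶠ N : ℕ in atTop, modes p (modeOp p x k v) n w =
      ∑ i ∈ range N, productTerm p (modeOp p x) (x.parity p) k (modes p v) n i w := by
  obtain ⟨N₀, h⟩ := prodTerm_zero p x k (modes_trunc p v) n w
  filter_upwards [eventually_ge_atTop N₀] with N hN
  rw [modes_apply, stateField_modeOp, prodOp_ncoeff, prodMode_eq_sum _ _ _ _ _ _ _ N]
  · rfl
  · intro j hj
    have := h j (by omega) 0
    rwa [Nat.cast_zero, add_zero] at this

theorem modes_vacuum (p : A → ZMod 2) (n : ℤ) :
    modes p (vacuum p) n = if n = -1 then 1 else 0 := by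
  rw [modes_apply, stateField_vacuum, idField_ncoeff]

/-- The commutator of an operator with a summand of the `k`-th product with a free field. -/
theorem commutator_productTerm (p : A → ZMod 2) (U : Module.End ℂ (Fch p)) (q : ZMod 2)
    (y : Gen A) (k : ℤ) (F : ℤ → Module.End ℂ (Fch p)) (n : ℤ) (i : ℕ)
    (C₁ C₂ : Module.End ℂ (Fch p))
    (hU : twist p (y.parity p) U = koszul (y.parity p) q • U)
    (h₁ : U * modeOp p y (k - i) = koszul (y.parity p) q • (modeOp p y (k - i) * U) + C₁)
    (h₂ : U * modeOp p y i = koszul (y.parity p) q • (modeOp p y i * U) + C₂) :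
    U * productTerm p (modeOp p y) (y.parity p) k F n i
      - twist p q (productTerm p (modeOp p y) (y.parity p) k F n i) * U =
    koszul (y.parity p) q • productTerm p (modeOp p y) (y.parity p) k
        (fun l => U * F l - twist p q (F l) * U) n i
      + ((-1 : ℂ) ^ i * (Ring.choose k i : ℤ)) • (C₁ * F (n + i)
        - (-1 : ℂ) ^ k • (twist p q (twist p (y.parity p) (F (k + n - i))) * C₂)) := by
  have hs := koszul_mul_self (y.parity p) q
  have ty := twist_modeOp p q y
  set s := koszul (y.parity p) q
  set r := y.parity p
  have hU' : U = s • twist p r U := by rw [hU, smul_smul, hs, one_smul]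
  have t1 : ∀ B, U * (modeOp p y (k - i) * B) = s • (modeOp p y (k - i) * (U * B)) + C₁ * B := by
    intro B
    rw [← mul_assoc, h₁, add_mul, smul_mul_assoc, mul_assoc]
  have t3 : ∀ B, U * (twist p r B * modeOp p y i) = s • (twist p r (U * B) * modeOp p y i) := by
    intro B
    rw [map_mul, ← mul_assoc, hU, smul_mul_assoc, smul_mul_assoc, smul_smul, hs, one_smul]
  -- This moves `U` to the left of the annihilating mode so that the supercommutator of `U` with `B`
  -- can form inside the conjugation; the term with `C₂` is the price.
  have t4 : ∀ B, twist p q (twist p r B) * (modeOp p y i * U) =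
      twist p r (twist p q B * U) * modeOp p y i
        - s • (twist p q (twist p r B) * C₂) := by
    intro B
    have e : modeOp p y i * U = s • (U * modeOp p y i) - s • C₂ := by
      rw [h₂, smul_add, smul_smul, hs, one_smul, add_sub_cancel_right]
    rw [e, mul_sub, mul_smul_comm, mul_smul_comm, map_mul, hU, twist_comm p r q, mul_smul_comm,
      smul_mul_assoc, mul_assoc]
  simp only [productTerm, map_smul, map_sub, map_mul, mul_smul_comm, smul_mul_assoc, mul_sub,
    sub_mul, mul_assoc, t1, t3, ty, t4, smul_smul]
  simp only [smul_sub, smul_add, smul_smul, mul_assoc]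
  have hs' : s ^ 2 = 1 := by rw [sq, hs]
  match_scalars <;> (ring_nf; try simp only [hs', mul_one])

end Modes

/-! ### The commutator formula for a free field -/

section Commutator

open Filter Finset

variable {A : Type*}

theorem choose_neg_succ (K r : ℕ) :
    Ring.choose (-((K : ℤ) + 1)) r = (-1) ^ r * ((K + r).choose r : ℤ) := by
  rw [Ring.choose_neg, Units.smul_def, smul_eq_mul, Int.negOnePow_def, zpow_natCast,
    show (K : ℤ) + 1 + r - 1 = ((K + r : ℕ) : ℤ) by push_cast; ring, Ring.choose_natCast]
  push_cast
  rfl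

theorem sum_range_mul_ite_eq (f : ℕ → ℂ) (κ : ℂ) (a : ℤ) (N : ℕ) (h : a < N) :
    ∑ i ∈ range N, f i * (if (i : ℤ) = a then κ else 0) = if 0 ≤ a then f a.toNat * κ else 0 := by
  split_ifs with h0
  · rw [sum_eq_single a.toNat]
    · rw [if_pos (by omega)]
    · intro i _ hi
      rw [if_neg (by omega), mul_zero]
    · intro hi
      exact absurd (mem_range.2 (by omega)) hi
  · exact sum_eq_zero fun i _ => by rw [if_neg (by omega), mul_zero]

/-- The expansions of $(z-w)^k$ in $|z|>|w|$ and in $|w|>|z|$ agree for $k \ge 0$, and for $k<0$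
differ by the divided derivative of order $-1-k$ of the delta function. The two sides are the
coefficients of $z^{-m-1} w^{m+k+1}$. In the commutator formula the left side collects the
contractions inside the product field, the right side those inside the vectors $x_j y_k v$. -/
theorem choose_contraction (m k : ℤ) :
    (if 0 ≤ m + k + 1 then ((-1 : ℂ) ^ (m + k + 1).toNat * (Ring.choose k (m + k + 1).toNat : ℤ))
        else 0)
      - (-1 : ℂ) ^ k * (if 0 ≤ -1 - m then
          ((-1 : ℂ) ^ (-1 - m).toNat * (Ring.choose k (-1 - m).toNat : ℤ)) else 0) =
    if 0 ≤ -1 - k then ((Ring.choose m (-1 - k).toNat : ℤ) : ℂ) else 0 := by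
  rcases lt_or_ge k 0 with hk | hk
  · obtain ⟨K, hK⟩ : ∃ K : ℕ, k = -((K : ℤ) + 1) := ⟨(-1 - k).toNat, by omega⟩
    have e1 : (-1 - k).toNat = K := by omega
    have e2 : (-1 : ℂ) ^ k = - (-1) ^ K := by
      rw [hK, zpow_neg, ← inv_zpow, show ((-1 : ℂ))⁻¹ = -1 by norm_num]
      norm_cast
      rw [pow_succ]
      push_cast
      ring
    have hs : ∀ e : ℕ, ((-1 : ℂ) ^ e) ^ 2 = 1 := fun e => by rw [← pow_mul, mul_comm, pow_mul]; simp
    rw [if_pos (by omega : 0 ≤ -1 - k), e1, e2]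
    rcases lt_or_ge m 0 with hm | hm
    · obtain ⟨M, hM⟩ : ∃ M : ℕ, m = -((M : ℤ) + 1) := ⟨(-1 - m).toNat, by omega⟩
      have e3 : (-1 - m).toNat = M := by omega
      rw [if_neg (by omega), if_pos (by omega), e3, hK, hM, choose_neg_succ, choose_neg_succ,
        show (M + K).choose K = (K + M).choose M by rw [add_comm, Nat.choose_symm_add] ]
      push_cast
      linear_combination (-1 : ℂ) ^ K * ((K + M).choose M : ℂ) * hs M
    · obtain ⟨M, rfl⟩ := Int.eq_ofNat_of_zero_le hm
      rw [if_neg (by omega : ¬ (0 ≤ -1 - (M : ℤ)))]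
      rw [Ring.choose_natCast]
      rcases le_or_gt K M with h | h
      · obtain ⟨r, rfl⟩ := Nat.exists_eq_add_of_le h
        rw [if_pos (by omega), show (((K + r : ℕ) : ℤ) + k + 1).toNat = r by omega, hK,
          choose_neg_succ, Nat.choose_symm_add]
        push_cast
        linear_combination ((K + r).choose r : ℂ) * hs r
      · rw [if_neg (by omega), Nat.choose_eq_zero_of_lt h]
        simp
  · obtain ⟨K, rfl⟩ := Int.eq_ofNat_of_zero_le hk
    rw [if_neg (by omega : ¬ (0 ≤ -1 - (K : ℤ)))]
    simp only [Ring.choose_natCast, zpow_natCast]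
    rcases lt_or_ge m 0 with hm | hm
    · obtain ⟨M, hM⟩ : ∃ M : ℕ, m = -((M : ℤ) + 1) := ⟨(-1 - m).toNat, by omega⟩
      have e3 : (-1 - m).toNat = M := by omega
      rw [if_pos (by omega : 0 ≤ -1 - m), e3]
      rcases le_or_gt M K with h | h
      · obtain ⟨r, rfl⟩ := Nat.exists_eq_add_of_le h
        have hs : ((-1 : ℂ) ^ M) ^ 2 = 1 := by rw [← pow_mul, mul_comm, pow_mul]; simp
        rw [if_pos (by omega), show (m + ((M + r : ℕ) : ℤ) + 1).toNat = r by omega,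
          ← Nat.choose_symm_add, pow_add]
        push_cast
        linear_combination -(-1 : ℂ) ^ r * ((M + r).choose M : ℂ) * hs
      · rw [if_neg (by omega), Nat.choose_eq_zero_of_lt h]
        simp
    · rw [if_pos (by omega), if_neg (by omega), Nat.choose_eq_zero_of_lt (by omega)]
      simp

/-- A nonzero pairing forces equal parities, so the two conjugations cancel. -/
theorem twist_twist_pairing (p : A → ZMod 2) (x y : Gen A) (B : Module.End ℂ (Fch p)) :
    Gen.pairing p x y • twist p (x.parity p) (twist p (y.parity p) B) =
      Gen.pairing p x y • B := by
  by_cases h : Gen.pairing p x y = 0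
  · simp [h]
  · rw [Gen.pairing_parity p x y h, twist_self]

theorem modeOp_modeOp_apply (p : A → ZMod 2) (x y : Gen A) (m n : ℤ) (v : Fch p) :
    modeOp p x m (modeOp p y n v) =
      koszul (x.parity p) (y.parity p) • modeOp p y n (modeOp p x m v)
      + (if m + n = -1 then Gen.pairing p x y else 0) • v := by
  rw [← Module.End.mul_apply, modeOp_mul, LinearMap.add_apply, LinearMap.smul_apply,
    LinearMap.smul_apply, Module.End.mul_apply, Module.End.one_apply]

/-- Each summand of a product depends linearly on the second field and only translates its index, so
it commutes with taking combinations of index shifts. -/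
theorem productTerm_sum (p : A → ZMod 2) (W : ℤ → Module.End ℂ (Fch p)) (q : ZMod 2) (n : ℤ)
    {ι : Type*} (s : Finset ι) (c : ι → ℂ) (F : ι → ℤ → Module.End ℂ (Fch p)) (d : ι → ℤ)
    (k : ℤ) (j : ℕ) :
    productTerm p W q n (fun l => ∑ i ∈ s, c i • F i (l + d i)) k j =
      ∑ i ∈ s, c i • productTerm p W q n (F i) (k + d i) j := by
  simp only [productTerm, map_sum, mul_sum, sum_mul, map_smul, mul_smul_comm, smul_mul_assoc,
    smul_sum, smul_sub, ← sum_sub_distrib]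
  refine sum_congr rfl fun i _ => ?_
  rw [show k + (j : ℤ) + d i = k + d i + j by ring,
    show n + k - (j : ℤ) + d i = n + (k + d i) - j by ring]
  module

/-- The commutator formula for a free field and the field of an arbitrary vector. -/
theorem modeOp_commutator (p : A → ZMod 2) (x : Gen A) (v : Fch p) (m n : ℤ) (M : ℕ)
    (hM : ∀ j : ℕ, M ≤ j → modeOp p x j v = 0) :
    modeOp p x m * modes p v n - twist p (x.parity p) (modes p v n) * modeOp p x m =
      ∑ j ∈ range M, ((Ring.choose m j : ℤ) : ℂ) • modes p (modeOp p x j v) (n + (m - j)) := by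
  -- Raising the cutoff beyond the first vanishing index adds only zeros. This lets the induction
  -- run with the statement for all large cutoffs.
  have stable : ∀ v m n (M M' : ℕ), M ≤ M' → (∀ j : ℕ, M ≤ j → modeOp p x j v = 0) →
      ∑ j ∈ range M', ((Ring.choose m j : ℤ) : ℂ) • modes p (modeOp p x j v) (n + (m - j)) =
      ∑ j ∈ range M, ((Ring.choose m j : ℤ) : ℂ) • modes p (modeOp p x j v) (n + (m - j)) := by
    intro v m n M M' h hM
    refine (sum_subset (range_mono h) fun j _ hj => ?_).symm
    rw [hM j (by simpa using hj), map_zero, Pi.zero_apply, smul_zero]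
  let W : Submodule ℂ (Fch p) :=
    { carrier := {v | ∀ m n : ℤ, ∀ᶠ M : ℕ in atTop,
        modeOp p x m * modes p v n - twist p (x.parity p) (modes p v n) * modeOp p x m =
        ∑ j ∈ range M, ((Ring.choose m j : ℤ) : ℂ) • modes p (modeOp p x j v) (n + (m - j))}
      zero_mem' := fun m n => by simp
      add_mem' := by
        intro a b ha hb m n
        filter_upwards [ha m n, hb m n] with M h1 h2
        simp only [map_add, Pi.add_apply, mul_add, add_mul, smul_add, sum_add_distrib, ← h1, ← h2]
        abel
      smul_mem' := by
        intro c a ha m n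
        filter_upwards [ha m n] with M h1
        simp only [map_smul, Pi.smul_apply, mul_smul_comm, smul_mul_assoc]
        rw [← smul_sub, h1, smul_sum]
        exact sum_congr rfl fun j _ => smul_comm _ _ _ }
  suffices hW : ∀ v, v ∈ W by
    obtain ⟨M', h1, h2⟩ := ((hW v m n).and (eventually_ge_atTop M)).exists
    rw [h1, stable v m n M M' h2 hM]
  refine Fch.induction p W ?_ ?_
  · intro m n
    refine Eventually.of_forall fun M => ?_
    rw [modes_vacuum, sum_eq_zero fun j _ => by
      rw [modeOp_vacuum p x j (by positivity), map_zero, Pi.zero_apply, smul_zero] ]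
    split_ifs <;> simp
  · intro y k v hv m n
    -- The cutoff has to exceed $-1-k$, because $x_j$ contracts with $y_k$ exactly at $j = -1-k$.
    filter_upwards [eventually_modeOp_eq_zero p x v, eventually_gt_atTop (-1 - k).toNat]
      with M hM hMk
    have hv' : ∀ m n : ℤ,
        modeOp p x m * modes p v n - twist p (x.parity p) (modes p v n) * modeOp p x m =
        ∑ j ∈ range M, ((Ring.choose m j : ℤ) : ℂ) • modes p (modeOp p x j v) (n + (m - j)) := by
      intro m n
      obtain ⟨M', h1, h2⟩ := ((hv m n).and (eventually_ge_atTop M)).exists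
      rw [h1, stable v m n M M' h2 hM]
    refine LinearMap.ext fun w => ?_
    have hj := (eventually_all_finset (range M)).2 fun j _ =>
      modes_modeOp p y k (modeOp p x j v) (n + (m - j)) w
    obtain ⟨I, h1, h2, hj, hI⟩ := ((modes_modeOp p y k v n w).and
      ((modes_modeOp p y k v n ((parityOp p ^ (x.parity p).val) (modeOp p x m w))).and
      (hj.and (eventually_gt_atTop (max (m + k + 1) (-1 - m)).toNat)))).exists
    rw [LinearMap.sub_apply, Module.End.mul_apply, Module.End.mul_apply, twist_apply,
      Module.End.mul_apply, Module.End.mul_apply, h1, h2, map_sum, map_sum, ← sum_sub_distrib]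
    -- The $i$-th summand of the supercommutator of $x_m$ with $(y_k v)_n$: the induction hypothesis
    -- replaces the supercommutators with $v$, and the contractions of $x_m$ with $y$ occur at $i =
    -- m+k+1$ in the first half and at $i = -1-m$ in the second.
    have e : ∀ i ∈ range I,
        modeOp p x m (productTerm p (modeOp p y) (y.parity p) k (modes p v) n i w)
        - (parityOp p ^ (x.parity p).val) (productTerm p (modeOp p y) (y.parity p) k (modes p v) n i
          ((parityOp p ^ (x.parity p).val) (modeOp p x m w))) =
        ∑ j ∈ range M, ((Ring.choose m j : ℤ) : ℂ) • koszul (y.parity p) (x.parity p) •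
          productTerm p (modeOp p y) (y.parity p) k (modes p (modeOp p x j v)) (n + (m - j)) i w
        + (((-1 : ℂ) ^ i * (Ring.choose k i : ℤ)) *
            (if (i : ℤ) = m + k + 1 then Gen.pairing p x y else 0)
          - (-1 : ℂ) ^ k * (((-1 : ℂ) ^ i * (Ring.choose k i : ℤ)) *
            (if (i : ℤ) = -1 - m then Gen.pairing p x y else 0))) •
            modes p v (n + (m + k + 1)) w := by
      intro i _
      have h := commutator_productTerm p (modeOp p x m) (x.parity p) y k (modes p v) n i
        ((if m + (k - i) = -1 then Gen.pairing p x y else 0) • 1)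
        ((if m + i = -1 then Gen.pairing p x y else 0) • 1)
        (by rw [twist_modeOp, koszul_comm])
        (by rw [modeOp_mul, koszul_comm]) (by rw [modeOp_mul, koszul_comm])
      simp only [hv'] at h
      rw [productTerm_sum] at h
      have h' := LinearMap.congr_fun h w
      simp only [LinearMap.sub_apply, LinearMap.add_apply, LinearMap.smul_apply,
        LinearMap.sum_apply, Module.End.mul_apply, twist_apply p (x.parity p)
          (productTerm _ _ _ _ _ _ _)] at h'
      rw [h', smul_sum]
      congr 1
      · exact sum_congr rfl fun j _ => smul_comm _ _ _
      · simp only [map_smul, Module.End.one_apply]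
        by_cases c1 : (i : ℤ) = m + k + 1 <;> by_cases c2 : (i : ℤ) = -1 - m
        · have := LinearMap.congr_fun (twist_twist_pairing p x y (modes p v (k + n - i))) w
          rw [if_pos (by omega), if_pos (by omega), if_pos (by omega), if_pos (by omega)]
          rw [LinearMap.smul_apply, LinearMap.smul_apply] at this
          rw [this, show n + (i : ℤ) = n + (m + k + 1) by omega,
            show k + n - (i : ℤ) = n + (m + k + 1) by omega]
          module
        · rw [if_pos (by omega), if_neg (by omega), if_pos (by omega), if_neg (by omega),
            show n + (i : ℤ) = n + (m + k + 1) by omega]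
          module
        · have := LinearMap.congr_fun (twist_twist_pairing p x y (modes p v (k + n - i))) w
          rw [if_neg (by omega), if_pos (by omega), if_neg (by omega), if_pos (by omega)]
          rw [LinearMap.smul_apply, LinearMap.smul_apply] at this
          rw [this, show k + n - (i : ℤ) = n + (m + k + 1) by omega]
          module
        · rw [if_neg (by omega), if_neg (by omega), if_neg (by omega), if_neg (by omega)]
          module
    rw [sum_congr rfl e, sum_add_distrib, ← sum_smul, sum_sub_distrib, ← mul_sum,
      sum_range_mul_ite_eq _ _ _ _ (by omega), sum_range_mul_ite_eq _ _ _ _ (by omega), sum_comm,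
      LinearMap.sum_apply]
    have e' : ∀ j ∈ range M, (((Ring.choose m j : ℤ) : ℂ) •
          modes p (modeOp p x j (modeOp p y k v)) (n + (m - j))) w =
        ∑ i ∈ range I, ((Ring.choose m j : ℤ) : ℂ) • koszul (y.parity p) (x.parity p) •
          productTerm p (modeOp p y) (y.parity p) k (modes p (modeOp p x j v)) (n + (m - j)) i w
        + (((Ring.choose m j : ℤ) : ℂ) *
            (if (j : ℤ) = -1 - k then Gen.pairing p x y else 0)) •
            modes p v (n + (m + k + 1)) w := by
      intro j hjM
      rw [modeOp_modeOp_apply, map_add, map_smul, map_smul, Pi.add_apply, Pi.smul_apply,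
        Pi.smul_apply, LinearMap.smul_apply, LinearMap.add_apply, LinearMap.smul_apply,
        LinearMap.smul_apply, hj j hjM, koszul_comm, smul_add, smul_sum, smul_sum, smul_smul]
      congr 1
      by_cases c : (j : ℤ) = -1 - k
      · rw [if_pos c, if_pos (by omega), show m - (j : ℤ) = m + k + 1 by omega]
      · rw [if_neg c, if_neg (by omega), mul_zero, zero_smul, zero_smul]
    rw [sum_congr rfl e', sum_add_distrib, ← sum_smul, sum_range_mul_ite_eq _ _ _ _ (by omega)]
    congr 2
    -- The products of $y$ with the $x_j v$ already match; only the scalars in front of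
    -- $v_{n+m+k+1}$ remain to be compared.
    have := congrArg (· * Gen.pairing p x y) (choose_contraction m k)
    simp only [sub_mul, mul_assoc, ite_mul, zero_mul] at this
    simp only [mul_assoc]
    exact this

end Commutator

/-! ### Homogeneity of fields, multiplication by $z-w$, and Dong's lemma -/

section Locality

open Filter Finset

variable {A : Type*}

/-! ### Parity of the modes -/

theorem zmodTwo_cases (q : ZMod 2) : q = 0 ∨ q = 1 := by
  revert q
  decide

theorem koszul_add_right (r q q' : ZMod 2) : koszul r (q + q') = koszul r q * koszul r q' := by
  rcases zmodTwo_cases r with rfl | rfl <;> rcases zmodTwo_cases q with rfl | rfl <;>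
    rcases zmodTwo_cases q' with rfl | rfl <;>
    simp [koszul, show (1 : ZMod 2) + 1 = 0 from rfl, show (1 : ZMod 2).val = 1 from rfl]

theorem mem_grade (p : A → ZMod 2) (q : ZMod 2) (v : Fch p) :
    v ∈ grade p q ↔ parityOp p v = koszul 1 q • v := by
  rw [grade, LinearMap.mem_ker, LinearMap.sub_apply, LinearMap.smul_apply, Module.End.one_apply,
    sub_eq_zero]

theorem modeOp_mem_grade (p : A → ZMod 2) (x : Gen A) (n : ℤ) {q : ZMod 2} {v : Fch p}
    (hv : v ∈ grade p q) : modeOp p x n v ∈ grade p (x.parity p + q) := by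
  rw [mem_grade] at hv ⊢
  rw [← Module.End.mul_apply, parityOp_mul_modeOp, LinearMap.smul_apply, Module.End.mul_apply, hv,
    map_smul, smul_smul, koszul_add_right]

theorem twist_productTerm (p : A → ZMod 2) (x : Gen A) (r : ZMod 2) (k : ℤ)
    (F : ℤ → Module.End ℂ (Fch p)) (n : ℤ) (i : ℕ) :
    twist p r (productTerm p (modeOp p x) (x.parity p) k F n i) = koszul (x.parity p) r •
      productTerm p (modeOp p x) (x.parity p) k (fun l => twist p r (F l)) n i := by
  simp only [productTerm, map_smul, map_sub, map_mul, twist_modeOp, mul_smul_comm,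
    smul_mul_assoc, twist_comm p r (x.parity p)]
  module

/-- The parity operator is an automorphism of the state-field correspondence, because conjugation by
it respects the recursion that defines the fields. Thus homogeneous vectors have homogeneous fields
(`twist_modes`), and a conjugation can be traded for a Koszul sign. -/
theorem twist_one_modes (p : A → ZMod 2) (v : Fch p) (n : ℤ) :
    twist p 1 (modes p v n) = modes p (parityOp p v) n := by
  let W : Submodule ℂ (Fch p) :=
    { carrier := {v | ∀ n : ℤ, twist p 1 (modes p v n) = modes p (parityOp p v) n}
      zero_mem' := fun n => by simp
      add_mem' := fun ha hb n => by
        rw [map_add, map_add, map_add, Pi.add_apply, Pi.add_apply, map_add, ha n, hb n]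
      smul_mem' := fun c a ha n => by
        rw [map_smul, map_smul, map_smul, Pi.smul_apply, Pi.smul_apply, map_smul, ha n] }
  refine Fch.induction p W ?_ ?_ v n
  · intro n
    rw [parityOp_vacuum, modes_vacuum]
    split_ifs <;> simp
  · intro x k v hv n
    refine LinearMap.ext fun w => ?_
    rw [← Module.End.mul_apply (parityOp p), parityOp_mul_modeOp, LinearMap.smul_apply,
      Module.End.mul_apply, map_smul, Pi.smul_apply, LinearMap.smul_apply]
    obtain ⟨I, h1, h2⟩ := ((modes_modeOp p x k (parityOp p v) n w).and
      (modes_modeOp p x k v n (parityOp p w))).exists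
    have h01 : ∀ B w, twist p 1 B w = parityOp p (B (parityOp p w)) := fun B w => by
      rw [twist_apply]
      rfl
    rw [h01, h1, h2, map_sum, smul_sum]
    refine sum_congr rfl fun i _ => ?_
    rw [← h01, twist_productTerm, koszul_comm, LinearMap.smul_apply]
    congr 3
    exact funext hv

theorem twist_modes (p : A → ZMod 2) {q : ZMod 2} {u : Fch p} (hu : u ∈ grade p q) (r : ZMod 2)
    (n : ℤ) : twist p r (modes p u n) = koszul r q • modes p u n := by
  rcases zmodTwo_cases r with rfl | rfl
  · simp [twist_zero, koszul]
  · rw [twist_one_modes, (mem_grade p q u).1 hu, map_smul, Pi.smul_apply]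

/-! ### Multiplication by `z - w` -/

section Difference

variable {E : Type*} [AddCommGroup E] [Module ℂ E]

/-- Multiplication by `z - w` on formal distributions in two variables. -/
def difference (E : Type*) [AddCommGroup E] [Module ℂ E] : Module.End ℂ (ℤ → ℤ → E) where
  toFun f m n := f (m + 1) n - f m (n + 1)
  map_add' f g := by
    ext m n
    simp only [Pi.add_apply]
    abel
  map_smul' c f := by
    ext m n
    simp only [Pi.smul_apply, smul_sub, RingHom.id_apply]

/-- Pascal's rule, that is $(1-x)^K (1-x) = (1-x)^{K+1}$, truncated at $N$; the last term is the
boundary term of the truncation. -/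
theorem sum_choose_sub_succ (K : ℤ) (a : ℕ → E) (N : ℕ) :
    ∑ i ∈ range N, ((-1 : ℂ) ^ i * (Ring.choose K i : ℤ)) • (a i - a (i + 1)) =
      ∑ i ∈ range (N + 1), ((-1 : ℂ) ^ i * (Ring.choose (K + 1) i : ℤ)) • a i
        - ((-1 : ℂ) ^ N * (Ring.choose K N : ℤ)) • a N := by
  induction N with
  | zero => simp
  | succ N ih =>
    rw [sum_range_succ, ih, sum_range_succ _ (N + 1), Ring.choose_succ_succ]
    push_cast
    module

theorem sum_choose_sub_succ_of_eq_zero (K : ℤ) (a : ℕ → E) (N : ℕ) (h : a N = 0) :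
    ∑ i ∈ range N, ((-1 : ℂ) ^ i * (Ring.choose K i : ℤ)) • (a i - a (i + 1)) =
      ∑ i ∈ range N, ((-1 : ℂ) ^ i * (Ring.choose (K + 1) i : ℤ)) • a i := by
  rw [sum_choose_sub_succ, sum_range_succ, h, smul_zero, smul_zero, add_zero, sub_zero]

/-- The right-hand side has the shape of `LocalAt`, so locality becomes the vanishing of a power of
one linear operator, a condition monotone in the exponent. -/
theorem difference_pow_apply (N : ℕ) (f : ℤ → ℤ → E) (m n : ℤ) :
    (difference E ^ N) f m n = ∑ l ∈ range (N + 1), ((-1 : ℂ) ^ l * (N.choose l : ℂ)) •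
      f (m + (N - l : ℕ)) (n + l) := by
  induction N generalizing f with
  | zero => simp
  | succ N ih =>
    rw [pow_succ, Module.End.mul_apply, ih]
    have h := sum_choose_sub_succ (E := E) N (fun i => f (m + (N + 1 - i)) (n + i)) (N + 1)
    simp only [Ring.choose_natCast, Nat.choose_succ_self, Nat.cast_zero, Int.cast_zero, mul_zero,
      zero_smul, sub_zero, show (N : ℤ) + 1 = ((N + 1 : ℕ) : ℤ) by norm_cast] at h
    refine Eq.trans (sum_congr rfl fun i hi => ?_) (h.trans (sum_congr rfl fun i hi => ?_))
    · have hi := mem_range.1 hi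
      simp only [difference, LinearMap.coe_mk, AddHom.coe_mk, Int.cast_natCast]
      rw [show m + ((N - i : ℕ) : ℤ) + 1 = m + (((N + 1 : ℕ) : ℤ) - i) by omega,
        show m + ((N - i : ℕ) : ℤ) = m + (((N + 1 : ℕ) : ℤ) - ((i + 1 : ℕ) : ℤ)) by omega,
        show n + (i : ℤ) + 1 = n + ((i + 1 : ℕ) : ℤ) by omega]
    · have hi := mem_range.1 hi
      rw [Int.cast_natCast, show ((N + 1 : ℕ) : ℤ) - i = ((N + 1 - i : ℕ) : ℤ) by omega]

theorem difference_pow_eq_zero_of_le {f : ℤ → ℤ → E} {M N : ℕ} (h : M ≤ N)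
    (hf : (difference E ^ M) f = 0) : (difference E ^ N) f = 0 := by
  obtain ⟨K, rfl⟩ := Nat.exists_eq_add_of_le' h
  rw [pow_add, Module.End.mul_apply, hf, map_zero]

end Difference

/-- The supercommutator of two families of modes, the first one being of parity `q`. -/
def superComm (p : A → ZMod 2) (q : ZMod 2) (W F : ℤ → Module.End ℂ (Fch p)) (m n : ℤ) :
    Module.End ℂ (Fch p) :=
  W m * F n - twist p q (F n) * W m

/-- A product in the variable $w$ with a fixed field merely translates the second index of $B$, so
multiplication by $(z-w)^N$ passes through to $B$ summand by summand. -/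
theorem superComm_productTerm_eq_zero (p : A → ZMod 2) (N : ℕ) (W : ℤ → Module.End ℂ (Fch p))
    (r : ZMod 2) (k : ℤ) (B : ℤ → ℤ → Module.End ℂ (Fch p))
    (h : (difference _ ^ N) B = 0) (m n : ℤ) (i : ℕ) :
    ∑ l ∈ range (N + 1), ((-1 : ℂ) ^ l * (N.choose l : ℂ)) •
      productTerm p W r k (B (m + (N - l : ℕ))) (n + l) i = 0 := by
  rw [← productTerm_sum p W r k (range (N + 1)) _ (fun l => B (m + (N - l : ℕ))) (fun l => l)]
  simp only [← difference_pow_apply, h]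
  simp [productTerm]

/-- The formal distribution `W(z) F(w) (z - w)^K - (-1)^{WF} F(w) W(z) (z - w)^K`, applied to `w`,
where the two powers are expanded in the domains `|z| > |w|` and `|w| > |z|`. -/
def shiftedProduct (p : A → ZMod 2) (q : ZMod 2) (W F : ℤ → Module.End ℂ (Fch p)) (w : Fch p)
    (K m n : ℤ) : Fch p :=
  ∑ᶠ i : ℕ, productTerm p (fun l => W (m + l)) q K F n i w

theorem shiftedProduct_eq_sum (p : A → ZMod 2) (q : ZMod 2) {W F : ℤ → Module.End ℂ (Fch p)}
    (hW : Trunc W) (hF : Trunc F) (w : Fch p) (K m n : ℤ) :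
    ∀ᶠ I : ℕ in atTop, shiftedProduct p q W F w K m n =
      ∑ i ∈ range I, productTerm p (fun l => W (m + l)) q K F n i w := by
  obtain ⟨N₁, h₁⟩ := hW w
  obtain ⟨N₂, h₂⟩ := hF w
  filter_upwards [eventually_ge_atTop (max (N₁ - m) (N₂ - n)).toNat] with I hI
  refine finsum_eq_sum_of_support_subset _ fun i hi => ?_
  rw [coe_range]
  by_contra h
  have h : I ≤ i := by simpa using h
  refine hi ?_
  simp only [productTerm, LinearMap.smul_apply, LinearMap.sub_apply, Module.End.mul_apply]
  rw [h₁ (m + i) (by omega), h₂ (n + i) (by omega)]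
  simp

/-- Multiplication by $z-w$ raises the exponent by one in both expansions. Together with
`shiftedProduct_zero` it links every exponent $K$ to the supercommutator. -/
theorem difference_shiftedProduct (p : A → ZMod 2) (q : ZMod 2)
    {W F : ℤ → Module.End ℂ (Fch p)} (hW : Trunc W) (hF : Trunc F) (w : Fch p) (K : ℤ) :
    difference _ (shiftedProduct p q W F w K) = shiftedProduct p q W F w (K + 1) := by
  ext m n
  obtain ⟨N₁, h₁⟩ := hW w
  obtain ⟨N₂, h₂⟩ := hF w
  obtain ⟨I, e1, e2, e3, hI⟩ := ((shiftedProduct_eq_sum p q hW hF w K (m + 1) n).and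
    ((shiftedProduct_eq_sum p q hW hF w K m (n + 1)).and
    ((shiftedProduct_eq_sum p q hW hF w (K + 1) m n).and
    (eventually_ge_atTop (max (N₁ - m) (N₂ - n)).toNat)))).exists
  change shiftedProduct p q W F w K (m + 1) n - shiftedProduct p q W F w K m (n + 1) = _
  rw [e1, e2, e3, ← sum_sub_distrib]
  -- Both halves are put into one sequence. The second enters with a plus sign since $z-w$ reverses
  -- sign in the expansion in powers of $z/w$, which turns $(-1)^K$ into $(-1)^{K+1}$.
  have ha := sum_choose_sub_succ_of_eq_zero K (fun i : ℕ =>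
    W (m + (K + 1 - i)) (F (n + i) w) + (-1 : ℂ) ^ K • twist p q (F (K + 1 + n - i)) (W (m + i) w))
    I (by rw [h₁ (m + I) (by omega), h₂ (n + I) (by omega)]; simp)
  refine Eq.trans (sum_congr rfl fun i _ => ?_) (ha.trans (sum_congr rfl fun i _ => ?_))
  · simp only [productTerm, LinearMap.smul_apply, LinearMap.sub_apply, Module.End.mul_apply]
    rw [show m + 1 + (K - i) = m + (K + 1 - i) by ring,
      show m + (K - i) = m + (K + 1 - ((i + 1 : ℕ) : ℤ)) by push_cast; ring,
      show n + 1 + (i : ℤ) = n + ((i + 1 : ℕ) : ℤ) by push_cast; ring,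
      show m + 1 + (i : ℤ) = m + ((i + 1 : ℕ) : ℤ) by push_cast; ring,
      show K + n - (i : ℤ) = K + 1 + n - ((i + 1 : ℕ) : ℤ) by push_cast; ring,
      show K + (n + 1) - (i : ℤ) = K + 1 + n - i by ring]
    module
  · simp only [productTerm, LinearMap.smul_apply, LinearMap.sub_apply, Module.End.mul_apply]
    rw [zpow_add₀ (by norm_num), zpow_one]
    module

theorem shiftedProduct_zero (p : A → ZMod 2) (q : ZMod 2) (W F : ℤ → Module.End ℂ (Fch p))
    (w : Fch p) (m n : ℤ) :
    shiftedProduct p q W F w 0 m n = superComm p q W F m n w := by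
  rw [shiftedProduct, finsum_eq_single _ 0]
  · simp [productTerm, superComm]
  · intro i hi
    rw [productTerm, Ring.choose_zero_pos _ (Nat.pos_of_ne_zero hi)]
    simp

theorem difference_pow_shiftedProduct (p : A → ZMod 2) (q : ZMod 2)
    {W F : ℤ → Module.End ℂ (Fch p)} (hW : Trunc W) (hF : Trunc F) (w : Fch p) (K : ℤ) (N : ℕ) :
    (difference _ ^ N) (shiftedProduct p q W F w K) = shiftedProduct p q W F w (K + N) := by
  induction N with
  | zero => simp
  | succ N ih =>
    rw [pow_succ', Module.End.mul_apply, ih, difference_shiftedProduct p q hW hF]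
    push_cast
    rw [add_assoc]

/-- Multiplying the distribution of exponent $K$ by $(z-w)^N$ gives $(z-w)^{N+K}$ times the
supercommutator. The term `K.natAbs` covers negative exponents, ensuring $N + K \ge M$. -/
theorem difference_pow_shiftedProduct_eq_zero (p : A → ZMod 2) (q : ZMod 2)
    {W F : ℤ → Module.End ℂ (Fch p)} (hW : Trunc W) (hF : Trunc F) (w : Fch p) (K : ℤ) {M N : ℕ}
    (h : (difference _ ^ M) (superComm p q W F) = 0) (hN : M + K.natAbs ≤ N) :
    (difference _ ^ N) (shiftedProduct p q W F w K) = 0 := by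
  obtain ⟨L, hL⟩ : ∃ L : ℕ, K + N = L := ⟨(K + N).toNat, by omega⟩
  have e := difference_pow_shiftedProduct p q hW hF w 0 L
  rw [difference_pow_shiftedProduct p q hW hF, hL]
  rw [zero_add] at e
  rw [← e]
  have h' := difference_pow_eq_zero_of_le (show M ≤ L by omega) h
  ext m n
  have h'' := LinearMap.congr_fun (congrFun (congrFun h' m) n) w
  rw [difference_pow_apply] at h'' ⊢
  simp only [shiftedProduct_zero]
  simp only [LinearMap.sum_apply, LinearMap.smul_apply] at h''
  exact h''

/-! ### Dong's lemma -/

theorem choose_mul_choose_sub (k : ℤ) (i j : ℕ) :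
    Ring.choose k i * Ring.choose (k - i) j = Ring.choose k j * Ring.choose (k - j) i := by
  have h1 := Ring.choose_smul_choose k (Nat.le_add_right i j)
  have h2 := Ring.choose_smul_choose k (Nat.le_add_left j i)
  rw [Nat.add_sub_cancel_left] at h1
  rw [Nat.add_sub_cancel] at h2
  rw [← h1, ← h2, Nat.choose_symm_add]

theorem choose_mul_choose_add (k : ℤ) (i j : ℕ) :
    Ring.choose k (i + j) * ((i + j).choose j : ℤ) = Ring.choose k j * Ring.choose (k - j) i := by
  have h2 := Ring.choose_smul_choose k (Nat.le_add_left j i)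
  rw [Nat.add_sub_cancel, nsmul_eq_mul] at h2
  rw [← h2, mul_comm]

/-- Reindexing by $j$ while keeping one cutoff: the first $j$ terms vanish on the left, the last
ones on the right. -/
theorem sum_range_shift {E : Type*} [AddCommGroup E] (g h : ℕ → E) (j I : ℕ) (hj : j ≤ I)
    (hlt : ∀ i < j, g i = 0) (heq : ∀ i, g (i + j) = h i) (hz : ∀ i, I ≤ i + j → h i = 0) :
    ∑ i ∈ range I, g i = ∑ i ∈ range I, h i := by
  obtain ⟨t, rfl⟩ := Nat.exists_eq_add_of_le hj
  have e : ∑ i ∈ range (j + t), h i = ∑ i ∈ range t, h i :=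
    (sum_subset (range_mono (Nat.le_add_left _ _)) fun i _ hi => hz i (by
      have := mem_range.not.1 hi
      omega)).symm
  rw [e, sum_range_add, sum_eq_zero fun i hi => hlt i (mem_range.1 hi), zero_add]
  exact sum_congr rfl fun i _ => by rw [add_comm, heq]

/-- The part of the commutator of a field with the `k`-th product of a free field and a field that
comes from the commutator with the free field. -/
theorem sum_contraction (p : A → ZMod 2) (r : ZMod 2) {W F : ℤ → Module.End ℂ (Fch p)}
    (hW : Trunc W) (hF : Trunc F) (k m n : ℤ) (j : ℕ) (w : Fch p) :
    ∀ᶠ I : ℕ in atTop, ∑ i ∈ range I, ((-1 : ℂ) ^ i * (Ring.choose k i : ℤ)) •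
      ((((Ring.choose (k - i) j : ℤ) : ℂ) • (W (m + (k - i - j)) * F (n + i))
        - (-1 : ℂ) ^ k • ((Ring.choose (i : ℤ) j : ℤ) : ℂ) •
          (twist p r (F (k + n - i)) * W (m + (i - j)))) w) =
      ((Ring.choose k j : ℤ) : ℂ) • shiftedProduct p r W F w (k - j) m n := by
  obtain ⟨N₁, h₁⟩ := hW w
  filter_upwards [shiftedProduct_eq_sum p r hW hF w (k - j) m n,
    eventually_ge_atTop (j + (N₁ - m).toNat)] with I e hI
  rw [e, smul_sum]
  simp only [productTerm, LinearMap.smul_apply, LinearMap.sub_apply, Module.End.mul_apply,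
    smul_sub, sum_sub_distrib]
  congr 1
  · refine sum_congr rfl fun i _ => ?_
    have := choose_mul_choose_sub k i j
    rw [show k - (i : ℤ) - j = k - j - i by ring, smul_smul, smul_smul]
    congr 1
    have h : ((Ring.choose k i : ℤ) : ℂ) * (Ring.choose (k - i) j : ℤ) =
      (Ring.choose k j : ℤ) * (Ring.choose (k - j) i : ℤ) := mod_cast this
    linear_combination (-1 : ℂ) ^ i * h
  -- In the expansion in powers of $z/w$ the factor $\binom{i}{j}$ kills $i<j$, so the sum starts at
  -- $i=j$; the shift also produces the sign $(-1)^j$ between $(-1)^k$ and $(-1)^{k-j}$.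
  · refine sum_range_shift _ _ j I (by omega) ?_ ?_ ?_
    · intro i hi
      rw [Ring.choose_natCast, Nat.choose_eq_zero_of_lt hi]
      simp
    · intro i
      rw [Ring.choose_natCast, show k + n - ((i + j : ℕ) : ℤ) = k - j + n - i by push_cast; ring,
        show ((i + j : ℕ) : ℤ) - j = i by push_cast; ring]
      simp only [smul_smul]
      congr 1
      have h : ((Ring.choose k (i + j) : ℤ) : ℂ) * (((i + j).choose j : ℤ) : ℂ) =
        (Ring.choose k j : ℤ) * (Ring.choose (k - j) i : ℤ) := mod_cast choose_mul_choose_add k i j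
      have hs : (-1 : ℂ) ^ k = (-1) ^ (k - j) * (-1) ^ j := by
        rw [← zpow_natCast, ← zpow_add₀ (by norm_num), sub_add_cancel]
      have hs2 : ((-1 : ℂ) ^ j) ^ 2 = 1 := by rw [← pow_mul, mul_comm, pow_mul]; simp
      rw [hs, pow_add]
      linear_combination ((-1 : ℂ) ^ i * (-1) ^ (k - j) * ((-1 : ℂ) ^ j) ^ 2) * h
        + (-1 : ℂ) ^ i * (-1) ^ (k - j) * (Ring.choose k j : ℤ) * (Ring.choose (k - j) i : ℤ) * hs2
    · intro i hi
      rw [h₁ (m + i) (by omega)]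
      simp

/-- The fields of any two vectors are mutually local. -/
theorem modes_local (p : A → ZMod 2) (v : Fch p) : ∀ (q : ZMod 2) (u : Fch p), u ∈ grade p q →
    ∃ N : ℕ, (difference _ ^ N) (superComm p q (modes p u) (modes p v)) = 0 := by
  have superComm_add : ∀ (q : ZMod 2) (u a b : Fch p),
      superComm p q (modes p u) (modes p (a + b)) =
        superComm p q (modes p u) (modes p a) + superComm p q (modes p u) (modes p b) := by
    intro q u a b
    ext1 m
    ext1 n
    simp only [superComm, map_add, Pi.add_apply, mul_add, add_mul]
    abel
  have superComm_smul : ∀ (q : ZMod 2) (u a : Fch p) (c : ℂ),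
      superComm p q (modes p u) (modes p (c • a)) =
        c • superComm p q (modes p u) (modes p a) := by
    intro q u a c
    ext1 m
    ext1 n
    simp only [superComm, map_smul, Pi.smul_apply, mul_smul_comm, smul_mul_assoc, smul_sub]
  let W : Submodule ℂ (Fch p) :=
    { carrier := {v | ∀ (q : ZMod 2) (u : Fch p), u ∈ grade p q →
        ∃ N : ℕ, (difference _ ^ N) (superComm p q (modes p u) (modes p v)) = 0}
      zero_mem' := fun q u _ => ⟨0, by
        ext1 m
        ext1 n
        simp [superComm]⟩
      add_mem' := by
        intro a b ha hb q u hu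
        obtain ⟨M, hM⟩ := ha q u hu
        obtain ⟨N, hN⟩ := hb q u hu
        refine ⟨max M N, ?_⟩
        rw [superComm_add, map_add, difference_pow_eq_zero_of_le (le_max_left _ _) hM,
          difference_pow_eq_zero_of_le (le_max_right _ _) hN, add_zero]
      smul_mem' := by
        intro c a ha q u hu
        obtain ⟨N, hN⟩ := ha q u hu
        exact ⟨N, by rw [superComm_smul, map_smul, hN, smul_zero]⟩ }
  refine Fch.induction p W ?_ ?_ v
  · intro q u _
    refine ⟨0, ?_⟩
    ext1 m
    ext1 n
    rw [pow_zero, Module.End.one_apply, superComm, modes_vacuum]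
    split_ifs <;> simp
  · intro y k v hv q u hu
    obtain ⟨M, hM⟩ := (eventually_modeOp_eq_zero p y u).exists
    -- The induction hypothesis on $v$ covers all homogeneous $u$, and is used here for the vectors
    -- $y_j u$ that arise when $u$ is commuted past $y$.
    have hW := fun j : ℕ => hv _ _ (modeOp_mem_grade p y j hu)
    choose Nj hNj using hW
    obtain ⟨N₀, hN₀⟩ := hv q u hu
    set r := y.parity p with hr
    set s := koszul r q with hs
    -- The exponent dominates the locality order of $u$ with $v$ and, for each of the finitely many
    -- $j$, the order for $y_j u$ with $v$ enlarged by the exponent $k-j$ of the distribution that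
    -- occurs.
    refine ⟨N₀ + ∑ j ∈ range M, (Nj j + (k - j).natAbs), ?_⟩
    set N := N₀ + ∑ j ∈ range M, (Nj j + (k - j).natAbs) with hN
    have hNle : ∀ j ∈ range M, Nj j + (k - j).natAbs ≤ N := fun j hj =>
      (single_le_sum (f := fun j : ℕ => Nj j + (k - j).natAbs) (fun _ _ => Nat.zero_le _) hj).trans
        (Nat.le_add_left _ _)
    have comm : ∀ l m : ℤ, modes p u m * modeOp p y l = s • (modeOp p y l * modes p u m)
        + -s • ∑ j ∈ range M, ((Ring.choose l j : ℤ) : ℂ) •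
          modes p (modeOp p y j u) (m + (l - j)) := by
      intro l m
      rw [← modeOp_commutator p y u l m M hM, twist_modes p hu, smul_sub, smul_mul_assoc, neg_smul,
        neg_smul, smul_smul, koszul_mul_self, one_smul]
      abel
    -- The supercommutator of $u(z)$ with $(y_k v)(w)$ splits into the $k$-th product of $y$ with
    -- the supercommutator of $u$ and $v$, and, for each $j$, a multiple $\binom{k}{j}$ of the
    -- distribution of exponent $k-j$ built from $y_j u$ and $v$. A high power of $z-w$ kills each
    -- part.
    have key : ∀ (m n : ℤ) (w : Fch p), ∀ᶠ I : ℕ in atTop,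
        superComm p q (modes p u) (modes p (modeOp p y k v)) m n w =
        ∑ i ∈ range I, s • productTerm p (modeOp p y) r k
          (superComm p q (modes p u) (modes p v) m) n i w
        + ∑ j ∈ range M, (-s * (Ring.choose k j : ℤ)) • shiftedProduct p (r + q)
          (modes p (modeOp p y j u)) (modes p v) w (k - j) m n := by
      intro m n w
      have hj := (eventually_all_finset (range M)).2 fun j _ =>
        sum_contraction p (r + q) (modes_trunc p (modeOp p y j u)) (modes_trunc p v) k m n j w
      filter_upwards [modes_modeOp p y k v n w,
        modes_modeOp p y k v n ((parityOp p ^ q.val) (modes p u m w)), hj] with I h1 h2 hj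
      rw [superComm, LinearMap.sub_apply, Module.End.mul_apply, Module.End.mul_apply, twist_apply,
        Module.End.mul_apply, Module.End.mul_apply, h1, h2, map_sum, map_sum, ← sum_sub_distrib]
      have e : ∀ j ∈ range M, (-s * (Ring.choose k j : ℤ)) • shiftedProduct p (r + q)
          (modes p (modeOp p y j u)) (modes p v) w (k - j) m n =
          -s • ∑ i ∈ range I, ((-1 : ℂ) ^ i * (Ring.choose k i : ℤ)) •
      ((((Ring.choose (k - i) j : ℤ) : ℂ) • (modes p (modeOp p y j u) (m + (k - i - j))
          * modes p v (n + i))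
        - (-1 : ℂ) ^ k • ((Ring.choose (i : ℤ) j : ℤ) : ℂ) •
          (twist p (r + q) (modes p v (k + n - i)) * modes p (modeOp p y j u) (m + (i - j)))) w) :=
        fun j hjM => by rw [hj j hjM, smul_smul]
      rw [sum_congr rfl e]
      simp only [smul_sum]
      rw [sum_comm (s := range M), ← sum_add_distrib]
      refine sum_congr rfl fun i _ => ?_
      have h := LinearMap.congr_fun (commutator_productTerm p (modes p u m) q y k (modes p v) n i _
        _ (twist_modes p hu _ m) (comm (k - i) m) (comm i m)) w
      refine Eq.trans ?_ (h.trans ?_)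
      · rw [LinearMap.sub_apply, Module.End.mul_apply, Module.End.mul_apply, twist_apply p q
          (productTerm _ _ _ _ _ _ _), Module.End.mul_apply, Module.End.mul_apply]
      · rw [LinearMap.add_apply, LinearMap.smul_apply]
        congr 1
        rw [LinearMap.smul_apply, ← smul_sum, ← smul_sum, smul_comm (-s)]
        congr 1
        rw [← LinearMap.sum_apply, ← LinearMap.smul_apply]
        congr 1
        rw [twist_twist, add_comm q, sum_sub_distrib, smul_mul_assoc, sum_mul, mul_smul_comm,
          mul_sum, ← smul_sum, smul_comm ((-1 : ℂ) ^ k), ← smul_sub]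
        simp only [smul_mul_assoc, mul_smul_comm]
        rfl
    ext1 m
    ext1 n
    refine LinearMap.ext fun w => ?_
    have hl := (eventually_all_finset (range (N + 1))).2 fun l _ =>
      key (m + (N - l : ℕ)) (n + l) w
    obtain ⟨I, hI⟩ := hl.exists
    rw [difference_pow_apply, LinearMap.sum_apply]
    have e : ∀ l ∈ range (N + 1), (((-1 : ℂ) ^ l * (N.choose l : ℂ)) •
        superComm p q (modes p u) (modes p (modeOp p y k v)) (m + (N - l : ℕ)) (n + l)) w =
        ∑ i ∈ range I, s • ((-1 : ℂ) ^ l * (N.choose l : ℂ)) • productTerm p (modeOp p y) r k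
          (superComm p q (modes p u) (modes p v) (m + (N - l : ℕ))) (n + l) i w
        + ∑ j ∈ range M, (-s * (Ring.choose k j : ℤ)) • ((-1 : ℂ) ^ l * (N.choose l : ℂ)) •
          shiftedProduct p (r + q) (modes p (modeOp p y j u)) (modes p v) w (k - j)
            (m + (N - l : ℕ)) (n + l) := by
      intro l hl
      rw [LinearMap.smul_apply, hI l hl, smul_add, smul_sum, smul_sum]
      simp only [smul_comm ((-1 : ℂ) ^ l * (N.choose l : ℂ))]
    rw [sum_congr rfl e, sum_add_distrib, sum_comm, sum_comm (s := range (N + 1))]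
    simp only [← smul_sum]
    rw [sum_eq_zero, sum_eq_zero, add_zero, smul_zero]
    · rfl
    · intro j hj
      rw [← difference_pow_apply, difference_pow_shiftedProduct_eq_zero p (r + q) (modes_trunc p _)
        (modes_trunc p v) w (k - j) (hNj j) (hNle j hj), Pi.zero_apply, Pi.zero_apply, smul_zero]
    · intro i _
      have h := LinearMap.congr_fun (superComm_productTerm_eq_zero p N (modeOp p y) r k _
        (difference_pow_eq_zero_of_le (Nat.le_add_right _ _) hN₀) m n i) w
      simp only [LinearMap.sum_apply, LinearMap.smul_apply] at h
      rw [h, LinearMap.zero_apply]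

end Locality

/-! ### Vacuum axioms, translation covariance, and odd derivations -/

section Translation

open Filter Finset

variable {A : Type*}

/-! ### Creation and translation -/

/-- The second half of a product starts with an annihilating mode, so on the vacuum only the first
half survives. -/
theorem productTerm_vacuum (p : A → ZMod 2) (x : Gen A) (q : ZMod 2) (k : ℤ)
    (F : ℤ → Module.End ℂ (Fch p)) (n : ℤ) (i : ℕ) :
    productTerm p (modeOp p x) q k F n i (vacuum p) =
      ((-1 : ℂ) ^ i * (Ring.choose k i : ℤ)) • modeOp p x (k - i) (F (n + i) (vacuum p)) := by
  rw [productTerm, LinearMap.smul_apply, LinearMap.sub_apply, LinearMap.smul_apply,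
    Module.End.mul_apply, Module.End.mul_apply, modeOp_vacuum p x i (by positivity), map_zero,
    smul_zero, sub_zero]

theorem modes_apply_vacuum_of_nonneg (p : A → ZMod 2) (v : Fch p) (n : ℤ) (hn : 0 ≤ n) :
    modes p v n (vacuum p) = 0 := by
  let W : Submodule ℂ (Fch p) :=
    { carrier := {v | ∀ n : ℤ, 0 ≤ n → modes p v n (vacuum p) = 0}
      zero_mem' := fun n _ => by simp
      add_mem' := fun ha hb n hn => by
        rw [map_add, Pi.add_apply, LinearMap.add_apply, ha n hn, hb n hn, add_zero]
      smul_mem' := fun c a ha n hn => by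
        rw [map_smul, Pi.smul_apply, LinearMap.smul_apply, ha n hn, smul_zero] }
  refine Fch.induction p W ?_ ?_ v n hn
  · intro n hn
    rw [modes_vacuum, if_neg (by omega), LinearMap.zero_apply]
  · intro x k v hv n hn
    obtain ⟨I, h⟩ := (modes_modeOp p x k v n (vacuum p)).exists
    rw [h]
    refine sum_eq_zero fun i _ => ?_
    rw [productTerm_vacuum, hv _ (by omega), map_zero, smul_zero]

theorem modes_neg_one_vacuum (p : A → ZMod 2) (v : Fch p) : modes p v (-1) (vacuum p) = v := by
  let W : Submodule ℂ (Fch p) :=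
    { carrier := {v | modes p v (-1) (vacuum p) = v}
      zero_mem' := by simp
      add_mem' := fun ha hb => by
        change modes p (_ + _) (-1) (vacuum p) = _
        rw [map_add, Pi.add_apply, LinearMap.add_apply, ha, hb]
      smul_mem' := fun c a ha => by
        change modes p (c • a) (-1) (vacuum p) = _
        rw [map_smul, Pi.smul_apply, LinearMap.smul_apply, ha] }
  refine Fch.induction p W ?_ ?_ v
  · change modes p (vacuum p) (-1) (vacuum p) = vacuum p
    rw [modes_vacuum, if_pos rfl, Module.End.one_apply]
  · intro x k v hv
    obtain ⟨I, h, hI⟩ := ((modes_modeOp p x k v (-1) (vacuum p)).and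
      (eventually_ge_atTop 1)).exists
    change modes p (modeOp p x k v) (-1) (vacuum p) = _
    have hv : modes p v (-1) (vacuum p) = v := hv
    rw [h, sum_eq_single 0]
    · rw [productTerm_vacuum, Nat.cast_zero, add_zero, hv]
      simp
    · intro i _ hi
      rw [productTerm_vacuum, modes_apply_vacuum_of_nonneg p v _ (by omega), map_zero, smul_zero]
    · intro h0
      exact absurd (mem_range.2 (by omega)) h0

theorem transl_apply (p : A → ZMod 2) (v : Fch p) : transl p v = modes p v (-2) (vacuum p) := rfl

theorem transl_vacuum (p : A → ZMod 2) : transl p (vacuum p) = 0 := by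
  rw [transl_apply, modes_vacuum, if_neg (by norm_num), LinearMap.zero_apply]

/-- In $(x_k v)_{(-2)}|0\rangle$ only the summands $i = 0, 1$ survive, the later ones involving
nonnegative modes of $v$ on the vacuum. This is $[\partial, x_k] = -k\,x_{k-1}$. -/
theorem transl_modeOp (p : A → ZMod 2) (x : Gen A) (k : ℤ) (v : Fch p) :
    transl p (modeOp p x k v) = modeOp p x k (transl p v) - (k : ℂ) • modeOp p x (k - 1) v := by
  obtain ⟨I, h, hI⟩ := ((modes_modeOp p x k v (-2) (vacuum p)).and
    (eventually_ge_atTop 2)).exists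
  rw [transl_apply, h, ← sum_subset (range_mono hI), sum_range_succ, sum_range_one,
    productTerm_vacuum, productTerm_vacuum, Ring.choose_one_right, Ring.choose_zero_right,
    Nat.cast_zero, Nat.cast_one, show (-2 : ℤ) + 1 = -1 by norm_num, modes_neg_one_vacuum,
    sub_zero, add_zero, ← transl_apply]
  · push_cast
    module
  · intro i _ hi
    have := mem_range.not.1 hi
    rw [productTerm_vacuum, modes_apply_vacuum_of_nonneg p v _ (by omega), map_zero, smul_zero]

theorem succ_mul_choose_succ (k : ℤ) (i : ℕ) :
    ((i : ℂ) + 1) * (Ring.choose k (i + 1) : ℤ) = (k : ℂ) * (Ring.choose (k - 1) i : ℤ) := by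
  have h := Ring.choose_smul_choose k (Nat.le_add_left 1 i)
  rw [Nat.choose_one_right, Nat.add_sub_cancel, Ring.choose_one_right, nsmul_eq_mul] at h
  exact_mod_cast h

theorem sub_mul_choose (k : ℤ) (i : ℕ) :
    ((k : ℂ) - i) * (Ring.choose k i : ℤ) = (k : ℂ) * (Ring.choose (k - 1) i : ℤ) := by
  have h := choose_mul_choose_sub k i 1
  rw [Ring.choose_one_right, Ring.choose_one_right, mul_comm] at h
  exact_mod_cast h

/-- The rule $i\binom{k}{i} = k\binom{k-1}{i-1}$, that is, differentiation of $(1-x)^k$, with the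
sum cut off where the terms vanish. -/
theorem sum_choose_mul_index {E : Type*} [AddCommGroup E] [Module ℂ E] (k : ℤ) (a : ℕ → E) (N : ℕ)
    (h : a N = 0) :
    ∑ i ∈ range N, ((-1 : ℂ) ^ i * (Ring.choose k i : ℤ)) • (i : ℂ) • a i =
      -(k : ℂ) • ∑ i ∈ range N, ((-1 : ℂ) ^ i * (Ring.choose (k - 1) i : ℤ)) • a (i + 1) := by
  have e := sum_range_succ (fun i : ℕ => ((-1 : ℂ) ^ i * (Ring.choose k i : ℤ)) • (i : ℂ) • a i) N
  rw [h, smul_zero, smul_zero, add_zero] at e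
  rw [← e, sum_range_succ', Nat.cast_zero, zero_smul, smul_zero, add_zero, smul_sum]
  refine sum_congr rfl fun i _ => ?_
  simp only [smul_smul]
  congr 1
  push_cast
  linear_combination (-(-1 : ℂ) ^ i) * succ_mul_choose_succ k i

/-- Induction with `transl_modeOp`: the recursion for $\partial(x_k v)$ reduces to $\partial_w$ of
the product of $x(z)$ and $v(w)$ against $(z-w)^k$, the term with $x_{k-1}$ being the derivative of
the power. -/
theorem modes_transl (p : A → ZMod 2) (v : Fch p) (n : ℤ) :
    modes p (transl p v) n = -(n : ℂ) • modes p v (n - 1) := by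
  let W : Submodule ℂ (Fch p) :=
    { carrier := {v | ∀ n : ℤ, modes p (transl p v) n = -(n : ℂ) • modes p v (n - 1)}
      zero_mem' := fun n => by simp
      add_mem' := fun ha hb n => by
        rw [map_add, map_add, map_add, Pi.add_apply, Pi.add_apply, ha n, hb n, smul_add]
      smul_mem' := fun c a ha n => by
        rw [map_smul, map_smul, map_smul, Pi.smul_apply, Pi.smul_apply, ha n, smul_comm] }
  refine Fch.induction p W ?_ ?_ v n
  · intro n
    rw [transl_vacuum, map_zero, modes_vacuum, Pi.zero_apply]
    split_ifs with h
    · simp [show n = 0 by omega]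
    · rw [smul_zero]
  · intro x k v hv n
    refine LinearMap.ext fun w => ?_
    obtain ⟨N, hN⟩ := modes_trunc p v w
    obtain ⟨I, h1, h2, h3, hI⟩ := ((modes_modeOp p x k (transl p v) n w).and
      ((modes_modeOp p x (k - 1) v n w).and ((modes_modeOp p x k v (n - 1) w).and
      (eventually_ge_atTop (N - (n - 1)).toNat)))).exists
    have hP := sum_choose_mul_index k (fun i => modeOp p x (k - i) (modes p v (n - 1 + i) w)) I
      (by rw [hN _ (by omega), map_zero])
    have e : ∀ i ∈ range I, productTerm p (modeOp p x) (x.parity p) k (modes p (transl p v)) n i w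
        = -(n : ℂ) • productTerm p (modeOp p x) (x.parity p) k (modes p v) (n - 1) i w
          - ((-1 : ℂ) ^ i * (Ring.choose k i : ℤ)) •
            (i : ℂ) • modeOp p x (k - i) (modes p v (n - 1 + i) w)
          + ((-1 : ℂ) ^ k * ((-1) ^ i * ((k - i) * (Ring.choose k i : ℤ)))) •
            twist p (x.parity p) (modes p v (k + n - 1 - i)) (modeOp p x i w) := by
      intro i _
      simp only [productTerm, LinearMap.smul_apply, LinearMap.sub_apply, Module.End.mul_apply]
      rw [hv, hv, show n + (i : ℤ) - 1 = n - 1 + i by ring,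
        show k + n - (i : ℤ) - 1 = k + n - 1 - i by ring,
        show k + (n - 1) - (i : ℤ) = k + n - 1 - i by ring]
      simp only [map_smul, LinearMap.smul_apply]
      push_cast
      module
    rw [transl_modeOp, map_sub, map_smul, Pi.sub_apply, Pi.smul_apply, LinearMap.sub_apply,
      LinearMap.smul_apply, LinearMap.smul_apply, h1, h2, h3, sum_congr rfl e, sum_add_distrib,
      sum_sub_distrib, hP]
    simp only [smul_sum]
    rw [← sum_sub_distrib, ← sum_add_distrib, ← sum_sub_distrib]
    refine sum_congr rfl fun i _ => ?_
    simp only [productTerm, LinearMap.smul_apply, LinearMap.sub_apply, Module.End.mul_apply]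
    rw [sub_mul_choose, show k - 1 - (i : ℤ) = k - ((i + 1 : ℕ) : ℤ) by push_cast; ring,
      show n - 1 + ((i + 1 : ℕ) : ℤ) = n + i by push_cast; ring,
      show k - 1 + n - (i : ℤ) = k + n - 1 - i by ring, zpow_sub_one₀ (by norm_num),
      show ((-1 : ℂ))⁻¹ = -1 by norm_num]
    module

/-! ### Derivations -/

/-- An odd operator that kills the vacuum and sends free fields to multiples of free fields or of
their derivatives is a derivation. -/
theorem modes_derivation (p : A → ZMod 2) (D : Module.End ℂ (Fch p)) (hvac : D (vacuum p) = 0)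
    (hD : ∀ r, twist p r D = koszul r 1 • D)
    (hx : ∀ x : Gen A, ∃ (y : Gen A) (μ : ℂ), y.parity p = 1 + x.parity p ∧
      ((∀ n : ℤ, D * modeOp p x n =
          koszul (x.parity p) 1 • (modeOp p x n * D) + μ • modeOp p y n) ∨
        ∀ n : ℤ, D * modeOp p x n =
          koszul (x.parity p) 1 • (modeOp p x n * D) + (μ * -(n : ℂ)) • modeOp p y (n - 1)))
    (v : Fch p) (n : ℤ) :
    D * modes p v n - twist p 1 (modes p v n) * D = modes p (D v) n := by
  let W : Submodule ℂ (Fch p) :=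
    { carrier := {v | ∀ n : ℤ, D * modes p v n - twist p 1 (modes p v n) * D = modes p (D v) n}
      zero_mem' := fun n => by simp
      add_mem' := fun ha hb n => by
        rw [map_add, map_add, map_add, Pi.add_apply, Pi.add_apply, ← ha n, ← hb n, map_add, mul_add,
          add_mul]
        abel
      smul_mem' := fun c a ha n => by
        rw [map_smul, map_smul, map_smul, Pi.smul_apply, Pi.smul_apply, ← ha n, map_smul,
          mul_smul_comm, smul_mul_assoc, smul_sub] }
  refine Fch.induction p W ?_ ?_ v n
  · intro n
    rw [hvac, map_zero, modes_vacuum, Pi.zero_apply]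
    split_ifs <;> simp
  · intro x k v hv n
    obtain ⟨y, μ, hy, hxy⟩ := hx x
    refine LinearMap.ext fun w => ?_
    have hv' : (fun l => D * modes p v l - twist p 1 (modes p v l) * D) = modes p (D v) :=
      funext hv
    have h01 : ∀ B w, twist p 1 B w = parityOp p (B (parityOp p w)) := fun B w => by
      rw [twist_apply]
      rfl
    rcases hxy with hxy | hxy
    · obtain ⟨I, h1, h2, h3, h4⟩ := ((modes_modeOp p x k v n w).and
        ((modes_modeOp p x k v n (parityOp p (D w))).and
        ((modes_modeOp p x k (D v) n w).and (modes_modeOp p y k v n w)))).exists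
      have e : D (modeOp p x k v) = koszul (x.parity p) 1 • modeOp p x k (D v)
          + μ • modeOp p y k v := LinearMap.congr_fun (hxy k) v
      rw [e, map_add, map_smul, map_smul, Pi.add_apply, Pi.smul_apply, Pi.smul_apply,
        LinearMap.add_apply, LinearMap.smul_apply, LinearMap.smul_apply, h3, h4,
        LinearMap.sub_apply, Module.End.mul_apply, Module.End.mul_apply, h01, h1, h2, map_sum,
        map_sum, ← sum_sub_distrib, smul_sum, smul_sum, ← sum_add_distrib]
      refine sum_congr rfl fun i _ => ?_
      have h := LinearMap.congr_fun (commutator_productTerm p D 1 x k (modes p v) n i _ _ (hD _)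
        (hxy _) (hxy _)) w
      rw [hv', twist_twist, ← hy] at h
      rw [← h01]
      refine h.trans ?_
      simp only [productTerm, LinearMap.smul_apply, LinearMap.sub_apply, LinearMap.add_apply,
        Module.End.mul_apply, map_smul]
      module
    -- Now $D$ sends the field of $x$ to a multiple of $\partial y(z)$, and the $k$-th product with
    -- $\partial y$ is $-k$ times the $(k-1)$-st product with $y$. The factor $k-i$ in the first
    -- half is absorbed by `sub_mul_choose`, the factor $i$ in the second by the reindexing `hQ`.
    · obtain ⟨N, hN⟩ := trunc_modeOp p y w
      obtain ⟨I, h1, h2, h3, h4, hI⟩ := ((modes_modeOp p x k v n w).and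
        ((modes_modeOp p x k v n (parityOp p (D w))).and
        ((modes_modeOp p x k (D v) n w).and ((modes_modeOp p y (k - 1) v n w).and
        (eventually_ge_atTop (N + 1).toNat))))).exists
      have e : D (modeOp p x k v) = koszul (x.parity p) 1 • modeOp p x k (D v)
          + (μ * -(k : ℂ)) • modeOp p y (k - 1) v := LinearMap.congr_fun (hxy k) v
      have hQ := sum_choose_mul_index k (fun i => twist p (y.parity p) (modes p v (k + n - i))
        (modeOp p y (i - 1) w)) I (by rw [hN _ (by omega), map_zero])
      rw [e, map_add, map_smul, map_smul, Pi.add_apply, Pi.smul_apply, Pi.smul_apply,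
        LinearMap.add_apply, LinearMap.smul_apply, LinearMap.smul_apply, h3, h4,
        LinearMap.sub_apply, Module.End.mul_apply, Module.End.mul_apply, h01, h1, h2, map_sum,
        map_sum, ← sum_sub_distrib]
      have e2 : ∀ i ∈ range I,
          D (productTerm p (modeOp p x) (x.parity p) k (modes p v) n i w)
          - parityOp p (productTerm p (modeOp p x) (x.parity p) k (modes p v) n i
            (parityOp p (D w))) =
          koszul (x.parity p) 1 •
            productTerm p (modeOp p x) (x.parity p) k (modes p (D v)) n i w
          - (μ * ((-1) ^ i * (((k : ℂ) - i) * (Ring.choose k i : ℤ)))) •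
            modeOp p y (k - i - 1) (modes p v (n + i) w)
          + (μ * (-1) ^ k) • ((-1 : ℂ) ^ i * (Ring.choose k i : ℤ)) • (i : ℂ) •
            twist p (y.parity p) (modes p v (k + n - i)) (modeOp p y (i - 1) w) := by
        intro i _
        have h := LinearMap.congr_fun (commutator_productTerm p D 1 x k (modes p v) n i _ _ (hD _)
          (hxy _) (hxy _)) w
        rw [hv', twist_twist, ← hy] at h
        rw [← h01]
        refine h.trans ?_
        simp only [LinearMap.smul_apply, LinearMap.sub_apply, LinearMap.add_apply,
          Module.End.mul_apply, map_smul]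
        push_cast
        module
      rw [sum_congr rfl e2, sum_add_distrib, sum_sub_distrib, ← smul_sum (r := μ * (-1) ^ k), hQ]
      simp only [smul_sum]
      rw [← sum_sub_distrib, ← sum_add_distrib, ← sum_add_distrib]
      refine sum_congr rfl fun i _ => ?_
      rw [sub_mul_choose]
      simp only [productTerm, LinearMap.smul_apply, LinearMap.sub_apply, Module.End.mul_apply]
      rw [show k - (i : ℤ) - 1 = k - 1 - i by ring,
        show k + n - ((i + 1 : ℕ) : ℤ) = k - 1 + n - i by push_cast; ring,
        show ((i + 1 : ℕ) : ℤ) - 1 = i by push_cast; ring, zpow_sub_one₀ (by norm_num),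
        show ((-1 : ℂ))⁻¹ = -1 by norm_num]
      module

end Translation

/-! ### The generators $\gamma, c, b, \beta$ and commutators with quadratic fields -/

section Quadratic

open Filter Finset

variable {A : Type*}

/-! ### The generators `γ`, `c`, `b`, `β` -/

/-- The generator `γ` attached to `a`. -/
def gammaGen (p : A → ZMod 2) (a : A) : Gen A := if p a = 0 then .phi a else .phiBar a

/-- The generator `c` attached to `a`. -/
def cGen (p : A → ZMod 2) (a : A) : Gen A := if p a = 0 then .dphi a else .dphiBar a

/-- The generator `b` attached to `a`. -/
def bGen (p : A → ZMod 2) (a : A) : Gen A := if p a = 0 then .phiBar a else .phi a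

/-- The generator `β` attached to `a`. -/
def betaGen (p : A → ZMod 2) (a : A) : Gen A := if p a = 0 then .dphiBar a else .dphi a

theorem gammaVec_eq (p : A → ZMod 2) (a : A) : gammaVec p a = vec p (gammaGen p a) := by
  unfold gammaVec gammaGen
  split_ifs <;> rfl

theorem cVec_eq (p : A → ZMod 2) (a : A) : cVec p a = vec p (cGen p a) := by
  unfold cVec cGen
  split_ifs <;> rfl

theorem bVec_eq (p : A → ZMod 2) (a : A) : bVec p a = vec p (bGen p a) := by
  unfold bVec bGen
  split_ifs <;> rfl

theorem betaVec_eq (p : A → ZMod 2) (a : A) : betaVec p a = vec p (betaGen p a) := by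
  unfold betaVec betaGen
  split_ifs <;> rfl

/-- This reduces any check over all generators to four cases in which the parity of $a$ no longer
appears. -/
theorem gen_cases (p : A → ZMod 2) (x : Gen A) :
    ∃ a, x = gammaGen p a ∨ x = cGen p a ∨ x = bGen p a ∨ x = betaGen p a := by
  cases x with
  | phi a => exact ⟨a, by unfold gammaGen bGen; split_ifs <;> simp⟩
  | dphi a => exact ⟨a, by unfold cGen betaGen; split_ifs <;> simp⟩
  | phiBar a => exact ⟨a, by unfold gammaGen bGen; split_ifs <;> simp⟩
  | dphiBar a => exact ⟨a, by unfold cGen betaGen; split_ifs <;> simp⟩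

theorem parity_gammaGen (p : A → ZMod 2) (a : A) : (gammaGen p a).parity p = 0 := by
  rcases zmodTwo_cases (p a) with h | h <;> simp [gammaGen, Gen.parity, h, CharTwo.add_self_eq_zero]

theorem parity_cGen (p : A → ZMod 2) (a : A) : (cGen p a).parity p = 1 := by
  rcases zmodTwo_cases (p a) with h | h <;> simp [cGen, Gen.parity, h]

theorem parity_bGen (p : A → ZMod 2) (a : A) : (bGen p a).parity p = 1 := by
  rcases zmodTwo_cases (p a) with h | h <;> simp [bGen, Gen.parity, h]

theorem parity_betaGen (p : A → ZMod 2) (a : A) : (betaGen p a).parity p = 0 := by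
  rcases zmodTwo_cases (p a) with h | h <;> simp [betaGen, Gen.parity, h, CharTwo.add_self_eq_zero]

section Pairing

-- In terms of $\gamma, c, b, \beta$ the signs depending on the parity of $a$ disappear: the pairing
-- of the odd $b, c$ is symmetric, that of the even $\beta, \gamma$ antisymmetric, with $-1$ only
-- for $(\gamma, \beta)$.
open Classical in
theorem pairing_c_b (p : A → ZMod 2) (a a' : A) :
    Gen.pairing p (cGen p a) (bGen p a') = if a = a' then 1 else 0 := by
  by_cases h : a = a'
  · subst h
    rcases zmodTwo_cases (p a) with h | h <;> simp [cGen, bGen, Gen.pairing, h]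
  · unfold cGen bGen
    split_ifs <;> simp [Gen.pairing, h]

open Classical in
theorem pairing_b_c (p : A → ZMod 2) (a a' : A) :
    Gen.pairing p (bGen p a) (cGen p a') = if a = a' then 1 else 0 := by
  by_cases h : a = a'
  · subst h
    rcases zmodTwo_cases (p a) with h | h <;>
      simp [cGen, bGen, Gen.pairing, h, CharTwo.add_self_eq_zero]
  · unfold cGen bGen
    split_ifs <;> simp [Gen.pairing, h]

open Classical in
theorem pairing_beta_gamma (p : A → ZMod 2) (a a' : A) :
    Gen.pairing p (betaGen p a) (gammaGen p a') = if a = a' then 1 else 0 := by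
  by_cases h : a = a'
  · subst h
    rcases zmodTwo_cases (p a) with h | h <;> simp [betaGen, gammaGen, Gen.pairing, h]
  · unfold betaGen gammaGen
    split_ifs <;> simp [Gen.pairing, h]

open Classical in
theorem pairing_gamma_beta (p : A → ZMod 2) (a a' : A) :
    Gen.pairing p (gammaGen p a) (betaGen p a') = if a = a' then -1 else 0 := by
  by_cases h : a = a'
  · subst h
    rcases zmodTwo_cases (p a) with h | h <;>
      simp [betaGen, gammaGen, Gen.pairing, h, show (1 : ZMod 2).val = 1 from rfl]
  · unfold betaGen gammaGen
    split_ifs <;> simp [Gen.pairing, h]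

theorem pairing_of_parity (p : A → ZMod 2) (x y : Gen A) (h : x.parity p ≠ y.parity p) :
    Gen.pairing p x y = 0 := by
  by_contra h'
  exact h (Gen.pairing_parity p x y h')

theorem pairing_c_c (p : A → ZMod 2) (a a' : A) : Gen.pairing p (cGen p a) (cGen p a') = 0 := by
  unfold cGen
  split_ifs <;> simp [Gen.pairing]

theorem pairing_b_b (p : A → ZMod 2) (a a' : A) : Gen.pairing p (bGen p a) (bGen p a') = 0 := by
  unfold bGen
  split_ifs <;> simp [Gen.pairing]

theorem pairing_gamma_gamma (p : A → ZMod 2) (a a' : A) :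
    Gen.pairing p (gammaGen p a) (gammaGen p a') = 0 := by
  unfold gammaGen
  split_ifs <;> simp [Gen.pairing]

theorem pairing_beta_beta (p : A → ZMod 2) (a a' : A) :
    Gen.pairing p (betaGen p a) (betaGen p a') = 0 := by
  unfold betaGen
  split_ifs <;> simp [Gen.pairing]

theorem pairing_gamma_c (p : A → ZMod 2) (a a' : A) :
    Gen.pairing p (gammaGen p a) (cGen p a') = 0 :=
  pairing_of_parity p _ _ (by simp [parity_gammaGen, parity_cGen])

theorem pairing_gamma_b (p : A → ZMod 2) (a a' : A) :
    Gen.pairing p (gammaGen p a) (bGen p a') = 0 :=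
  pairing_of_parity p _ _ (by simp [parity_gammaGen, parity_bGen])

theorem pairing_beta_c (p : A → ZMod 2) (a a' : A) :
    Gen.pairing p (betaGen p a) (cGen p a') = 0 :=
  pairing_of_parity p _ _ (by simp [parity_betaGen, parity_cGen])

theorem pairing_beta_b (p : A → ZMod 2) (a a' : A) :
    Gen.pairing p (betaGen p a) (bGen p a') = 0 :=
  pairing_of_parity p _ _ (by simp [parity_betaGen, parity_bGen])

theorem pairing_c_gamma (p : A → ZMod 2) (a a' : A) :
    Gen.pairing p (cGen p a) (gammaGen p a') = 0 :=
  pairing_of_parity p _ _ (by simp [parity_gammaGen, parity_cGen])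

theorem pairing_b_gamma (p : A → ZMod 2) (a a' : A) :
    Gen.pairing p (bGen p a) (gammaGen p a') = 0 :=
  pairing_of_parity p _ _ (by simp [parity_gammaGen, parity_bGen])

theorem pairing_c_beta (p : A → ZMod 2) (a a' : A) :
    Gen.pairing p (cGen p a) (betaGen p a') = 0 :=
  pairing_of_parity p _ _ (by simp [parity_betaGen, parity_cGen])

theorem pairing_b_beta (p : A → ZMod 2) (a a' : A) :
    Gen.pairing p (bGen p a) (betaGen p a') = 0 :=
  pairing_of_parity p _ _ (by simp [parity_betaGen, parity_bGen])

end Pairing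

theorem koszul_zero_left (q : ZMod 2) : koszul 0 q = 1 := by simp [koszul]

theorem koszul_zero_right (q : ZMod 2) : koszul q 0 = 1 := by simp [koszul]

theorem koszul_one_one : koszul 1 1 = -1 := by
  simp [koszul, show (1 : ZMod 2).val = 1 from rfl]

/-! ### Quadratic vectors -/

/-- All coefficients $(-1)^i\binom{-1}{i}$ equal $1$, and the identity field has a single mode, so
exactly one summand survives: in the first half when $n<0$, in the second when $n \ge 0$. -/
theorem modes_vec (p : A → ZMod 2) (x : Gen A) (n : ℤ) :
    modes p (modeOp p x (-1) (vacuum p)) n = modeOp p x n := by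
  refine LinearMap.ext fun w => ?_
  obtain ⟨I, h, hI⟩ := ((modes_modeOp p x (-1) (vacuum p) n w).and
    (eventually_gt_atTop (n.natAbs))).exists
  have hc : ∀ i : ℕ, (-1 : ℂ) ^ i * (Ring.choose (-1 : ℤ) i : ℤ) = 1 := by
    intro i
    have := choose_neg_succ 0 i
    rw [Nat.cast_zero, zero_add, zero_add, Nat.choose_self] at this
    rw [this]
    push_cast
    rw [mul_one, ← mul_pow]
    norm_num
  rw [h]
  simp only [productTerm, hc, one_smul, modes_vacuum]
  rcases lt_or_ge n 0 with hn | hn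
  · rw [sum_eq_single (-1 - n).toNat]
    · rw [if_pos (by omega), if_neg (by omega), show (-1 : ℤ) - ((-1 - n).toNat : ℤ) = n by omega]
      simp
    · intro i _ hi
      rw [if_neg (by omega), if_neg (by omega)]
      simp
    · intro hi
      exact absurd (mem_range.2 (by omega)) hi
  · rw [sum_eq_single n.toNat]
    · rw [if_neg (by omega), if_pos (by omega), Int.toNat_of_nonneg hn]
      simp
    · intro i _ hi
      rw [if_neg (by omega), if_neg (by omega)]
      simp
    · intro hi
      exact absurd (mem_range.2 (by omega)) hi

theorem transl_vec (p : A → ZMod 2) (x : Gen A) :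
    transl p (modeOp p x (-1) (vacuum p)) = modeOp p x (-2) (vacuum p) := by
  rw [transl_modeOp, transl_vacuum]
  norm_num

theorem modes_transl_vec (p : A → ZMod 2) (x : Gen A) (n : ℤ) :
    modes p (modeOp p x (-2) (vacuum p)) n = -(n : ℂ) • modeOp p x (n - 1) := by
  rw [← transl_vec, modes_transl, modes_vec]

theorem nop_vec_vec (p : A → ZMod 2) (x y : Gen A) :
    nop p (vec p x) (vec p y) = modeOp p x (-1) (modeOp p y (-1) (vacuum p)) := by
  rw [nop, ← modes_apply, vec, modes_vec, vec]

theorem nop_transl_vec_vec (p : A → ZMod 2) (x y : Gen A) :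
    nop p (transl p (vec p x)) (vec p y) = modeOp p x (-2) (modeOp p y (-1) (vacuum p)) := by
  rw [nop, ← modes_apply, vec, transl_vec, modes_transl_vec, vec]
  norm_num

theorem nop_vec_transl_vec (p : A → ZMod 2) (x y : Gen A) :
    nop p (vec p x) (transl p (vec p y)) = modeOp p x (-1) (modeOp p y (-2) (vacuum p)) := by
  rw [nop, ← modes_apply, vec, modes_vec, vec, transl_vec]

theorem modeOp_modeOp_vacuum (p : A → ZMod 2) (x y : Gen A) (m l : ℤ) (hm : 0 ≤ m)
    (h : m + l = -1) :
    modeOp p x m (modeOp p y l (vacuum p)) = Gen.pairing p x y • vacuum p := by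
  rw [modeOp_modeOp_apply, if_pos h, modeOp_vacuum p x m hm, map_zero, smul_zero, zero_add]

theorem modeOp_modeOp_vacuum_of_ne (p : A → ZMod 2) (x y : Gen A) (m l : ℤ) (hm : 0 ≤ m)
    (h : m + l ≠ -1) : modeOp p x m (modeOp p y l (vacuum p)) = 0 := by
  rw [modeOp_modeOp_apply, if_neg h, modeOp_vacuum p x m hm, map_zero, smul_zero, zero_add,
    zero_smul]

theorem modeOp_quadratic (p : A → ZMod 2) (x y z : Gen A) (j k l : ℤ) (hj : 0 ≤ j) :
    modeOp p x j (modeOp p y k (modeOp p z l (vacuum p))) =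
      (if j + k = -1 then Gen.pairing p x y else 0) • modeOp p z l (vacuum p)
      + (koszul (x.parity p) (y.parity p) * (if j + l = -1 then Gen.pairing p x z else 0)) •
        modeOp p y k (vacuum p) := by
  rw [modeOp_modeOp_apply, modeOp_modeOp_apply p x z, modeOp_vacuum p x j hj, map_zero, smul_zero,
    zero_add, map_smul, smul_smul, add_comm]

/-- The supercommutator of the mode `x_m` of a free field with the `n`-th mode of the field of a
vector. -/
def freeComm (p : A → ZMod 2) (x : Gen A) (m n : ℤ) : Fch p →ₗ[ℂ] Module.End ℂ (Fch p) where
  toFun v := modeOp p x m * modes p v n - twist p (x.parity p) (modes p v n) * modeOp p x m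
  map_add' u v := by
    simp only [map_add, Pi.add_apply, mul_add, add_mul]
    abel
  map_smul' c v := by
    simp only [map_smul, Pi.smul_apply, mul_smul_comm, smul_mul_assoc, RingHom.id_apply, smul_sub]

/-- The quadratic vectors in use have modes $-1$ and $-2$ only, so they contract with $x_j$ only for
$j = 0, 1$ and the commutator formula has two terms. -/
theorem freeComm_of_forall (p : A → ZMod 2) (x : Gen A) (m n : ℤ) (v : Fch p)
    (h : ∀ j : ℕ, 2 ≤ j → modeOp p x j v = 0) :
    freeComm p x m n v = modes p (modeOp p x 0 v) (m + n)
      + (m : ℂ) • modes p (modeOp p x 1 v) (m + n - 1) := by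
  refine (modeOp_commutator p x v m n 2 h).trans ?_
  rw [sum_range_succ, sum_range_one, Ring.choose_one_right, Ring.choose_zero_right,
    show n + (m - ((1 : ℕ) : ℤ)) = m + n - 1 by push_cast; ring,
    show n + (m - ((0 : ℕ) : ℤ)) = m + n by push_cast; ring]
  simp

theorem freeComm_vec_vec (p : A → ZMod 2) (x y z : Gen A) (m n : ℤ) :
    freeComm p x m n (modeOp p y (-1) (modeOp p z (-1) (vacuum p))) =
      Gen.pairing p x y • modeOp p z (m + n)
      + (koszul (x.parity p) (y.parity p) * Gen.pairing p x z) • modeOp p y (m + n) := by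
  rw [freeComm_of_forall, modeOp_quadratic p x y z 0 _ _ (by norm_num),
    modeOp_quadratic p x y z 1 _ _ (by norm_num)]
  · simp [modes_vec]
  · intro j hj
    rw [modeOp_quadratic p x y z j _ _ (by positivity), if_neg (by omega), if_neg (by omega)]
    simp

theorem freeComm_transl_vec_vec (p : A → ZMod 2) (x y z : Gen A) (m n : ℤ) :
    freeComm p x m n (modeOp p y (-2) (modeOp p z (-1) (vacuum p))) =
      (Gen.pairing p x y * m) • modeOp p z (m + n - 1)
      + (koszul (x.parity p) (y.parity p) * Gen.pairing p x z * -((m : ℂ) + n)) •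
        modeOp p y (m + n - 1) := by
  rw [freeComm_of_forall, modeOp_quadratic p x y z 0 _ _ (by norm_num),
    modeOp_quadratic p x y z 1 _ _ (by norm_num)]
  · simp only [map_add, map_smul, Pi.add_apply, Pi.smul_apply, modes_vec, modes_transl_vec]
    norm_num
    module
  · intro j hj
    rw [modeOp_quadratic p x y z j _ _ (by positivity), if_neg (by omega), if_neg (by omega)]
    simp

theorem freeComm_vec_transl_vec (p : A → ZMod 2) (x y z : Gen A) (m n : ℤ) :
    freeComm p x m n (modeOp p y (-1) (modeOp p z (-2) (vacuum p))) =
      (Gen.pairing p x y * -((m : ℂ) + n)) • modeOp p z (m + n - 1)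
      + (koszul (x.parity p) (y.parity p) * Gen.pairing p x z * m) • modeOp p y (m + n - 1) := by
  rw [freeComm_of_forall, modeOp_quadratic p x y z 0 _ _ (by norm_num),
    modeOp_quadratic p x y z 1 _ _ (by norm_num)]
  · simp only [map_add, map_smul, Pi.add_apply, Pi.smul_apply, modes_vec, modes_transl_vec]
    norm_num
    module
  · intro j hj
    rw [modeOp_quadratic p x y z j _ _ (by positivity), if_neg (by omega), if_neg (by omega)]
    simp

/-- The commutator formula describes $x_m$ acting on $Q_n$; solving it for $Q_n x_m$ turns it into a
rule for evaluating $Q_n$ on vectors. -/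
theorem modes_apply_modeOp (p : A → ZMod 2) {e : ZMod 2} {Q : Fch p} (hQ : Q ∈ grade p e)
    (x : Gen A) (m n : ℤ) (v : Fch p) :
    modes p Q n (modeOp p x m v) =
      koszul (x.parity p) e • (modeOp p x m (modes p Q n v) - freeComm p x m n Q v) := by
  change _ = koszul (x.parity p) e • (_ - (modeOp p x m * modes p Q n
    - twist p (x.parity p) (modes p Q n) * modeOp p x m) v)
  rw [twist_modes p hQ, LinearMap.sub_apply, Module.End.mul_apply, sub_sub_cancel,
    smul_mul_assoc, LinearMap.smul_apply, smul_smul, koszul_mul_self, one_smul]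
  rfl

theorem quadratic_mem_grade (p : A → ZMod 2) (x y : Gen A) (k l : ℤ) {e : ZMod 2}
    (he : x.parity p + y.parity p = e) :
    modeOp p x k (modeOp p y l (vacuum p)) ∈ grade p e := by
  have h0 : vacuum p ∈ grade p 0 := by
    rw [mem_grade, parityOp_vacuum, koszul_zero_right, one_smul]
  have := modeOp_mem_grade p x k (modeOp_mem_grade p y l h0)
  rwa [add_zero, he] at this

theorem cb_parity (p : A → ZMod 2) (a : A) :
    (cGen p a).parity p + (bGen p a).parity p = 0 := by
  rw [parity_cGen, parity_bGen, CharTwo.add_self_eq_zero]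

theorem gamma_beta_parity (p : A → ZMod 2) (a : A) :
    (gammaGen p a).parity p + (betaGen p a).parity p = 0 := by
  rw [parity_gammaGen, parity_betaGen, add_zero]

/-! ### The vectors `J`, `G⁺`, `G⁻`, `L` -/

variable [Fintype A]

theorem GPlusSh_eq (p : A → ZMod 2) :
    GPlusSh p = ∑ a, modeOp p (cGen p a) (-1) (modeOp p (betaGen p a) (-1) (vacuum p)) := by
  simp only [GPlusSh, cVec_eq, betaVec_eq, nop_vec_vec]

theorem GMinusSh_eq (p : A → ZMod 2) (t : A → ℂ) :
    GMinusSh p t = ∑ a,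
      ((t a + 1) • modeOp p (gammaGen p a) (-2) (modeOp p (bGen p a) (-1) (vacuum p))
      + t a • modeOp p (gammaGen p a) (-1) (modeOp p (bGen p a) (-2) (vacuum p))) := by
  simp only [GMinusSh, gammaVec_eq, bVec_eq, nop_transl_vec_vec, nop_vec_transl_vec]

theorem LSh_eq (p : A → ZMod 2) (t : A → ℂ) :
    LSh p t = ∑ a, (2⁻¹ : ℂ) •
      ((t a - 1) • modeOp p (cGen p a) (-1) (modeOp p (bGen p a) (-2) (vacuum p))
      + (t a + 1) • modeOp p (cGen p a) (-2) (modeOp p (bGen p a) (-1) (vacuum p))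
      + t a • modeOp p (gammaGen p a) (-1) (modeOp p (betaGen p a) (-2) (vacuum p))
      + (t a + 2) • modeOp p (gammaGen p a) (-2) (modeOp p (betaGen p a) (-1) (vacuum p))) := by
  simp only [LSh, gammaVec_eq, bVec_eq, cVec_eq, betaVec_eq, nop_transl_vec_vec,
    nop_vec_transl_vec]

theorem JSh_eq (p : A → ZMod 2) (t : A → ℂ) :
    JSh p t = ∑ a,
      ((t a + 1) • modeOp p (cGen p a) (-1) (modeOp p (bGen p a) (-1) (vacuum p))
      + t a • modeOp p (gammaGen p a) (-1) (modeOp p (betaGen p a) (-1) (vacuum p))) := by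
  rw [JSh, ← sum_add_distrib]
  refine sum_congr rfl fun a _ => ?_
  rcases zmodTwo_cases (p a) with h | h <;>
    simp only [h, cGen, bGen, gammaGen, betaGen, nop_vec_vec, if_true, one_ne_zero, if_false] <;>
    module

/-- For odd $a$ the roles of $\phi_a$ and $\phi^{\bar a}$ are exchanged, so the factors stand in the
opposite order. Each product has an even factor and its two modes never contract, hence the order is
immaterial. -/
theorem TSh_eq (p : A → ZMod 2) (t : A → ℂ) : TSh p t = GPlusSh p + GMinusSh p t := by
  have comm : ∀ (x y : Gen A) (k l : ℤ), x.parity p * y.parity p = 0 → k < 0 → l < 0 →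
      k + l ≠ -1 → modeOp p x k (modeOp p y l (vacuum p)) =
        modeOp p y l (modeOp p x k (vacuum p)) := by
    intro x y k l hxy hk hl hkl
    rw [modeOp_modeOp_apply, if_neg hkl, zero_smul, add_zero]
    rcases mul_eq_zero.1 hxy with h | h
    · rw [h, koszul_zero_left, one_smul]
    · rw [h, koszul_zero_right, one_smul]
  rw [TSh, GPlusSh_eq, GMinusSh_eq, ← sum_add_distrib]
  refine sum_congr rfl fun a _ => ?_
  rcases zmodTwo_cases (p a) with h | h <;>
    simp only [h, cGen, bGen, gammaGen, betaGen, nop_vec_vec, nop_transl_vec_vec,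
      nop_vec_transl_vec, if_true, one_ne_zero, if_false]
  · module
  · have hp : ∀ q : ZMod 2, q * (q + 1) = 0 := by decide
    rw [comm (.phi a) (.phiBar a) (-2) (-1) (hp _) (by norm_num) (by norm_num) (by norm_num),
      comm (.phi a) (.phiBar a) (-1) (-2) (hp _) (by norm_num) (by norm_num) (by norm_num),
      comm (.dphi a) (.dphiBar a) (-1) (-1) (by rw [mul_comm]; exact hp _) (by norm_num)
        (by norm_num) (by norm_num)]
    module

theorem GPlusSh_mem_grade (p : A → ZMod 2) : GPlusSh p ∈ grade p 1 := by
  rw [GPlusSh_eq]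
  exact Submodule.sum_mem _ fun a _ => quadratic_mem_grade p _ _ _ _ (by
    rw [parity_cGen, parity_betaGen, add_zero])

theorem GMinusSh_mem_grade (p : A → ZMod 2) (t : A → ℂ) : GMinusSh p t ∈ grade p 1 := by
  rw [GMinusSh_eq]
  exact Submodule.sum_mem _ fun a _ => Submodule.add_mem _
    (Submodule.smul_mem _ _ (quadratic_mem_grade p _ _ _ _ (by
      rw [parity_gammaGen, parity_bGen, zero_add])))
    (Submodule.smul_mem _ _ (quadratic_mem_grade p _ _ _ _ (by
      rw [parity_gammaGen, parity_bGen, zero_add])))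

theorem JSh_mem_grade (p : A → ZMod 2) (t : A → ℂ) : JSh p t ∈ grade p 0 := by
  rw [JSh_eq]
  exact Submodule.sum_mem _ fun a _ => Submodule.add_mem _
    (Submodule.smul_mem _ _ (quadratic_mem_grade p _ _ _ _ (cb_parity p a)))
    (Submodule.smul_mem _ _ (quadratic_mem_grade p _ _ _ _ (gamma_beta_parity p a)))

theorem LSh_mem_grade (p : A → ZMod 2) (t : A → ℂ) : LSh p t ∈ grade p 0 := by
  rw [LSh_eq]
  refine Submodule.sum_mem _ fun a _ => Submodule.smul_mem _ _ (Submodule.add_mem _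
    (Submodule.add_mem _ (Submodule.add_mem _ ?_ ?_) ?_) ?_) <;>
    refine Submodule.smul_mem _ _ (quadratic_mem_grade p _ _ _ _ ?_)
  exacts [cb_parity p a, cb_parity p a, gamma_beta_parity p a, gamma_beta_parity p a]

end Quadratic

/-! ### Action tables of $G^\pm$, $J$, $L$ and their mutual products -/

section Products

set_option linter.unusedSimpArgs false

open Filter Finset

variable {A : Type*} [Fintype A]

/-! ### The action of `G⁺`, `G⁻`, `J`, `L` on the generators -/

theorem modes_GPlusSh_modeOp (p : A → ZMod 2) (a : A) (n m : ℤ) (v : Fch p) :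
    modes p (GPlusSh p) n (modeOp p (gammaGen p a) m v) =
      modeOp p (gammaGen p a) m (modes p (GPlusSh p) n v) + modeOp p (cGen p a) (m + n) v ∧
    modes p (GPlusSh p) n (modeOp p (cGen p a) m v) =
      -modeOp p (cGen p a) m (modes p (GPlusSh p) n v) ∧
    modes p (GPlusSh p) n (modeOp p (bGen p a) m v) =
      -modeOp p (bGen p a) m (modes p (GPlusSh p) n v) + modeOp p (betaGen p a) (m + n) v ∧
    modes p (GPlusSh p) n (modeOp p (betaGen p a) m v) =
      modeOp p (betaGen p a) m (modes p (GPlusSh p) n v) := by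
  classical
  simp only [modes_apply_modeOp p (GPlusSh_mem_grade p), parity_gammaGen, parity_cGen, parity_bGen,
    parity_betaGen, koszul_zero_left, koszul_one_one, congrArg (freeComm p _ _ _) (GPlusSh_eq p),
    map_sum, freeComm_vec_vec, pairing_c_b, pairing_b_c, pairing_beta_gamma, pairing_gamma_beta,
    pairing_c_c, pairing_b_b, pairing_gamma_gamma, pairing_beta_beta, pairing_gamma_c,
    pairing_gamma_b, pairing_beta_c, pairing_beta_b, pairing_c_gamma, pairing_b_gamma,
    pairing_c_beta, pairing_b_beta, mul_zero, zero_smul, zero_add, add_zero, one_mul, mul_ite,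
    mul_one, ite_smul, sum_ite_eq, mem_univ, if_true, sum_const_zero, LinearMap.zero_apply,
    LinearMap.smul_apply]
  refine ⟨?_, ?_, ?_, ?_⟩ <;> module

/-- Every $t_a$ comes with a factor $n$, because $t_a$ is the coefficient of $\partial(\gamma b)$ in
$G^-$ and a total derivative has no zero mode. -/
theorem modes_GMinusSh_modeOp (p : A → ZMod 2) (t : A → ℂ) (a : A) (n m : ℤ) (v : Fch p) :
    modes p (GMinusSh p t) n (modeOp p (gammaGen p a) m v) =
      modeOp p (gammaGen p a) m (modes p (GMinusSh p t) n v) ∧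
    modes p (GMinusSh p t) n (modeOp p (cGen p a) m v) =
      -modeOp p (cGen p a) m (modes p (GMinusSh p t) n v)
        - ((m : ℂ) + (t a + 1) * n) • modeOp p (gammaGen p a) (m + n - 1) v ∧
    modes p (GMinusSh p t) n (modeOp p (bGen p a) m v) =
      -modeOp p (bGen p a) m (modes p (GMinusSh p t) n v) ∧
    modes p (GMinusSh p t) n (modeOp p (betaGen p a) m v) =
      modeOp p (betaGen p a) m (modes p (GMinusSh p t) n v)
        + (t a * n - m) • modeOp p (bGen p a) (m + n - 1) v := by
  classical
  simp only [modes_apply_modeOp p (GMinusSh_mem_grade p t), parity_gammaGen, parity_cGen,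
    parity_bGen, parity_betaGen, koszul_zero_left, koszul_zero_right, koszul_one_one,
    congrArg (freeComm p _ _ _) (GMinusSh_eq p t), map_sum, map_add, map_smul,
    freeComm_transl_vec_vec, freeComm_vec_transl_vec, pairing_c_b, pairing_b_c,
    pairing_beta_gamma, pairing_gamma_beta, pairing_c_c, pairing_b_b, pairing_gamma_gamma,
    pairing_beta_beta, pairing_gamma_c, pairing_gamma_b, pairing_beta_c, pairing_beta_b,
    pairing_c_gamma, pairing_b_gamma, pairing_c_beta, pairing_b_beta, mul_zero, zero_mul,
    zero_smul, smul_zero, zero_add, add_zero, one_mul, mul_ite, ite_mul, mul_one, ite_smul,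
    smul_ite, sum_add_distrib, sum_ite_eq, mem_univ, if_true, sum_const_zero,
    LinearMap.zero_apply, LinearMap.smul_apply, LinearMap.add_apply]
  refine ⟨?_, ?_, ?_, ?_⟩ <;> module

/-- The generators $\gamma, c, b, \beta$ are eigenvectors of $J_{(0)}$, with charges $t_a$, $t_a+1$,
$-(t_a+1)$, $-t_a$. -/
theorem modes_JSh_modeOp (p : A → ZMod 2) (t : A → ℂ) (a : A) (n m : ℤ) (v : Fch p) :
    modes p (JSh p t) n (modeOp p (gammaGen p a) m v) =
      modeOp p (gammaGen p a) m (modes p (JSh p t) n v)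
        + t a • modeOp p (gammaGen p a) (m + n) v ∧
    modes p (JSh p t) n (modeOp p (cGen p a) m v) =
      modeOp p (cGen p a) m (modes p (JSh p t) n v)
        + (t a + 1) • modeOp p (cGen p a) (m + n) v ∧
    modes p (JSh p t) n (modeOp p (bGen p a) m v) =
      modeOp p (bGen p a) m (modes p (JSh p t) n v)
        - (t a + 1) • modeOp p (bGen p a) (m + n) v ∧
    modes p (JSh p t) n (modeOp p (betaGen p a) m v) =
      modeOp p (betaGen p a) m (modes p (JSh p t) n v)
        - t a • modeOp p (betaGen p a) (m + n) v := by
  classical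
  simp only [modes_apply_modeOp p (JSh_mem_grade p t), parity_gammaGen, parity_cGen,
    parity_bGen, parity_betaGen, koszul_zero_left, koszul_zero_right, koszul_one_one,
    congrArg (freeComm p _ _ _) (JSh_eq p t), map_sum, map_add, map_smul,
    freeComm_vec_vec, pairing_c_b, pairing_b_c,
    pairing_beta_gamma, pairing_gamma_beta, pairing_c_c, pairing_b_b, pairing_gamma_gamma,
    pairing_beta_beta, pairing_gamma_c, pairing_gamma_b, pairing_beta_c, pairing_beta_b,
    pairing_c_gamma, pairing_b_gamma, pairing_c_beta, pairing_b_beta, mul_zero,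
    zero_smul, smul_zero, zero_add, add_zero, one_mul, mul_ite, mul_one, ite_smul,
    smul_ite, sum_ite_eq, mem_univ, if_true, LinearMap.smul_apply]
  refine ⟨?_, ?_, ?_, ?_⟩ <;> module

/-- Here $t_a$ multiplies $\tfrac12\partial(cb + \gamma\beta)$, so again it appears only with a
factor $n$. At $n = 1$ the formulas give the conformal weights $-t_a/2$, $(1-t_a)/2$, $(1+t_a)/2$,
$1+t_a/2$ of $\gamma, c, b, \beta$. -/
theorem modes_LSh_modeOp (p : A → ZMod 2) (t : A → ℂ) (a : A) (n m : ℤ) (v : Fch p) :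
    modes p (LSh p t) n (modeOp p (gammaGen p a) m v) =
      modeOp p (gammaGen p a) m (modes p (LSh p t) n v)
        - (m + (t a + 2) / 2 * n) • modeOp p (gammaGen p a) (m + n - 1) v ∧
    modes p (LSh p t) n (modeOp p (cGen p a) m v) =
      modeOp p (cGen p a) m (modes p (LSh p t) n v)
        - (m + (t a + 1) / 2 * n) • modeOp p (cGen p a) (m + n - 1) v ∧
    modes p (LSh p t) n (modeOp p (bGen p a) m v) =
      modeOp p (bGen p a) m (modes p (LSh p t) n v)
        + ((t a - 1) / 2 * n - m) • modeOp p (bGen p a) (m + n - 1) v ∧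
    modes p (LSh p t) n (modeOp p (betaGen p a) m v) =
      modeOp p (betaGen p a) m (modes p (LSh p t) n v)
        + (t a / 2 * n - m) • modeOp p (betaGen p a) (m + n - 1) v := by
  classical
  simp only [modes_apply_modeOp p (LSh_mem_grade p t), parity_gammaGen, parity_cGen,
    parity_bGen, parity_betaGen, koszul_zero_left, koszul_zero_right, koszul_one_one,
    congrArg (freeComm p _ _ _) (LSh_eq p t), map_sum, map_add, map_smul,
    freeComm_transl_vec_vec, freeComm_vec_transl_vec, pairing_c_b, pairing_b_c,
    pairing_beta_gamma, pairing_gamma_beta, pairing_c_c, pairing_b_b, pairing_gamma_gamma,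
    pairing_beta_beta, pairing_gamma_c, pairing_gamma_b, pairing_beta_c, pairing_beta_b,
    pairing_c_gamma, pairing_b_gamma, pairing_c_beta, pairing_b_beta, mul_zero, zero_mul,
    zero_smul, smul_zero, zero_add, add_zero, one_mul, mul_ite, ite_mul, mul_one, ite_smul,
    smul_ite, smul_add, sum_add_distrib, sum_ite_eq, mem_univ, if_true,
    sum_const_zero, LinearMap.zero_apply, LinearMap.smul_apply, LinearMap.add_apply]
  refine ⟨?_, ?_, ?_, ?_⟩ <;> module

/-! ### Products of `G⁺`, `G⁻`, `J`, `L` -/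

theorem JSh_zero_JSh (p : A → ZMod 2) (t : A → ℂ) : modes p (JSh p t) 0 (JSh p t) = 0 := by
  rw [congrArg (modes p (JSh p t) 0) (JSh_eq p t), map_sum]
  refine sum_eq_zero fun a _ => ?_
  simp only [map_add, map_smul, map_sub, map_zero, modes_JSh_modeOp,
    modes_apply_vacuum_of_nonneg p _ 0 le_rfl]
  norm_num

/-- The pair $c, b$ contributes $(t_a+1)^2$ and the pair $\gamma, \beta$ contributes $-t_a^2$. -/
theorem JSh_one_JSh (p : A → ZMod 2) (t : A → ℂ) :
    modes p (JSh p t) 1 (JSh p t) = (cSh t / 3) • vacuum p := by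
  rw [congrArg (modes p (JSh p t) 1) (JSh_eq p t), map_sum, cSh, sum_div, sum_smul]
  refine sum_congr rfl fun a _ => ?_
  simp (disch := omega) only [map_add, map_smul, map_sub, map_zero, modes_JSh_modeOp,
    modes_apply_vacuum_of_nonneg, modeOp_modeOp_vacuum, modeOp_vacuum, pairing_c_b,
    pairing_gamma_beta, if_true]
  module

theorem JSh_two_JSh (p : A → ZMod 2) (t : A → ℂ) (n : ℤ) (hn : 2 ≤ n) :
    modes p (JSh p t) n (JSh p t) = 0 := by
  rw [congrArg (modes p (JSh p t) n) (JSh_eq p t), map_sum]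
  refine sum_eq_zero fun a _ => ?_
  simp (disch := omega) only [map_add, map_smul, map_sub, map_zero, modes_JSh_modeOp,
    modes_apply_vacuum_of_nonneg, modeOp_modeOp_vacuum_of_ne, modeOp_vacuum]
  module

theorem GPlusSh_zero_JSh (p : A → ZMod 2) (t : A → ℂ) :
    modes p (GPlusSh p) 0 (JSh p t) = -GPlusSh p := by
  rw [congrArg (modes p (GPlusSh p) 0) (JSh_eq p t), map_sum, GPlusSh_eq p, ← sum_neg_distrib,
    ← GPlusSh_eq p]
  refine sum_congr rfl fun a _ => ?_
  simp (disch := omega) only [map_add, map_smul, map_sub, map_neg, map_zero, modes_GPlusSh_modeOp,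
    modes_apply_vacuum_of_nonneg]
  norm_num
  module

theorem GPlusSh_one_JSh (p : A → ZMod 2) (t : A → ℂ) (n : ℤ) (hn : 1 ≤ n) :
    modes p (GPlusSh p) n (JSh p t) = 0 := by
  rw [congrArg (modes p (GPlusSh p) n) (JSh_eq p t), map_sum]
  refine sum_eq_zero fun a _ => ?_
  rcases eq_or_ne n 1 with rfl | hn'
  all_goals
    simp (disch := omega) only [map_add, map_smul, map_sub, map_neg, map_zero,
      modes_GPlusSh_modeOp, modes_apply_vacuum_of_nonneg, modeOp_modeOp_vacuum,
      modeOp_modeOp_vacuum_of_ne, modeOp_vacuum, pairing_c_beta]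
    module

theorem GMinusSh_zero_JSh (p : A → ZMod 2) (t : A → ℂ) :
    modes p (GMinusSh p t) 0 (JSh p t) = GMinusSh p t := by
  rw [congrArg (modes p (GMinusSh p t) 0) (JSh_eq p t), map_sum,
    congrArg (fun G => _ = G) (GMinusSh_eq p t)]
  refine sum_congr rfl fun a _ => ?_
  simp (disch := omega) only [map_add, map_smul, map_sub, map_neg, map_zero,
    modes_GMinusSh_modeOp, modes_apply_vacuum_of_nonneg]
  norm_num

theorem GMinusSh_one_JSh (p : A → ZMod 2) (t : A → ℂ) (n : ℤ) (hn : 1 ≤ n) :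
    modes p (GMinusSh p t) n (JSh p t) = 0 := by
  rw [congrArg (modes p (GMinusSh p t) n) (JSh_eq p t), map_sum]
  refine sum_eq_zero fun a _ => ?_
  -- At $n = 1$ the parts $cb$ and $\gamma\beta$ of $J$ give $\mp t_a(t_a+1)\gamma b$, which cancel.
  rcases eq_or_ne n 1 with rfl | hn1
  · simp (disch := omega) only [map_add, map_smul, map_sub, map_neg, map_zero,
      modes_GMinusSh_modeOp, modes_apply_vacuum_of_nonneg]
    norm_num
    module
  rcases eq_or_ne n 2 with rfl | hn2
  all_goals
    simp (disch := omega) only [map_add, map_smul, map_sub, map_neg, map_zero,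
      modes_GMinusSh_modeOp, modes_apply_vacuum_of_nonneg, modeOp_modeOp_vacuum,
      modeOp_modeOp_vacuum_of_ne, modeOp_vacuum, pairing_gamma_b]
    module

/-- The modes of $G^+$ supercommute with those of $c$ and $\beta$, of which $G^+$ is made. The same
holds for $G^-$ with $\gamma$ and $b$. -/
theorem GPlusSh_GPlusSh (p : A → ZMod 2) (n : ℤ) (hn : 0 ≤ n) :
    modes p (GPlusSh p) n (GPlusSh p) = 0 := by
  rw [congrArg (modes p (GPlusSh p) n) (GPlusSh_eq p), map_sum]
  refine sum_eq_zero fun a _ => ?_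
  simp (disch := omega) only [map_zero, neg_zero, modes_GPlusSh_modeOp,
    modes_apply_vacuum_of_nonneg]

theorem GMinusSh_GMinusSh (p : A → ZMod 2) (t : A → ℂ) (n : ℤ) (hn : 0 ≤ n) :
    modes p (GMinusSh p t) n (GMinusSh p t) = 0 := by
  rw [congrArg (modes p (GMinusSh p t) n) (GMinusSh_eq p t), map_sum]
  refine sum_eq_zero fun a _ => ?_
  simp (disch := omega) only [map_add, map_smul, map_zero, neg_zero, smul_zero, add_zero,
    modes_GMinusSh_modeOp, modes_apply_vacuum_of_nonneg]

/-- Only the symmetrized product is needed: since $G^\pm$ have no products with themselves, it is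
the product of $T = G^+ + G^-$ with itself. -/
theorem GPlusSh_GMinusSh_add (p : A → ZMod 2) (t : A → ℂ) :
    modes p (GPlusSh p) 0 (GMinusSh p t) + modes p (GMinusSh p t) 0 (GPlusSh p) =
      (2 : ℂ) • LSh p t := by
  rw [congrArg (modes p (GPlusSh p) 0) (GMinusSh_eq p t), map_sum,
    congrArg (modes p (GMinusSh p t) 0) (GPlusSh_eq p), map_sum, ← sum_add_distrib, LSh_eq,
    smul_sum]
  refine sum_congr rfl fun a _ => ?_
  simp (disch := omega) only [map_add, map_smul, map_neg, map_sub, map_zero,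
    modes_GPlusSh_modeOp, modes_GMinusSh_modeOp, modes_apply_vacuum_of_nonneg]
  norm_num
  module

/-- The two summands are $J$ and $-J$. -/
theorem GPlusSh_one_GMinusSh_add (p : A → ZMod 2) (t : A → ℂ) :
    modes p (GPlusSh p) 1 (GMinusSh p t) + modes p (GMinusSh p t) 1 (GPlusSh p) = 0 := by
  rw [congrArg (modes p (GPlusSh p) 1) (GMinusSh_eq p t), map_sum,
    congrArg (modes p (GMinusSh p t) 1) (GPlusSh_eq p), map_sum, ← sum_add_distrib]
  refine sum_eq_zero fun a _ => ?_
  simp (disch := omega) only [map_add, map_smul, map_neg, map_sub, map_zero,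
    modes_GPlusSh_modeOp, modes_GMinusSh_modeOp, modes_apply_vacuum_of_nonneg, modeOp_vacuum,
    modeOp_modeOp_vacuum_of_ne]
  norm_num

theorem GPlusSh_two_GMinusSh_add (p : A → ZMod 2) (t : A → ℂ) :
    modes p (GPlusSh p) 2 (GMinusSh p t) + modes p (GMinusSh p t) 2 (GPlusSh p) =
      (2 * (cSh t / 3)) • vacuum p := by
  rw [congrArg (modes p (GPlusSh p) 2) (GMinusSh_eq p t), map_sum,
    congrArg (modes p (GMinusSh p t) 2) (GPlusSh_eq p), map_sum, ← sum_add_distrib, cSh, sum_div,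
    mul_sum, sum_smul]
  refine sum_congr rfl fun a _ => ?_
  simp (disch := omega) only [map_add, map_smul, map_neg, map_sub, map_zero,
    modes_GPlusSh_modeOp, modes_GMinusSh_modeOp, modes_apply_vacuum_of_nonneg, modeOp_vacuum,
    modeOp_modeOp_vacuum, modeOp_modeOp_vacuum_of_ne, pairing_c_b, pairing_gamma_beta, if_true]
  push_cast
  module

theorem GPlusSh_three_GMinusSh_add (p : A → ZMod 2) (t : A → ℂ) (n : ℤ) (hn : 3 ≤ n) :
    modes p (GPlusSh p) n (GMinusSh p t) + modes p (GMinusSh p t) n (GPlusSh p) = 0 := by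
  rw [congrArg (modes p (GPlusSh p) n) (GMinusSh_eq p t), map_sum,
    congrArg (modes p (GMinusSh p t) n) (GPlusSh_eq p), map_sum, ← sum_add_distrib]
  refine sum_eq_zero fun a _ => ?_
  simp (disch := omega) only [map_add, map_smul, map_neg, map_sub, map_zero,
    modes_GPlusSh_modeOp, modes_GMinusSh_modeOp, modes_apply_vacuum_of_nonneg, modeOp_vacuum,
    modeOp_modeOp_vacuum_of_ne]
  module

/-- Both operators kill the vacuum and have the same commutators with all modes $x_n$. -/
theorem LSh_zero (p : A → ZMod 2) (t : A → ℂ) (v : Fch p) :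
    modes p (LSh p t) 0 v = transl p v := by
  have := Fch.induction p (LinearMap.ker (modes p (LSh p t) 0 - transl p))
    (by rw [LinearMap.mem_ker, LinearMap.sub_apply, transl_vacuum,
      modes_apply_vacuum_of_nonneg p _ 0 le_rfl, sub_zero])
    (by
      intro x n v hv
      rw [LinearMap.mem_ker, LinearMap.sub_apply, sub_eq_zero] at hv ⊢
      rw [transl_modeOp]
      obtain ⟨a, rfl | rfl | rfl | rfl⟩ := gen_cases p x <;>
        simp only [modes_LSh_modeOp, hv, add_zero, Int.cast_zero, mul_zero, zero_sub, neg_smul,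
          ← sub_eq_add_neg]) v
  rwa [LinearMap.mem_ker, LinearMap.sub_apply, sub_eq_zero] at this

theorem LSh_one_JSh (p : A → ZMod 2) (t : A → ℂ) :
    modes p (LSh p t) 1 (JSh p t) = JSh p t := by
  rw [congrArg (modes p (LSh p t) 1) (JSh_eq p t), map_sum,
    congrArg (fun J => _ = J) (JSh_eq p t)]
  refine sum_congr rfl fun a _ => ?_
  simp (disch := omega) only [map_add, map_smul, map_sub, map_zero,
    modes_LSh_modeOp, modes_apply_vacuum_of_nonneg]
  norm_num
  module

theorem LSh_two_JSh (p : A → ZMod 2) (t : A → ℂ) (n : ℤ) (hn : 2 ≤ n) :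
    modes p (LSh p t) n (JSh p t) = 0 := by
  rw [congrArg (modes p (LSh p t) n) (JSh_eq p t), map_sum]
  refine sum_eq_zero fun a _ => ?_
  -- At $n = 2$ the contractions of $cb$ and $\gamma\beta$ give $\mp t_a(t_a+1)$, so $J$ is primary
  -- for every shift.
  rcases eq_or_ne n 2 with rfl | hn2
  all_goals
    simp (disch := omega) only [map_add, map_smul, map_sub, map_zero,
      modes_LSh_modeOp, modes_apply_vacuum_of_nonneg, modeOp_vacuum,
      modeOp_modeOp_vacuum, modeOp_modeOp_vacuum_of_ne, pairing_c_b, pairing_gamma_beta, if_true]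
    push_cast
    module

theorem LSh_one_GPlusSh (p : A → ZMod 2) (t : A → ℂ) :
    modes p (LSh p t) 1 (GPlusSh p) = (3 / 2 : ℂ) • GPlusSh p := by
  rw [congrArg (modes p (LSh p t) 1) (GPlusSh_eq p), map_sum,
    congrArg (fun J => _ = (3 / 2 : ℂ) • J) (GPlusSh_eq p), smul_sum]
  refine sum_congr rfl fun a _ => ?_
  simp (disch := omega) only [map_add, map_smul, map_sub, map_zero,
    modes_LSh_modeOp, modes_apply_vacuum_of_nonneg]
  norm_num
  module

theorem LSh_two_GPlusSh (p : A → ZMod 2) (t : A → ℂ) (n : ℤ) (hn : 2 ≤ n) :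
    modes p (LSh p t) n (GPlusSh p) = 0 := by
  rw [congrArg (modes p (LSh p t) n) (GPlusSh_eq p), map_sum]
  refine sum_eq_zero fun a _ => ?_
  rcases eq_or_ne n 2 with rfl | hn2
  all_goals
    simp (disch := omega) only [map_add, map_smul, map_sub, map_zero,
      modes_LSh_modeOp, modes_apply_vacuum_of_nonneg, modeOp_vacuum,
      modeOp_modeOp_vacuum, modeOp_modeOp_vacuum_of_ne, pairing_c_beta]
    module

theorem LSh_one_GMinusSh (p : A → ZMod 2) (t : A → ℂ) :
    modes p (LSh p t) 1 (GMinusSh p t) = (3 / 2 : ℂ) • GMinusSh p t := by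
  rw [congrArg (modes p (LSh p t) 1) (GMinusSh_eq p t), map_sum,
    congrArg (fun J => _ = (3 / 2 : ℂ) • J) (GMinusSh_eq p t), smul_sum]
  refine sum_congr rfl fun a _ => ?_
  simp (disch := omega) only [map_add, map_smul, map_sub, map_zero,
    modes_LSh_modeOp, modes_apply_vacuum_of_nonneg]
  norm_num
  module

theorem LSh_two_GMinusSh (p : A → ZMod 2) (t : A → ℂ) (n : ℤ) (hn : 2 ≤ n) :
    modes p (LSh p t) n (GMinusSh p t) = 0 := by
  rw [congrArg (modes p (LSh p t) n) (GMinusSh_eq p t), map_sum]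
  refine sum_eq_zero fun a _ => ?_
  rcases eq_or_ne n 2 with rfl | hn2
  · simp (disch := omega) only [map_add, map_smul, map_sub, map_zero,
      modes_LSh_modeOp, modes_apply_vacuum_of_nonneg, modeOp_vacuum,
      modeOp_modeOp_vacuum, modeOp_modeOp_vacuum_of_ne, pairing_gamma_b]
    norm_num
    module
  rcases eq_or_ne n 3 with rfl | hn3
  all_goals
    simp (disch := omega) only [map_add, map_smul, map_sub, map_zero,
      modes_LSh_modeOp, modes_apply_vacuum_of_nonneg, modeOp_vacuum,
      modeOp_modeOp_vacuum, modeOp_modeOp_vacuum_of_ne, pairing_gamma_b]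
    module

end Products

/-! ### The superspace, the odd derivations, and the $N_K = 2$ axioms -/

section Structure

open Filter Finset

variable {A : Type*}

theorem grade_isInternal (p : A → ZMod 2) : DirectSum.IsInternal (grade p) := by
  rw [DirectSum.isInternal_submodule_iff_isCompl (grade p) (i := 0) (j := 1) (by decide) (by
    ext q
    simpa using zmodTwo_cases q)]
  have hP : ∀ v, parityOp p (parityOp p v) = v := fun v =>
    LinearMap.congr_fun (parityOp_mul_self p) v
  refine IsCompl.of_eq ?_ ?_
  · refine (Submodule.eq_bot_iff _).2 fun v hv => ?_
    have h0 := (mem_grade p 0 v).1 hv.1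
    have h1 := (mem_grade p 1 v).1 hv.2
    rw [koszul_zero_right, one_smul] at h0
    rw [koszul_one_one, neg_one_smul, h0] at h1
    have h2 : (2 : ℂ) • v = 0 := by
      rw [two_smul]
      nth_rewrite 1 [h1]
      exact neg_add_cancel v
    exact (smul_eq_zero.1 h2).resolve_left two_ne_zero
  · refine (Submodule.eq_top_iff').2 fun v => ?_
    have e : v = (2⁻¹ : ℂ) • (v + parityOp p v) + (2⁻¹ : ℂ) • (v - parityOp p v) := by module
    rw [e]
    refine Submodule.add_mem_sup (Submodule.smul_mem _ _ ?_) (Submodule.smul_mem _ _ ?_)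
    · rw [mem_grade, koszul_zero_right, one_smul, map_add, hP, add_comm]
    · rw [mem_grade, koszul_one_one, map_sub, hP, neg_one_smul, neg_sub]

theorem vacuum_mem_grade (p : A → ZMod 2) : vacuum p ∈ grade p 0 := by
  rw [mem_grade, parityOp_vacuum, koszul_zero_right, one_smul]

theorem modes_mem_grade (p : A → ZMod 2) {q r : ZMod 2} {u v : Fch p} (hu : u ∈ grade p q)
    (hv : v ∈ grade p r) (n : ℤ) : modes p u n v ∈ grade p (q + r) := by
  have h := LinearMap.congr_fun (twist_modes p hu 1 n) (parityOp p v)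
  have hP : parityOp p (parityOp p v) = v := LinearMap.congr_fun (parityOp_mul_self p) v
  have h' : twist p 1 (modes p u n) (parityOp p v) =
      parityOp p (modes p u n (parityOp p (parityOp p v))) := by
    rw [twist_apply]
    rfl
  rw [h', hP, (mem_grade p r v).1 hv] at h
  rw [mem_grade, h, LinearMap.smul_apply, map_smul, smul_smul, koszul_add_right]

variable [Fintype A]

/-! ### The odd derivations -/

/-- The odd operator `α G⁺₍₀₎ + α' G⁻₍₀₎`. -/
def oddOp (p : A → ZMod 2) (t : A → ℂ) (α α' : ℂ) : Module.End ℂ (Fch p) :=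
  α • modes p (GPlusSh p) 0 + α' • modes p (GMinusSh p t) 0

theorem oddOp_apply (p : A → ZMod 2) (t : A → ℂ) (α α' : ℂ) (v : Fch p) :
    oddOp p t α α' v = α • modes p (GPlusSh p) 0 v + α' • modes p (GMinusSh p t) 0 v := rfl

theorem DSh_zero (p : A → ZMod 2) (t : A → ℂ) : DSh p t 0 = oddOp p t 1 1 := by
  change modes p (GPlusSh p + GMinusSh p t) 0 = _
  rw [oddOp, map_add, Pi.add_apply, one_smul, one_smul]

theorem DSh_one (p : A → ZMod 2) (t : A → ℂ) :
    DSh p t 1 = oddOp p t Complex.I (-Complex.I) := by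
  change Complex.I • modes p (GPlusSh p - GMinusSh p t) 0 = _
  rw [oddOp, map_sub, Pi.sub_apply]
  module

theorem oddOp_modeOp (p : A → ZMod 2) (t : A → ℂ) (α α' : ℂ) (a : A) (m : ℤ) (v : Fch p) :
    oddOp p t α α' (modeOp p (gammaGen p a) m v) =
      modeOp p (gammaGen p a) m (oddOp p t α α' v) + α • modeOp p (cGen p a) m v ∧
    oddOp p t α α' (modeOp p (cGen p a) m v) =
      -modeOp p (cGen p a) m (oddOp p t α α' v)
        + (α' * -(m : ℂ)) • modeOp p (gammaGen p a) (m - 1) v ∧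
    oddOp p t α α' (modeOp p (bGen p a) m v) =
      -modeOp p (bGen p a) m (oddOp p t α α' v) + α • modeOp p (betaGen p a) m v ∧
    oddOp p t α α' (modeOp p (betaGen p a) m v) =
      modeOp p (betaGen p a) m (oddOp p t α α' v)
        + (α' * -(m : ℂ)) • modeOp p (bGen p a) (m - 1) v := by
  simp only [oddOp_apply, modes_GPlusSh_modeOp, modes_GMinusSh_modeOp, map_add, map_smul,
    Int.cast_zero, mul_zero, add_zero]
  refine ⟨?_, ?_, ?_, ?_⟩ <;> module

theorem oddOp_vacuum (p : A → ZMod 2) (t : A → ℂ) (α α' : ℂ) :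
    oddOp p t α α' (vacuum p) = 0 := by
  rw [oddOp_apply, modes_apply_vacuum_of_nonneg p _ 0 le_rfl,
    modes_apply_vacuum_of_nonneg p _ 0 le_rfl, smul_zero, smul_zero, add_zero]

theorem twist_oddOp (p : A → ZMod 2) (t : A → ℂ) (α α' : ℂ) (r : ZMod 2) :
    twist p r (oddOp p t α α') = koszul r 1 • oddOp p t α α' := by
  rw [oddOp, map_add, map_smul, map_smul, twist_modes p (GPlusSh_mem_grade p),
    twist_modes p (GMinusSh_mem_grade p t)]
  module

theorem oddOp_mem_grade (p : A → ZMod 2) (t : A → ℂ) (α α' : ℂ) {q : ZMod 2} {v : Fch p}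
    (hv : v ∈ grade p q) : oddOp p t α α' v ∈ grade p (q + 1) := by
  rw [add_comm]
  exact Submodule.add_mem _ (Submodule.smul_mem _ _ (modes_mem_grade p (GPlusSh_mem_grade p) hv 0))
    (Submodule.smul_mem _ _ (modes_mem_grade p (GMinusSh_mem_grade p t) hv 0))

/-- `modes_derivation` applies because the operator sends $\gamma \mapsto \alpha c$ and $b \mapsto
\alpha\beta$, which are free fields, and $c \mapsto \alpha'\partial\gamma$ and $\beta \mapsto
\alpha'\partial b$, which are derivatives of free fields. -/
theorem oddOp_commutator (p : A → ZMod 2) (t : A → ℂ) (α α' : ℂ) {q : ZMod 2} {v : Fch p}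
    (hv : v ∈ grade p q) (n : ℤ) :
    oddOp p t α α' * modes p v n - koszul 1 q • (modes p v n * oddOp p t α α') =
      modes p (oddOp p t α α' v) n := by
  rw [← smul_mul_assoc, ← twist_modes p hv]
  refine modes_derivation p _ (oddOp_vacuum p t α α') (twist_oddOp p t α α') ?_ v n
  intro x
  obtain ⟨a, rfl | rfl | rfl | rfl⟩ := gen_cases p x
  · refine ⟨cGen p a, α, by rw [parity_cGen, parity_gammaGen, add_zero], Or.inl fun n => ?_⟩
    refine LinearMap.ext fun v => ?_
    rw [parity_gammaGen, koszul_zero_left, one_smul]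
    exact (oddOp_modeOp p t α α' a n v).1
  · refine ⟨gammaGen p a, α', by rw [parity_cGen, parity_gammaGen]; rfl, Or.inr fun n => ?_⟩
    refine LinearMap.ext fun v => ?_
    rw [parity_cGen, koszul_one_one, neg_one_smul]
    exact (oddOp_modeOp p t α α' a n v).2.1
  · refine ⟨betaGen p a, α, by rw [parity_bGen, parity_betaGen]; rfl, Or.inl fun n => ?_⟩
    refine LinearMap.ext fun v => ?_
    rw [parity_bGen, koszul_one_one, neg_one_smul]
    exact (oddOp_modeOp p t α α' a n v).2.2.1
  · refine ⟨bGen p a, α', by rw [parity_bGen, parity_betaGen, add_zero], Or.inr fun n => ?_⟩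
    refine LinearMap.ext fun v => ?_
    rw [parity_betaGen, koszul_zero_left, one_smul]
    exact (oddOp_modeOp p t α α' a n v).2.2.2

/-- Both sides kill the vacuum and have the same commutators with the modes, so no product of $G^+$
with $G^-$ is needed. The form is bilinear with $G^\pm$ isotropic: $(1,1)$ and $(i,-i)$ are
orthogonal and each gives $2\partial$. -/
theorem oddOp_anticommutator (p : A → ZMod 2) (t : A → ℂ) (α α' δ δ' : ℂ) :
    oddOp p t α α' * oddOp p t δ δ' + oddOp p t δ δ' * oddOp p t α α' =
      (α * δ' + α' * δ) • transl p := by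
  refine LinearMap.ext fun v => ?_
  have := Fch.induction p (LinearMap.ker (oddOp p t α α' * oddOp p t δ δ'
      + oddOp p t δ δ' * oddOp p t α α' - (α * δ' + α' * δ) • transl p))
    (by
      simp only [LinearMap.mem_ker, LinearMap.sub_apply, LinearMap.add_apply,
        LinearMap.smul_apply, Module.End.mul_apply, oddOp_vacuum, map_zero, transl_vacuum,
        smul_zero, add_zero, sub_zero])
    (by
      intro x n v hv
      simp only [LinearMap.mem_ker, LinearMap.sub_apply, LinearMap.add_apply,
        LinearMap.smul_apply, Module.End.mul_apply, sub_eq_zero] at hv ⊢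
      have hv' : oddOp p t α α' (oddOp p t δ δ' v) = (α * δ' + α' * δ) • transl p v
          - oddOp p t δ δ' (oddOp p t α α' v) := eq_sub_of_add_eq hv
      rw [transl_modeOp]
      obtain ⟨a, rfl | rfl | rfl | rfl⟩ := gen_cases p x <;>
        simp only [oddOp_modeOp, map_add, map_neg, map_smul, hv', map_sub] <;> module) v
  simpa only [LinearMap.mem_ker, LinearMap.sub_apply, sub_eq_zero] using this

theorem DSh_anticommutator (p : A → ZMod 2) (t : A → ℂ) (i j : Fin 2) :
    DSh p t i * DSh p t j + DSh p t j * DSh p t i =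
      if i = j then (2 : ℂ) • transl p else 0 := by
  have hI := Complex.I_mul_I
  fin_cases i <;> fin_cases j <;>
    simp only [Fin.zero_eta, Fin.mk_one, DSh_zero, DSh_one, oddOp_anticommutator]
  · rw [if_pos trivial]
    norm_num
  · rw [if_neg (by decide)]
    simp
  · rw [if_neg (by decide)]
    simp
  · rw [if_pos trivial]
    congr 1
    linear_combination (-2 : ℂ) * hI

theorem DSh_sq (p : A → ZMod 2) (t : A → ℂ) (i : Fin 2) (v : Fch p) :
    DSh p t i (DSh p t i v) = transl p v := by
  have h := LinearMap.congr_fun (DSh_anticommutator p t i i) v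
  rw [if_pos rfl, ← two_smul ℂ, LinearMap.smul_apply, LinearMap.smul_apply] at h
  exact smul_right_injective _ (two_ne_zero (α := ℂ)) h

theorem DSh_swap (p : A → ZMod 2) (t : A → ℂ) (v : Fch p) :
    DSh p t 1 (DSh p t 0 v) = -DSh p t 0 (DSh p t 1 v) := by
  have h := LinearMap.congr_fun (DSh_anticommutator p t 1 0) v
  rw [if_neg (by decide)] at h
  exact eq_neg_of_add_eq_zero_left h

theorem DSh_mem_grade (p : A → ZMod 2) (t : A → ℂ) (i : Fin 2) {q : ZMod 2} {v : Fch p}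
    (hv : v ∈ grade p q) : DSh p t i v ∈ grade p (q + 1) := by
  fin_cases i
  · simp only [Fin.zero_eta, DSh_zero]
    exact oddOp_mem_grade p t _ _ hv
  · simp only [Fin.mk_one, DSh_one]
    exact oddOp_mem_grade p t _ _ hv

theorem DSh_vacuum (p : A → ZMod 2) (t : A → ℂ) (i : Fin 2) : DSh p t i (vacuum p) = 0 := by
  fin_cases i
  · simp only [Fin.zero_eta, DSh_zero, oddOp_vacuum]
  · simp only [Fin.mk_one, DSh_one, oddOp_vacuum]

theorem DSh_commutator (p : A → ZMod 2) (t : A → ℂ) (i : Fin 2) {q : ZMod 2} {v : Fch p}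
    (hv : v ∈ grade p q) (n : ℤ) :
    DSh p t i * modes p v n - koszul 1 q • (modes p v n * DSh p t i) =
      modes p (DSh p t i v) n := by
  fin_cases i
  · simp only [Fin.zero_eta, DSh_zero]
    exact oddOp_commutator p t _ _ hv n
  · simp only [Fin.mk_one, DSh_one]
    exact oddOp_commutator p t _ _ hv n

theorem DSh_zero_vec (p : A → ZMod 2) (t : A → ℂ) (a : A) :
    DSh p t 0 (vec p (.phi a)) = vec p (.dphi a) ∧
    DSh p t 0 (vec p (.dphi a)) = transl p (vec p (.phi a)) ∧
    DSh p t 0 (vec p (.phiBar a)) = vec p (.dphiBar a) ∧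
    DSh p t 0 (vec p (.dphiBar a)) = transl p (vec p (.phiBar a)) := by
  have h := oddOp_modeOp p t 1 1 a (-1) (vacuum p)
  simp only [vec, transl_vec, DSh_zero]
  simp only [oddOp_vacuum, map_zero, neg_zero, zero_add, one_smul, one_mul] at h
  rcases zmodTwo_cases (p a) with hp | hp <;>
    simp only [gammaGen, cGen, bGen, betaGen, hp, if_true, one_ne_zero, if_false] at h <;>
    norm_num at h
  · exact h
  · exact ⟨h.2.2.1, h.2.2.2, h.1, h.2.1⟩

/-! ### The SUSY vertex algebra -/

theorem finset_fin_two_cases (S : Finset (Fin 2)) : S = ∅ ∨ S = {0} ∨ S = {1} ∨ S = {0, 1} := by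
  revert S
  decide

/-- The vector whose field is the `θ^S`-component of the `N_K = 2` superfield of `v`. -/
def component (p : A → ZMod 2) (t : A → ℂ) (S : Finset (Fin 2)) (v : Fch p) : Fch p :=
  if 0 ∈ S then (if 1 ∈ S then -DSh p t 0 (DSh p t 1 v) else DSh p t 0 v)
  else (if 1 ∈ S then DSh p t 1 v else v)

theorem YTwo_apply (p : A → ZMod 2) (t : A → ℂ) (v : Fch p) (S : Finset (Fin 2)) :
    YTwo p t v S = stateField p (component p t S v) := by
  unfold YTwo superfieldTwo component
  rw [LinearMap.pi_apply]
  split_ifs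
  · rw [map_neg]
    rfl
  all_goals rfl

theorem YTwo_ncoeff (p : A → ZMod 2) (t : A → ℂ) (v : Fch p) (S : Finset (Fin 2)) (n : ℤ) :
    (YTwo p t v S)[[n]] = modes p (component p t S v) n := by
  rw [YTwo_apply, modes_apply]

theorem component_mem_grade (p : A → ZMod 2) (t : A → ℂ) (S : Finset (Fin 2)) {q : ZMod 2}
    {v : Fch p} (hv : v ∈ grade p q) : component p t S v ∈ grade p (q + S.card) := by
  rcases finset_fin_two_cases S with rfl | rfl | rfl | rfl
  · simpa [component] using hv
  · simpa [component] using DSh_mem_grade p t 0 hv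
  · simpa [component] using DSh_mem_grade p t 1 hv
  · have := Submodule.neg_mem _ (DSh_mem_grade p t 0 (DSh_mem_grade p t 1 hv))
    rw [add_assoc] at this
    simpa [component, one_add_one_eq_two] using this

/-- Covariance reduces to the derivation property of $D^i$ once $D^i$ is known to permute the
components up to sign. The cases use $(D^i)^2 = \partial$, the anticommutation of $D^1$ and $D^2$,
and the minus sign in the coefficient $-D^1D^2v$ of $\theta^1\theta^2$. -/
theorem component_covariance (p : A → ZMod 2) (t : A → ℂ) (v : Fch p) (i : Fin 2)
    (S : Finset (Fin 2)) (n : ℤ) :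
    (-1 : ℂ) ^ S.card • modes p (DSh p t i (component p t S v)) n =
      if i ∈ S then -(thetaSign i (S.erase i) • ((-n : ℤ) •
        modes p (component p t (S.erase i) v) (n - 1)))
      else thetaSign i S • modes p (component p t (insert i S) v) n := by
  have e0 : ({0, 1} : Finset (Fin 2)).erase 0 = {1} := by decide
  have e1 : ({0, 1} : Finset (Fin 2)).erase 1 = {0} := by decide
  have e2 : insert 1 ({0} : Finset (Fin 2)) = {0, 1} := by decide
  have c2 : ({0, 1} : Finset (Fin 2)).card = 2 := by decide
  have s0 : ∀ i : Fin 2, thetaSign i ∅ = 1 := by simp [thetaSign]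
  have s1 : thetaSign (0 : Fin 2) {1} = 1 := by simp [thetaSign, filter_singleton]
  have s2 : thetaSign (1 : Fin 2) {0} = -1 := by simp [thetaSign, filter_singleton]
  rcases finset_fin_two_cases S with rfl | rfl | rfl | rfl <;> fin_cases i
  · simp [component, s0]
  · simp [component, s0]
  · simp [component, s0, DSh_sq, modes_transl, ← Int.cast_smul_eq_zsmul ℂ]
  · simp [component, s2, e2, DSh_swap]
  · simp [component, s1]
  · simp [component, s0, DSh_sq, modes_transl, ← Int.cast_smul_eq_zsmul ℂ]
  · simp [component, s1, c2, e0, DSh_sq, modes_transl, ← Int.cast_smul_eq_zsmul ℂ]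
  · have h : DSh p t 1 (DSh p t 0 (DSh p t 1 v)) = -transl p (DSh p t 0 v) := by
      rw [DSh_swap, DSh_sq, ← DSh_sq p t 0 (DSh p t 0 v), DSh_sq p t 0 v]
    simp [component, s2, c2, e1, h, modes_transl, ← Int.cast_smul_eq_zsmul ℂ]

theorem isSusyVertexAlgebra (p : A → ZMod 2) (t : A → ℂ) :
    IsSusyVertexAlgebra (grade p) (vacuum p) (DSh p t) (YTwo p t) where
  isInternal := grade_isInternal p
  vac_even := vacuum_mem_grade p
  D_odd i q v hv := DSh_mem_grade p t i hv
  Y_parity q r a ha v hv S n := by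
    rw [YTwo_ncoeff]
    exact modes_mem_grade p (component_mem_grade p t S ha) hv n
  D_vac := DSh_vacuum p t
  regular a S n hn := by
    rw [YTwo_ncoeff]
    exact modes_apply_vacuum_of_nonneg p _ n hn
  creation a := by
    rw [YTwo_ncoeff]
    exact modes_neg_one_vacuum p _
  covariance q a ha i S n := by
    simp only [superCommMode, superDerivMode, YTwo_ncoeff]
    rw [DSh_commutator p t i (component_mem_grade p t S ha), component_covariance]
  locality q r a ha b hb := by
    have h := fun S T => modes_local p (component p t T b) _ _ (component_mem_grade p t S ha)
    choose N hN using h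
    -- Each pair of components has its own locality order; the sum over the finitely many pairs
    -- bounds them all.
    refine ⟨∑ S, ∑ T, N S T, fun S T m n => ?_⟩
    have hle : N S T ≤ ∑ S, ∑ T, N S T :=
      (single_le_sum (f := N S) (fun _ _ => Nat.zero_le _) (mem_univ T)).trans
        (single_le_sum (f := fun S => ∑ T, N S T) (fun _ _ => Nat.zero_le _) (mem_univ S))
    have h0 := congrFun (congrFun (difference_pow_eq_zero_of_le hle (hN S T)) m) n
    rw [difference_pow_apply] at h0
    refine Eq.trans (sum_congr rfl fun k _ => ?_) h0
    rw [YTwo_ncoeff, YTwo_ncoeff, superComm, twist_modes p (component_mem_grade p t T hb),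
      smul_mul_assoc]

end Structure

/-! ### Clifford relations, $\Lambda$-brackets, and generated subalgebras -/

section Brackets

open Filter Finset

/-! ### The algebras `ℒ_N` -/

theorem chi_mul_self {N : ℕ} (i : Fin N) : chi i * chi i = -lam N := by
  have h : QuadraticMap.weightedSumSquares (Polynomial ℂ)
      (fun _ : Fin N => (-Polynomial.X : Polynomial ℂ)) (Pi.single i 1) = -Polynomial.X := by
    rw [QuadraticMap.weightedSumSquares_apply, sum_eq_single i]
    · simp
    · intro j _ hj
      simp [hj]
    · simp
  rw [chi, CliffordAlgebra.ι_sq_scalar, h, map_neg, lam]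

theorem chi_mul_chi_swap {N : ℕ} {i j : Fin N} (hij : i ≠ j) :
    chi i * chi j = -(chi j * chi i) := by
  have h : QuadraticMap.polar (QuadraticMap.weightedSumSquares (Polynomial ℂ)
      (fun _ : Fin N => (-Polynomial.X : Polynomial ℂ))) (Pi.single i 1) (Pi.single j 1) = 0 := by
    simp only [QuadraticMap.polar, QuadraticMap.weightedSumSquares_apply, ← sum_sub_distrib]
    refine sum_eq_zero fun k _ => ?_
    by_cases hi : k = i
    · subst hi
      simp [Pi.single_eq_of_ne hij]
    · simp [Pi.single_eq_of_ne hi]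
  refine eq_neg_of_add_eq_zero_left ?_
  rw [chi, chi, CliffordAlgebra.ι_mul_ι_add_swap, h, map_zero]

theorem lam_mul_comm {N : ℕ} (x : LambdaAlg N) : lam N * x = x * lam N :=
  Algebra.commutes _ _

section LambdaSum

variable {V : Type*} [AddCommGroup V] [Module ℂ V]

theorem lambdaSum_eq_sum (N : ℕ) (a : VertexOperator ℂ V) (v : V) (M : ℕ)
    (h : ∀ j : ℕ, M ≤ j → (a[[(j : ℤ)]]) v = 0) :
    lambdaSum N a v = ∑ j ∈ range M,
      ((j.factorial : ℂ)⁻¹) • ((lam N ^ j) ⊗ₜ[ℂ] (a[[(j : ℤ)]]) v) := by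
  refine finsum_eq_sum_of_support_subset _ fun j hj => ?_
  rw [coe_range]
  by_contra hj'
  have h0 := h j (by simpa using hj')
  exact hj (by simp only [h0, TensorProduct.tmul_zero, smul_zero])

theorem lambdaSum_smul (N : ℕ) (c : ℂ) (a : VertexOperator ℂ V) (v : V) :
    lambdaSum N (c • a) v = c • lambdaSum N a v := by
  obtain ⟨M, hM⟩ := trunc_ncoeff a v
  rw [lambdaSum_eq_sum N a v M.toNat fun j hj => hM j (by omega),
    lambdaSum_eq_sum N (c • a) v M.toNat, smul_sum]
  · refine sum_congr rfl fun j _ => ?_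
    rw [map_smul, Pi.smul_apply, LinearMap.smul_apply, TensorProduct.tmul_smul, smul_comm]
  · intro j hj
    have h : (a[[(j : ℤ)]]) v = 0 := hM j (by omega)
    rw [map_smul, Pi.smul_apply, LinearMap.smul_apply, h, smul_zero]

theorem lambdaSum_neg (N : ℕ) (a : VertexOperator ℂ V) (v : V) :
    lambdaSum N (-a) v = -lambdaSum N a v := by
  have h := lambdaSum_smul N (-1) a v
  rw [neg_one_smul ℂ a] at h
  rw [h]
  module

theorem lambdaSum_smul_right (N : ℕ) (a : VertexOperator ℂ V) (c : ℂ) (v : V) :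
    lambdaSum N a (c • v) = c • lambdaSum N a v := by
  obtain ⟨M, hM⟩ := trunc_ncoeff a v
  rw [lambdaSum_eq_sum N a v M.toNat fun j hj => hM j (by omega),
    lambdaSum_eq_sum N a (c • v) M.toNat, smul_sum]
  · refine sum_congr rfl fun j _ => ?_
    rw [map_smul, TensorProduct.tmul_smul, smul_comm]
  · intro j hj
    have h : (a[[(j : ℤ)]]) v = 0 := hM j (by omega)
    rw [map_smul, h, smul_zero]

end LambdaSum

variable {A : Type*}

/-- Sesquilinearity $[\partial u_\lambda v] = -\lambda[u_\lambda v]$: since $(\partial u)_{(j+1)} =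
-(j+1)u_{(j)}$, the factor $j+1$ turns $1/(j+1)!$ into $1/j!$ and one power of $\lambda$ comes out.
-/
theorem lambdaSum_transl (p : A → ZMod 2) (N : ℕ) (u v : Fch p) :
    lambdaSum N (stateField p (transl p u)) v = -(lam N • lambdaSum N (stateField p u) v) := by
  obtain ⟨M, hM⟩ := modes_trunc p u v
  have h : ∀ j : ℕ, M.toNat ≤ j → modes p u j v = 0 := fun j hj => hM j (by omega)
  rw [lambdaSum_eq_sum N (stateField p u) v M.toNat h,
    lambdaSum_eq_sum N (stateField p (transl p u)) v (M.toNat + 1), sum_range_succ', smul_sum,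
    ← sum_neg_distrib]
  · simp only [← modes_apply, modes_transl]
    rw [Nat.cast_zero, Int.cast_zero, neg_zero, zero_smul, LinearMap.zero_apply,
      TensorProduct.tmul_zero, smul_zero, add_zero]
    refine sum_congr rfl fun j _ => ?_
    rw [smul_comm (lam N), TensorProduct.smul_tmul' (lam N), smul_eq_mul, ← pow_succ',
      LinearMap.smul_apply, TensorProduct.tmul_smul, smul_smul, show ((j + 1 : ℕ) : ℤ) - 1 = j by
        push_cast; ring]
    match_scalars
    rw [Nat.factorial_succ]
    have h1 : (j.factorial : ℂ) ≠ 0 := by exact_mod_cast j.factorial_ne_zero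
    have h2 : (j : ℂ) + 1 ≠ 0 := by exact_mod_cast j.succ_ne_zero
    push_cast
    field_simp
  · intro j hj
    rw [← modes_apply, modes_transl, show (j : ℤ) - 1 = ((j - 1 : ℕ) : ℤ) by omega,
      LinearMap.smul_apply, h _ (by omega), smul_zero]

variable [Fintype A]

/-! ### The brackets -/

theorem bracketTwo_YTwo (p : A → ZMod 2) (t : A → ℂ) (u v : Fch p) :
    bracketTwo (YTwo p t) u v =
      -lambdaSum 2 (stateField p (DSh p t 0 (DSh p t 1 u))) v
      - chi (0 : Fin 2) • lambdaSum 2 (stateField p (DSh p t 1 u)) v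
      + chi (1 : Fin 2) • lambdaSum 2 (stateField p (DSh p t 0 u)) v
      - (chi (0 : Fin 2) * chi (1 : Fin 2)) • lambdaSum 2 (stateField p u) v := by
  simp [bracketTwo, YTwo_apply, component, lambdaSum_neg]

/-- The vectors $u, D^1u, D^2u, D^1D^2u$ are permuted by $D^i$ up to sign and $\partial$, and the
coefficients $1, \chi^i, \chi^1\chi^2$ are permuted by $\chi^i$ up to sign and $\lambda$.
Sesquilinearity in $\partial$ makes the two patterns match. -/
theorem bracketTwo_DSh (p : A → ZMod 2) (t : A → ℂ) (i : Fin 2) (u v : Fch p) :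
    bracketTwo (YTwo p t) (DSh p t i u) v = -(chi i • bracketTwo (YTwo p t) u v) := by
  have hs := chi_mul_chi_swap (show (1 : Fin 2) ≠ 0 by decide)
  have h0 := chi_mul_self (0 : Fin 2)
  have h1 := chi_mul_self (1 : Fin 2)
  rw [bracketTwo_YTwo, bracketTwo_YTwo]
  fin_cases i
  · have h2 : chi (0 : Fin 2) * (chi 0 * chi 1) = -(lam 2 * chi 1) := by
      rw [← mul_assoc, h0, neg_mul]
    simp only [Fin.zero_eta, DSh_sq, DSh_swap, map_neg, lambdaSum_neg, lambdaSum_transl,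
      smul_neg, smul_sub, smul_add, smul_smul, h0, h2, lam_mul_comm, neg_smul]
    abel
  · have e : DSh p t 0 (transl p u) = transl p (DSh p t 0 u) := by
      rw [← DSh_sq p t 0 (DSh p t 0 u), DSh_sq p t 0 u]
    have h2 : chi (1 : Fin 2) * (chi 0 * chi 1) = lam 2 * chi 0 := by
      rw [← mul_assoc, hs, neg_mul, mul_assoc, h1, mul_neg, neg_neg, lam_mul_comm]
    simp only [Fin.mk_one, e, DSh_sq, lambdaSum_transl,
      smul_neg, smul_sub, smul_add, smul_smul, h1, h2, hs, lam_mul_comm, neg_smul]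
    abel

theorem modes_TSh (p : A → ZMod 2) (t : A → ℂ) (n : ℤ) (v : Fch p) :
    modes p (TSh p t) n v = modes p (GPlusSh p) n v + modes p (GMinusSh p t) n v := by
  rw [TSh_eq, map_add, Pi.add_apply, LinearMap.add_apply]

theorem DSh_zero_apply (p : A → ZMod 2) (t : A → ℂ) (v : Fch p) :
    DSh p t 0 v = modes p (TSh p t) 0 v := by
  rw [DSh_zero, oddOp_apply, modes_TSh, one_smul, one_smul]

theorem DSh_zero_JSh (p : A → ZMod 2) (t : A → ℂ) :
    DSh p t 0 (JSh p t) = GMinusSh p t - GPlusSh p := by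
  rw [DSh_zero, oddOp_apply, GPlusSh_zero_JSh, GMinusSh_zero_JSh]
  module

theorem DSh_one_JSh (p : A → ZMod 2) (t : A → ℂ) :
    DSh p t 1 (JSh p t) = -Complex.I • TSh p t := by
  rw [DSh_one, oddOp_apply, GPlusSh_zero_JSh, GMinusSh_zero_JSh, TSh_eq]
  module

theorem DSh_zero_TSh (p : A → ZMod 2) (t : A → ℂ) :
    DSh p t 0 (TSh p t) = (2 : ℂ) • LSh p t := by
  rw [← GPlusSh_GMinusSh_add, DSh_zero, oddOp_apply, TSh_eq, map_add, map_add,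
    GPlusSh_GPlusSh p 0 le_rfl, GMinusSh_GMinusSh p t 0 le_rfl]
  module

theorem DSh_zero_PSh (p : A → ZMod 2) (t : A → ℂ) :
    DSh p t 0 (PSh p t) = -Complex.I • (GMinusSh p t - GPlusSh p) := by
  rw [PSh, map_smul, DSh_zero_JSh]

theorem DSh_one_PSh (p : A → ZMod 2) (t : A → ℂ) : DSh p t 1 (PSh p t) = -TSh p t := by
  rw [PSh, map_smul, DSh_one_JSh, smul_smul, neg_mul_neg, Complex.I_mul_I, neg_one_smul]

theorem lambdaSum_LSh_JSh (p : A → ZMod 2) (t : A → ℂ) (N : ℕ) :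
    lambdaSum N (stateField p ((2 : ℂ) • LSh p t)) (JSh p t) =
      (2 : ℂ) • ((1 : LambdaAlg N) ⊗ₜ[ℂ] transl p (JSh p t))
        + (2 : ℂ) • (lam N ⊗ₜ[ℂ] JSh p t) := by
  rw [map_smul, lambdaSum_smul, lambdaSum_eq_sum N _ _ 2, sum_range_succ, sum_range_one,
    Nat.cast_zero, Nat.cast_one, ← modes_apply, ← modes_apply, LSh_zero, LSh_one_JSh, smul_add]
  · simp
  · exact fun j hj => LSh_two_JSh p t j (by exact_mod_cast hj)

theorem lambdaSum_TSh_JSh (p : A → ZMod 2) (t : A → ℂ) (N : ℕ) :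
    lambdaSum N (stateField p (TSh p t)) (JSh p t) =
      (1 : LambdaAlg N) ⊗ₜ[ℂ] DSh p t 0 (JSh p t) := by
  rw [lambdaSum_eq_sum N _ _ 1, sum_range_one, Nat.cast_zero, ← modes_apply, ← DSh_zero_apply]
  · simp
  · intro j hj
    have hj : (1 : ℤ) ≤ j := by exact_mod_cast hj
    rw [← modes_apply, modes_TSh, GPlusSh_one_JSh p t j hj, GMinusSh_one_JSh p t j hj, add_zero]

theorem lambdaSum_GMinusSh_sub_JSh (p : A → ZMod 2) (t : A → ℂ) (N : ℕ) :
    lambdaSum N (stateField p (GMinusSh p t - GPlusSh p)) (JSh p t) =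
      (1 : LambdaAlg N) ⊗ₜ[ℂ] TSh p t := by
  rw [lambdaSum_eq_sum N _ _ 1, sum_range_one, Nat.cast_zero, ← modes_apply, map_sub, Pi.sub_apply,
    LinearMap.sub_apply, GPlusSh_zero_JSh, GMinusSh_zero_JSh, sub_neg_eq_add, add_comm, ← TSh_eq]
  · simp
  · intro j hj
    have hj : (1 : ℤ) ≤ j := by exact_mod_cast hj
    rw [← modes_apply, map_sub, Pi.sub_apply, LinearMap.sub_apply, GPlusSh_one_JSh p t j hj,
      GMinusSh_one_JSh p t j hj, sub_zero]

theorem lambdaSum_JSh_JSh (p : A → ZMod 2) (t : A → ℂ) (N : ℕ) :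
    lambdaSum N (stateField p (JSh p t)) (JSh p t) =
      (cSh t / 3) • (lam N ⊗ₜ[ℂ] vacuum p) := by
  rw [lambdaSum_eq_sum N _ _ 2, sum_range_succ, sum_range_one, Nat.cast_zero, Nat.cast_one,
    ← modes_apply, ← modes_apply, JSh_zero_JSh, JSh_one_JSh]
  · simp
  · exact fun j hj => JSh_two_JSh p t j (by exact_mod_cast hj)

theorem bracketTwo_PSh (p : A → ZMod 2) (t : A → ℂ) :
    bracketTwo (YTwo p t) (PSh p t) (PSh p t) =
      (2 : ℂ) • ((1 : LambdaAlg 2) ⊗ₜ[ℂ] transl p (PSh p t))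
        + (2 : ℂ) • (lam 2 ⊗ₜ[ℂ] PSh p t)
        + chi (0 : Fin 2) ⊗ₜ[ℂ] DSh p t 0 (PSh p t)
        + chi (1 : Fin 2) ⊗ₜ[ℂ] DSh p t 1 (PSh p t)
        + (cSh t / 3) • ((lam 2 * chi (0 : Fin 2) * chi (1 : Fin 2)) ⊗ₜ[ℂ] vacuum p) := by
  have hI : Complex.I * Complex.I = -1 := Complex.I_mul_I
  -- Here $D^1D^2P = -D^1T = -2L$, so this is the conformal action on $P$, of weight $1$.
  have e1 : lambdaSum 2 (stateField p (DSh p t 0 (DSh p t 1 (PSh p t)))) (PSh p t) =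
      -((2 : ℂ) • ((1 : LambdaAlg 2) ⊗ₜ[ℂ] transl p (PSh p t))
        + (2 : ℂ) • (lam 2 ⊗ₜ[ℂ] PSh p t)) := by
    rw [DSh_one_PSh, map_neg, map_neg, DSh_zero_TSh, lambdaSum_neg, PSh, lambdaSum_smul_right,
      lambdaSum_LSh_JSh, map_smul, TensorProduct.tmul_smul, TensorProduct.tmul_smul, smul_add,
      smul_comm (2 : ℂ) (-Complex.I), smul_comm (2 : ℂ) (-Complex.I)]
  have e2 : lambdaSum 2 (stateField p (DSh p t 1 (PSh p t))) (PSh p t) =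
      -((1 : LambdaAlg 2) ⊗ₜ[ℂ] DSh p t 0 (PSh p t)) := by
    rw [DSh_one_PSh, map_neg, lambdaSum_neg, PSh, lambdaSum_smul_right, lambdaSum_TSh_JSh,
      map_smul, TensorProduct.tmul_smul]
  have e3 : lambdaSum 2 (stateField p (DSh p t 0 (PSh p t))) (PSh p t) =
      (1 : LambdaAlg 2) ⊗ₜ[ℂ] DSh p t 1 (PSh p t) := by
    rw [DSh_one_PSh, DSh_zero_PSh, map_smul, lambdaSum_smul, PSh, lambdaSum_smul_right,
      lambdaSum_GMinusSh_sub_JSh, smul_smul, neg_mul_neg, hI, neg_one_smul, TensorProduct.tmul_neg]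
  -- The factor $(-i)^2 = -1$ offsets the minus sign in front of $\chi^1\chi^2$ in the bracket.
  have e4 : lambdaSum 2 (stateField p (PSh p t)) (PSh p t) =
      -((cSh t / 3) • (lam 2 ⊗ₜ[ℂ] vacuum p)) := by
    rw [PSh, map_smul, lambdaSum_smul, lambdaSum_smul_right, lambdaSum_JSh_JSh, smul_smul,
      neg_mul_neg, hI, neg_one_smul]
  rw [bracketTwo_YTwo, e1, e2, e3, e4, smul_neg, smul_neg,
    smul_comm (chi (0 : Fin 2) * chi (1 : Fin 2)), TensorProduct.smul_tmul' (chi (0 : Fin 2)),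
    TensorProduct.smul_tmul' (chi (1 : Fin 2)),
    TensorProduct.smul_tmul' (chi (0 : Fin 2) * chi (1 : Fin 2)), smul_eq_mul, smul_eq_mul,
    smul_eq_mul, mul_one, mul_one, ← lam_mul_comm, ← mul_assoc]
  abel

theorem bracketOne_YOne (p : A → ZMod 2) (t : A → ℂ) (u v : Fch p) :
    bracketOne (YOne p t) u v = lambdaSum 1 (stateField p (DSh p t 0 u)) v
      + chi (0 : Fin 1) • lambdaSum 1 (stateField p u) v := by
  simp [bracketOne, YOne, superfieldOne]

theorem lambdaSum_LSh_TSh (p : A → ZMod 2) (t : A → ℂ) (N : ℕ) :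
    lambdaSum N (stateField p ((2 : ℂ) • LSh p t)) (TSh p t) =
      (2 : ℂ) • ((1 : LambdaAlg N) ⊗ₜ[ℂ] transl p (TSh p t))
        + (3 : ℂ) • (lam N ⊗ₜ[ℂ] TSh p t) := by
  have h1 : modes p (LSh p t) 1 (TSh p t) = (3 / 2 : ℂ) • TSh p t := by
    rw [TSh_eq, map_add, LSh_one_GPlusSh, LSh_one_GMinusSh, smul_add]
  rw [map_smul, lambdaSum_smul, lambdaSum_eq_sum N _ _ 2, sum_range_succ, sum_range_one,
    Nat.cast_zero, Nat.cast_one, ← modes_apply, ← modes_apply, LSh_zero, h1, smul_add,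
    TensorProduct.tmul_smul]
  · simp [smul_smul]
    norm_num
  · intro j hj
    have hj : (2 : ℤ) ≤ j := by exact_mod_cast hj
    rw [← modes_apply, TSh_eq, map_add, LSh_two_GPlusSh p t j hj, LSh_two_GMinusSh p t j hj,
      add_zero]

theorem lambdaSum_TSh_TSh (p : A → ZMod 2) (t : A → ℂ) (N : ℕ) :
    lambdaSum N (stateField p (TSh p t)) (TSh p t) =
      (1 : LambdaAlg N) ⊗ₜ[ℂ] DSh p t 0 (TSh p t)
        + (cSh t / 3) • ((lam N ^ 2) ⊗ₜ[ℂ] vacuum p) := by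
  have e : ∀ n : ℤ, 0 ≤ n → modes p (TSh p t) n (TSh p t) =
      modes p (GPlusSh p) n (GMinusSh p t) + modes p (GMinusSh p t) n (GPlusSh p) := by
    intro n hn
    rw [modes_TSh, TSh_eq, map_add, map_add, GPlusSh_GPlusSh p n hn, GMinusSh_GMinusSh p t n hn]
    abel
  rw [lambdaSum_eq_sum N _ _ 3, sum_range_succ, sum_range_succ, sum_range_one, Nat.cast_zero,
    Nat.cast_one, Nat.cast_ofNat, ← modes_apply, ← modes_apply, ← modes_apply, ← DSh_zero_apply,
    e 1 (by norm_num), e 2 (by norm_num), GPlusSh_one_GMinusSh_add, GPlusSh_two_GMinusSh_add,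
    TensorProduct.tmul_smul, smul_smul]
  · simp
  · intro j hj
    rw [← modes_apply, e j (by positivity),
      GPlusSh_three_GMinusSh_add p t j (by exact_mod_cast hj)]

theorem bracketOne_TSh_TSh (p : A → ZMod 2) (t : A → ℂ) :
    bracketOne (YOne p t) (TSh p t) (TSh p t) =
      (2 : ℂ) • ((1 : LambdaAlg 1) ⊗ₜ[ℂ] transl p (TSh p t))
        + (3 : ℂ) • (lam 1 ⊗ₜ[ℂ] TSh p t)
        + chi (0 : Fin 1) ⊗ₜ[ℂ] DSh p t 0 (TSh p t)
        + (cSh t / 3) • ((lam 1 ^ 2 * chi (0 : Fin 1)) ⊗ₜ[ℂ] vacuum p) := by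
  rw [bracketOne_YOne, lambdaSum_TSh_TSh, smul_add, smul_comm (chi (0 : Fin 1)),
    TensorProduct.smul_tmul', TensorProduct.smul_tmul', smul_eq_mul, smul_eq_mul, mul_one, sq,
    ← mul_assoc, ← lam_mul_comm, mul_assoc, ← lam_mul_comm, ← mul_assoc, DSh_zero_TSh,
    lambdaSum_LSh_TSh]
  abel

theorem bracketOne_TSh_JSh (p : A → ZMod 2) (t : A → ℂ) :
    bracketOne (YOne p t) (TSh p t) (JSh p t) =
      (2 : ℂ) • ((1 : LambdaAlg 1) ⊗ₜ[ℂ] transl p (JSh p t))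
        + (2 : ℂ) • (lam 1 ⊗ₜ[ℂ] JSh p t)
        + chi (0 : Fin 1) ⊗ₜ[ℂ] DSh p t 0 (JSh p t) := by
  rw [bracketOne_YOne, lambdaSum_TSh_JSh, TensorProduct.smul_tmul', smul_eq_mul, mul_one,
    DSh_zero_TSh, lambdaSum_LSh_JSh]

theorem bracketOne_JSh_JSh (p : A → ZMod 2) (t : A → ℂ) :
    bracketOne (YOne p t) (JSh p t) (JSh p t) =
      (1 : LambdaAlg 1) ⊗ₜ[ℂ] TSh p t
        + (cSh t / 3) • ((lam 1 * chi (0 : Fin 1)) ⊗ₜ[ℂ] vacuum p) := by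
  rw [bracketOne_YOne, DSh_zero_JSh, lambdaSum_GMinusSh_sub_JSh, lambdaSum_JSh_JSh,
    smul_comm (chi (0 : Fin 1)), TensorProduct.smul_tmul', smul_eq_mul, lam_mul_comm]

/-! ### Generated subalgebras -/

/-- The $D^i$ are combinations of the zero modes of $G^\pm$, so stability under them costs nothing
once $G^\pm$ lie in a subspace closed under products. -/
theorem DSh_mem {p : A → ZMod 2} {t : A → ℂ} {W : Submodule ℂ (Fch p)} (h₁ : GPlusSh p ∈ W)
    (h₂ : GMinusSh p t ∈ W) (hW : ∀ a ∈ W, ∀ b ∈ W, ∀ n, modes p a n b ∈ W) (i : Fin 2) {a : Fch p}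
    (ha : a ∈ W) : DSh p t i a ∈ W := by
  fin_cases i
  · simp only [Fin.zero_eta, DSh_zero, oddOp_apply]
    exact W.add_mem (W.smul_mem _ (hW _ h₁ _ ha 0)) (W.smul_mem _ (hW _ h₂ _ ha 0))
  · simp only [Fin.mk_one, DSh_one, oddOp_apply]
    exact W.add_mem (W.smul_mem _ (hW _ h₁ _ ha 0)) (W.smul_mem _ (hW _ h₂ _ ha 0))

theorem GPlusSh_GMinusSh_mem {p : A → ZMod 2} {t : A → ℂ} {W : Submodule ℂ (Fch p)}
    (hT : TSh p t ∈ W) (hG : GMinusSh p t - GPlusSh p ∈ W) :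
    GPlusSh p ∈ W ∧ GMinusSh p t ∈ W := by
  rw [TSh_eq] at hT
  have e1 : GPlusSh p = (2⁻¹ : ℂ) • ((GPlusSh p + GMinusSh p t) - (GMinusSh p t - GPlusSh p)) := by
    module
  have e2 : GMinusSh p t =
      (2⁻¹ : ℂ) • ((GPlusSh p + GMinusSh p t) + (GMinusSh p t - GPlusSh p)) := by
    module
  constructor
  · rw [e1]
    exact W.smul_mem _ (W.sub_mem hT hG)
  · rw [e2]
    exact W.smul_mem _ (W.add_mem hT hG)

theorem LSh_mem {p : A → ZMod 2} {t : A → ℂ} {W : Submodule ℂ (Fch p)}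
    (hT : DSh p t 0 (TSh p t) ∈ W) : LSh p t ∈ W := by
  rw [DSh_zero_TSh] at hT
  have := W.smul_mem (2⁻¹ : ℂ) hT
  rwa [smul_smul, inv_mul_cancel₀ two_ne_zero, one_smul] at this

theorem component_mem {p : A → ZMod 2} {t : A → ℂ} {W : Submodule ℂ (Fch p)}
    (hD : ∀ i, ∀ a ∈ W, DSh p t i a ∈ W) (S : Finset (Fin 2)) {a : Fch p} (ha : a ∈ W) :
    component p t S a ∈ W := by
  unfold component
  split_ifs
  exacts [W.neg_mem (hD _ _ (hD _ _ ha)), hD _ _ ha, hD _ _ ha, ha]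

/-- This and the next two lemmas bring the three generated subalgebras to one normal form, the
smallest subspace containing the vacuum and the four currents and closed under all products. -/
theorem generated_superfieldZero (p : A → ZMod 2) (t : A → ℂ) :
    generated (vacuum p) ![] (superfieldZero (stateField p))
        {LSh p t, GPlusSh p, GMinusSh p t, JSh p t} =
      sInf {W | vacuum p ∈ W ∧ (LSh p t ∈ W ∧ GPlusSh p ∈ W ∧ GMinusSh p t ∈ W ∧ JSh p t ∈ W) ∧
        ∀ a ∈ W, ∀ b ∈ W, ∀ n, modes p a n b ∈ W} := by
  unfold generated
  congr 1
  ext W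
  simp only [Set.mem_ofPred_eq, Set.insert_subset_iff, Set.singleton_subset_iff, SetLike.mem_coe]
  constructor
  · rintro ⟨h0, hs, -, hW⟩
    exact ⟨h0, hs, fun a ha b hb n => hW a ha b hb ∅ n⟩
  · rintro ⟨h0, hs, hW⟩
    exact ⟨h0, hs, fun i => i.elim0, fun a ha b hb _ n => hW a ha b hb n⟩

theorem generated_YOne (p : A → ZMod 2) (t : A → ℂ) :
    generated (vacuum p) ![DSh p t 0] (YOne p t) {TSh p t, JSh p t} =
      sInf {W | vacuum p ∈ W ∧ (LSh p t ∈ W ∧ GPlusSh p ∈ W ∧ GMinusSh p t ∈ W ∧ JSh p t ∈ W) ∧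
        ∀ a ∈ W, ∀ b ∈ W, ∀ n, modes p a n b ∈ W} := by
  unfold generated
  congr 1
  ext W
  simp only [Set.mem_ofPred_eq, Set.insert_subset_iff, Set.singleton_subset_iff, SetLike.mem_coe]
  constructor
  · rintro ⟨h0, ⟨hT, hJ⟩, hD, hW⟩
    have hD : ∀ a ∈ W, DSh p t 0 a ∈ W := hD 0
    have hJ' := hD _ hJ
    rw [DSh_zero_JSh] at hJ'
    obtain ⟨h1, h2⟩ := GPlusSh_GMinusSh_mem hT hJ'
    exact ⟨h0, ⟨LSh_mem (hD _ hT), h1, h2, hJ⟩, fun a ha b hb n => hW a ha b hb ∅ n⟩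
  · rintro ⟨h0, ⟨-, h1, h2, hJ⟩, hW⟩
    have hD : ∀ a ∈ W, DSh p t 0 a ∈ W := fun a ha => DSh_mem h1 h2 hW 0 ha
    refine ⟨h0, ⟨?_, hJ⟩, fun i => ?_, fun a ha b hb S n => ?_⟩
    · rw [TSh_eq]
      exact W.add_mem h1 h2
    · rw [Subsingleton.elim i 0]
      exact hD
    · unfold YOne superfieldOne
      rw [LinearMap.pi_apply]
      split_ifs
      · exact hW _ (hD a ha) b hb n
      · exact hW a ha b hb n

theorem generated_YTwo (p : A → ZMod 2) (t : A → ℂ) :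
    generated (vacuum p) (DSh p t) (YTwo p t) {PSh p t} =
      sInf {W | vacuum p ∈ W ∧ (LSh p t ∈ W ∧ GPlusSh p ∈ W ∧ GMinusSh p t ∈ W ∧ JSh p t ∈ W) ∧
        ∀ a ∈ W, ∀ b ∈ W, ∀ n, modes p a n b ∈ W} := by
  unfold generated
  congr 1
  ext W
  simp only [Set.mem_ofPred_eq, Set.singleton_subset_iff, SetLike.mem_coe, YTwo_ncoeff]
  constructor
  · rintro ⟨h0, hP, hD, hW⟩
    -- From $P$ alone: $J = iP$, $T = -D^2P$, then $G^- - G^+ = D^1J$ separates $G^+$ from $G^-$,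
    -- and $2L = D^1T$.
    have hJ : JSh p t ∈ W := by
      have := W.smul_mem Complex.I hP
      rwa [PSh, smul_smul, mul_neg, Complex.I_mul_I, neg_neg, one_smul] at this
    have hT : TSh p t ∈ W := by
      have := W.neg_mem (hD 1 _ hP)
      rwa [DSh_one_PSh, neg_neg] at this
    have hJ' := hD 0 _ hJ
    rw [DSh_zero_JSh] at hJ'
    obtain ⟨h1, h2⟩ := GPlusSh_GMinusSh_mem hT hJ'
    exact ⟨h0, ⟨LSh_mem (hD 0 _ hT), h1, h2, hJ⟩, fun a ha b hb n => hW a ha b hb ∅ n⟩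
  · rintro ⟨h0, ⟨-, h1, h2, hJ⟩, hW⟩
    have hD : ∀ i, ∀ a ∈ W, DSh p t i a ∈ W := fun i a ha => DSh_mem h1 h2 hW i ha
    exact ⟨h0, W.smul_mem _ hJ, hD, fun a ha b hb S n => hW _ (component_mem hD S ha) b hb n⟩

end Brackets

end SusyFree

end

/-! ### The theorem -/

open SusyFree in
theorem proposition4p18 {A : Type*} [Fintype A] (p : A → ZMod 2) (t : A → ℂ) :
    -- `D¹, D²` and the superfields `Y(v, z, θ¹, θ²)` make `F^ch` an `N_K = 2` SUSY vertex algebra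
    IsSusyVertexAlgebra (grade p) (vacuum p) (DSh p t) (YTwo p t) ∧
    (∀ i j, DSh p t i * DSh p t j + DSh p t j * DSh p t i =
      if i = j then (2 : ℂ) • transl p else 0) ∧
    (∀ i u v, bracketTwo (YTwo p t) (DSh p t i u) v =
      -(chi i • bracketTwo (YTwo p t) u v)) ∧
    -- the bracket `[P_Λ P] = (2∂ + 2λ + χ¹D¹ + χ²D²) P + (c/3) λχ¹χ²`
    bracketTwo (YTwo p t) (PSh p t) (PSh p t) =
      (2 : ℂ) • ((1 : LambdaAlg 2) ⊗ₜ[ℂ] transl p (PSh p t))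
        + (2 : ℂ) • (lam 2 ⊗ₜ[ℂ] PSh p t)
        + chi (0 : Fin 2) ⊗ₜ[ℂ] DSh p t 0 (PSh p t)
        + chi (1 : Fin 2) ⊗ₜ[ℂ] DSh p t 1 (PSh p t)
        + (cSh t / 3) • ((lam 2 * chi (0 : Fin 2) * chi (1 : Fin 2)) ⊗ₜ[ℂ] vacuum p) ∧
    -- `D¹` is the odd derivation `D` of `F^ch`
    (∀ a, DSh p t 0 (vec p (.phi a)) = vec p (.dphi a) ∧
      DSh p t 0 (vec p (.dphi a)) = transl p (vec p (.phi a)) ∧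
      DSh p t 0 (vec p (.phiBar a)) = vec p (.dphiBar a) ∧
      DSh p t 0 (vec p (.dphiBar a)) = transl p (vec p (.phiBar a))) ∧
    -- `T` and `J` satisfy the `N = 2` superconformal relations of central charge `c`
    bracketOne (YOne p t) (TSh p t) (TSh p t) =
      (2 : ℂ) • ((1 : LambdaAlg 1) ⊗ₜ[ℂ] transl p (TSh p t))
        + (3 : ℂ) • (lam 1 ⊗ₜ[ℂ] TSh p t)
        + chi (0 : Fin 1) ⊗ₜ[ℂ] DSh p t 0 (TSh p t)
        + (cSh t / 3) • ((lam 1 ^ 2 * chi (0 : Fin 1)) ⊗ₜ[ℂ] vacuum p) ∧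
    bracketOne (YOne p t) (TSh p t) (JSh p t) =
      (2 : ℂ) • ((1 : LambdaAlg 1) ⊗ₜ[ℂ] transl p (JSh p t))
        + (2 : ℂ) • (lam 1 ⊗ₜ[ℂ] JSh p t)
        + chi (0 : Fin 1) ⊗ₜ[ℂ] DSh p t 0 (JSh p t) ∧
    bracketOne (YOne p t) (JSh p t) (JSh p t) =
      (1 : LambdaAlg 1) ⊗ₜ[ℂ] TSh p t
        + (cSh t / 3) • ((lam 1 * chi (0 : Fin 1)) ⊗ₜ[ℂ] vacuum p) ∧
    -- the components of the superfield of `P`; the last one is the coefficient of `θ¹ θ²`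
    TSh p t = GPlusSh p + GMinusSh p t ∧
    YTwo p t (PSh p t) ∅ = -Complex.I • stateField p (JSh p t) ∧
    YTwo p t (PSh p t) {0} = -Complex.I • stateField p (GMinusSh p t - GPlusSh p) ∧
    YTwo p t (PSh p t) {1} = -stateField p (TSh p t) ∧
    YTwo p t (PSh p t) {0, 1} = (2 : ℂ) • stateField p (LSh p t) ∧
    -- `P` generates the symmetry algebra of `T` and `J`, which is that of `L`, `G⁺`, `G⁻` and `J`
    generated (vacuum p) (DSh p t) (YTwo p t) {PSh p t} =
      generated (vacuum p) ![DSh p t 0] (YOne p t) {TSh p t, JSh p t} ∧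
    generated (vacuum p) (DSh p t) (YTwo p t) {PSh p t} =
      generated (vacuum p) ![] (superfieldZero (stateField p))
        {LSh p t, GPlusSh p, GMinusSh p t, JSh p t} := by
  refine ⟨isSusyVertexAlgebra p t, DSh_anticommutator p t, bracketTwo_DSh p t, bracketTwo_PSh p t,
    DSh_zero_vec p t, bracketOne_TSh_TSh p t, bracketOne_TSh_JSh p t, bracketOne_JSh_JSh p t,
    TSh_eq p t, ?_, ?_, ?_, ?_, ?_, ?_⟩
  · rw [YTwo_apply, ← map_smul]
    rfl
  · rw [YTwo_apply, ← map_smul, ← DSh_zero_PSh]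
    rfl
  · rw [YTwo_apply, ← map_neg, ← DSh_one_PSh]
    rfl
  -- The coefficient of $\theta^1\theta^2$ is the field of $-D^1D^2P = D^1T = 2L$.
  · rw [YTwo_apply, ← map_smul, ← DSh_zero_TSh, ← neg_neg (DSh p t 0 (TSh p t)), ← map_neg,
      ← DSh_one_PSh]
    rfl
  · rw [generated_YTwo, generated_YOne]
  · rw [generated_YTwo, generated_superfieldZero]
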